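/- **Setting.** Let $I=[0,1]$, $X=\mathbb R\times I^{\mathbb N}$ with Lebesgue measure, $\rho:I^2\to I$ a measure-preserving Borel isomorphism, $\Omega$ a monoid, $\Gamma$ a subgroup of $\mathbb R^{\times}$. Let $\mathfrak{ll}_\rho$ be the monoid of maps of $X\times I$ generated by the affine maps $(a,s,e)\mapsto(\alpha a+l,s,e)$ with $\alpha\in\Gamma$, $l\in\mathbb R$, the finite permutations of the coordinates of $s$, the map $(a,(x,y)\bullet s,e)\mapsto(a,\rho(x,y)\bullet s,e)$ and its inverse, and $(a,x\bullet s,e)\mapsto(a,e\bullet s,x)$. Let $m:\Omega\to[0,\infty]$ satisfy $m(uv)=m(vu)$ and $|\alpha|\,m(w)=m(w)$ for all $\alpha\in\Gamma$, $w\in\Omega$ (the latter holds for every $m$ if $\Gamma\subseteq\{\pm1\}$, and for every $\Gamma$ if $m$ takes values in $\{0,\infty\}$). A *graphing* $F$ (with dialect $I$) has a measurable support $S\subseteq X$ and a set of edges, each with a measurable source in $S\times I$, a realiser, which is a Borel automorphism of $X\times I$ sending the source into $S\times I$, and a weight in $\Omega$. The *execution* $F\bowtie G$ has support $S^F\triangle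 S^G$; its edges are the alternating paths of edges of $F$ and $G$ (each acting on its own dialect) with non-null domain, restricted to start and end outside $S^F\cap S^G$; the product of the two dialects is identified with $I$ by $\rho$. The measurement $[\![F,G]\!]$ is the sum over the primitive alternating circuits $\pi$ of $\int_{\mathrm{supp}(\pi)} m(\omega(\pi)^{p(x)})/p(x)\,dx$, where $\mathrm{supp}(\pi)$ is the set of points with a finite orbit under the realiser of $\pi$ that stays in its domain, and $p(x)$ is the period of $x$. A *project* is a pair $(a,A)$ with $a\in\mathbb R\cup\{\infty\}$ ($\infty$ absorbing) and $A=\sum_i\alpha_iA_i$ a finite non-empty formal sum, with real coefficients, of graphings with the same support; put $1_A=\sum_i\alpha_i$. Put $\langle (a,A),(b,B)\rangle=a1_B+b1_A+\sum_{i,j}\alpha_i\beta_j[\![A_i,B_j]\!]$ and $(a,A)\bowtie(b,B)=(\langle (a,A),(b,B)\rangle,\sum_{i,j}\alpha_i\beta_jA_i\bowtie B_j)$, also written $\otimes$ when the supports are disjoint. Projects of equal support are orthogonal if $\langle\cdot,\cdot\rangle\ne0,\infty$. A *conduct* of support $V$ is a bi-orthogonally closed set of projects of support $V$ with realisers in $\mathfrak{ll}_\rho$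 (orthogonals are taken among such projects). For disjoint supports, $\mathbf A\otimes\mathbf B=\{\mathfrak a\otimes\mathfrak b\}^{\perp\perp}$, and $\mathbf A\multimap\mathbf B$ is the set of projects $\mathfrak f$ with realisers in $\mathfrak{ll}_\rho$, whose support is the union of the two supports, with $\mathfrak f\bowtie\mathfrak a\in\mathbf B$ for all $\mathfrak a\in\mathbf A$. For a graphing $A$, $!A$ is the graphing with the same edges and weights, an edge acting on $(a,(d,d')\bullet s,e)$ as it does in $A$ on $(a,s,d)$, leaving $d'$ and $e$ unchanged; $!\mathbf A=\{(0,!A)\mid(0,A)\in\mathbf A\}^{\perp\perp}$, where $(0,A)$ has a single graphing with coefficient $1$. For a Borel automorphism $T$ of $X$, $T(F)$ is $F$ transported along $T$. Let $$\mathrm{twist}(\lambda,(x,\rho(y,z))\bullet s)=(\lambda,(y,\rho(x,z))\bullet s),\qquad \mathrm{merge}(\lambda,(x,\rho(y,z))\bullet s)=(\lambda,(\rho(x,y),z)\bullet s).$$ Two graphings are variants if they differ by a measure-preserving Borel automorphism of the dialect. Equality of graphings is up to null sets (of sources, and of the points where realisers differ), ignoring edges with null source, and up to renaming of edges; equality of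 projects is up to equality of the graphings. **Theorem (functorial promotion).** Let $\mathbf A,\mathbf B$ be conducts of supports $V_A,V_B$, where every project in $\mathbf B$ has wager $0$. Let $\theta_A,\theta_B$ be affine transformations of the real line with ratio in $\Gamma$, acting on $X$, such that $V_A,V_B,\theta_A(V_A),\theta_B(V_B)$ are pairwise disjoint. Let $\mathfrak{prom}=(0,P)$, where $P$ has four edges of weight $1$: $\theta_A\circ\mathrm{twist}$ on the support $!V_A$ of perennisations of graphings of support $V_A$, $\theta_B\circ\mathrm{merge}\circ\mathrm{twist}$ on $!V_B$ (defined likewise), and their inverses on the images; all act trivially on the dialect. Then $$\mathfrak{prom}\in\bigl(!\theta_A(\mathbf A)\otimes{!(\mathbf A\multimap\mathbf B)}\bigr)\multimap{!\theta_B(\mathbf B)} .$$ Moreover, for all graphings $A,F$ with $(0,!\theta_A(A))\in{!\theta_A(\mathbf A)}$ and $(0,!F)\in{!(\mathbf A\multimap\mathbf B)}$, $$\mathfrak{prom}\bowtie\bigl((0,!\theta_A(A))\otimes(0,!F)\bigr)=\bigl(0,\theta_B(\mathrm{merge}(!A\bowtie\mathrm{twist}(!F)))\bigr),$$ and $\mathrm{merge}(!A\bowtie\mathrm{twist}(!F))={!D}$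 for some variant $D$ of $F\bowtie A$. -/

import Mathlib

open MeasureTheory
open scoped unitInterval ENNReal

namespace IG

/-! ## The space -/

/-- The space `ℝ × [0,1]^ℕ`. -/
abbrev X : Type := ℝ × (ℕ → I)

/-- The space times the dialect `[0,1]`. All dialects are transported to `[0,1]`. -/
abbrev XD : Type := X × I

/-- The space times the dialects of two graphings. -/
abbrev Y : Type := X × (I × I)

/-- Lebesgue measure on `ℝ × [0,1]^ℕ`. -/
noncomputable def muX : Measure X :=
  (volume : Measure ℝ).prod (Measure.infinitePi fun _ : ℕ => (volume : Measure I))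

noncomputable def muXD : Measure XD := muX.prod (volume : Measure I)

noncomputable def muY : Measure Y :=
  muX.prod ((volume : Measure I).prod (volume : Measure I))

/-- Concatenation `(d, s) ↦ d • s` of a point and a sequence. -/
def consEquiv : I × (ℕ → I) ≃ᵐ (ℕ → I) where
  toFun p := fun n => Nat.casesOn n p.1 p.2
  invFun s := (s 0, fun n => s (n + 1))
  left_inv _ := rfl
  right_inv s := by
    funext n
    cases n <;> rfl
  measurable_toFun := by
    refine measurable_pi_lambda _ fun n => ?_
    cases n with
    | zero => exact measurable_fst
    | succ n => exact (measurable_pi_apply n).comp measurable_snd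
  measurable_invFun :=
    (measurable_pi_apply 0).prodMk (measurable_pi_lambda _ fun n => measurable_pi_apply (n + 1))

/-- The map `B : X × [0,1] → X`, `((a, s), d) ↦ (a, d • s)`. -/
def B : XD ≃ᵐ X :=
  MeasurableEquiv.prodAssoc.trans
    ((MeasurableEquiv.refl ℝ).prodCongr (MeasurableEquiv.prodComm.trans consEquiv))

/-- `((a, s), (d, d')) ↦ (a, (d, d') • s)`. -/
def BB : Y ≃ᵐ X :=
  (((MeasurableEquiv.refl X).prodCongr MeasurableEquiv.prodComm).trans
    (MeasurableEquiv.prodAssoc.symm.trans (B.prodCongr (MeasurableEquiv.refl I)))).trans B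

/-- The affine transformation `(a, s) ↦ (α a + l, s)` of the space. -/
def affineX (α : ℝˣ) (l : ℝ) : X ≃ᵐ X :=
  MeasurableEquiv.prodCongr
    { toFun := fun a => (α : ℝ) * a + l
      invFun := fun a => ((α⁻¹ : ℝˣ) : ℝ) * (a - l)
      left_inv := fun a => by simp
      right_inv := fun a => by simp
      measurable_toFun := by
        show Measurable fun a : ℝ => (α : ℝ) * a + l
        fun_prop
      measurable_invFun := by
        show Measurable fun a : ℝ => ((α⁻¹ : ℝˣ) : ℝ) * (a - l)
        fun_prop }
    (MeasurableEquiv.refl (ℕ → I))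

/-- The map `(a, (x, y) • s) ↦ (a, t (x, y) • s)` for a Borel automorphism `t` of `[0,1]²`. -/
def onHead (t : I × I ≃ᵐ I × I) : X ≃ᵐ X :=
  BB.symm.trans (((MeasurableEquiv.refl X).prodCongr t).trans BB)

/-- `(a, (x, ρ (y, z)) • s) ↦ (a, (y, ρ (x, z)) • s)`. -/
def twist (ρ : I × I ≃ᵐ I) : X ≃ᵐ X :=
  onHead (((MeasurableEquiv.refl I).prodCongr ρ.symm).trans
    ((MeasurableEquiv.prodAssoc.symm.trans
      ((MeasurableEquiv.prodComm.prodCongr (MeasurableEquiv.refl I)).trans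
        MeasurableEquiv.prodAssoc)).trans
      ((MeasurableEquiv.refl I).prodCongr ρ)))

/-- `(a, (x, ρ (y, z)) • s) ↦ (a, (ρ (x, y), z) • s)`. -/
def merge (ρ : I × I ≃ᵐ I) : X ≃ᵐ X :=
  onHead (((MeasurableEquiv.refl I).prodCongr ρ.symm).trans
    (MeasurableEquiv.prodAssoc.symm.trans (ρ.prodCongr (MeasurableEquiv.refl I))))

/-! ## The microcosm -/

/-- The monoid of maps of `X × [0,1]` generated by the affine transformations of the real line
with ratio in `Γ`, the finite permutations of the coordinates of the Hilbert cube, the map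
`(a, (x, y) • s, e) ↦ (a, ρ (x, y) • s, e)` and its inverse, and the exchange
`(a, x • s, e) ↦ (a, e • s, x)`. -/
inductive Microcosm (ρ : I × I ≃ᵐ I) (Γ : Subgroup ℝˣ) : (XD → XD) → Prop
  | one : Microcosm ρ Γ id
  | comp {f g : XD → XD} : Microcosm ρ Γ f → Microcosm ρ Γ g → Microcosm ρ Γ (f ∘ g)
  | affine (α : ℝˣ) (hα : α ∈ Γ) (l : ℝ) :
      Microcosm ρ Γ fun z => (((α : ℝ) * z.1.1 + l, z.1.2), z.2)
  | perm (τ : Equiv.Perm ℕ) (hτ : {n | τ n ≠ n}.Finite) :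
      Microcosm ρ Γ fun z => ((z.1.1, fun n => z.1.2 (τ n)), z.2)
  | pair :
      Microcosm ρ Γ fun z =>
        ((z.1.1, consEquiv (ρ (z.1.2 0, z.1.2 1), fun n => z.1.2 (n + 2))), z.2)
  | unpair :
      Microcosm ρ Γ fun z =>
        ((z.1.1, consEquiv ((ρ.symm (z.1.2 0)).1,
          consEquiv ((ρ.symm (z.1.2 0)).2, fun n => z.1.2 (n + 1)))), z.2)
  | xch :
      Microcosm ρ Γ fun z => ((z.1.1, consEquiv (z.2, fun n => z.1.2 (n + 1))), z.1.2 0)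

/-! ## Graphings -/

/-- An `Ω`-weighted thick graphing with dialect `[0,1]` whose edges are realised by Borel
automorphisms of `X × [0,1]`. -/
structure Graphing (Ω : Type*) where
  supp : Set X
  measurable_supp : MeasurableSet supp
  E : Type
  source : E → Set XD
  measurable_source : ∀ e, MeasurableSet (source e)
  source_subset : ∀ e, ∀ z ∈ source e, z.1 ∈ supp
  real : E → XD ≃ᵐ XD
  target_subset : ∀ e, ∀ z ∈ source e, (real e z).1 ∈ supp
  weight : E → Ω

namespace Graphing

/-- All realisers lie in the microcosm. -/
def InMicrocosm {Ω : Type*} (ρ : I × I ≃ᵐ I) (Γ : Subgroup ℝˣ) (F : Graphing Ω) : Prop :=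
  ∀ e, Microcosm ρ Γ (F.real e)

/-- Equality of graphings up to null sets: same support, and a weight-preserving bijection
between the edges with non-null source, such that corresponding sources agree up to a null set
and corresponding realisers agree almost everywhere on the source. -/
def AEEq {Ω : Type*} (F G : Graphing Ω) : Prop :=
  F.supp = G.supp ∧
  ∃ θ : {e : F.E // muXD (F.source e) ≠ 0} ≃ {e : G.E // muXD (G.source e) ≠ 0},
    ∀ e, F.weight e.1 = G.weight (θ e).1 ∧
      F.source e.1 =ᵐ[muXD] G.source (θ e).1 ∧
      ∀ᵐ z ∂(muXD.restrict (F.source e.1)), F.real e.1 z = G.real (θ e).1 z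

/-- The graphing `T(F)` for a Borel automorphism `T` of the space: `F` transported along `T`. -/
def mapX {Ω : Type*} (T : X ≃ᵐ X) (F : Graphing Ω) : Graphing Ω where
  supp := T '' F.supp
  measurable_supp := T.measurableSet_image.2 F.measurable_supp
  E := F.E
  source e := (T.prodCongr (MeasurableEquiv.refl I)) '' F.source e
  measurable_source e :=
    (T.prodCongr (MeasurableEquiv.refl I)).measurableSet_image.2 (F.measurable_source e)
  source_subset e := by
    rintro _ ⟨z, hz, rfl⟩
    exact ⟨z.1, F.source_subset e z hz, rfl⟩
  real e := (T.prodCongr (MeasurableEquiv.refl I)).symm.trans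
    ((F.real e).trans (T.prodCongr (MeasurableEquiv.refl I)))
  target_subset e := by
    rintro _ ⟨z, hz, rfl⟩
    refine ⟨(F.real e z).1, F.target_subset e z hz, ?_⟩
    simp only [MeasurableEquiv.trans_apply, MeasurableEquiv.symm_apply_apply]
    rfl
  weight := F.weight

/-- The graphing `(Id × φ)(F)`, for a Borel automorphism `φ` of the dialect. -/
def mapD {Ω : Type*} (φ : I ≃ᵐ I) (F : Graphing Ω) : Graphing Ω where
  supp := F.supp
  measurable_supp := F.measurable_supp
  E := F.E
  source e := ((MeasurableEquiv.refl X).prodCongr φ) '' F.source e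
  measurable_source e :=
    ((MeasurableEquiv.refl X).prodCongr φ).measurableSet_image.2 (F.measurable_source e)
  source_subset e := by
    rintro _ ⟨z, hz, rfl⟩
    exact F.source_subset e z hz
  real e := ((MeasurableEquiv.refl X).prodCongr φ).symm.trans
    ((F.real e).trans ((MeasurableEquiv.refl X).prodCongr φ))
  target_subset e := by
    rintro _ ⟨z, hz, rfl⟩
    simp only [MeasurableEquiv.trans_apply, MeasurableEquiv.symm_apply_apply]
    exact F.target_subset e z hz
  weight := F.weight

/-- `F` is a variant of `G`: up to null sets, `F` is `G` after a renaming of the dialect by an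
automorphism of the probability space `[0,1]`. -/
def IsVariant {Ω : Type*} (F G : Graphing Ω) : Prop :=
  ∃ φ : I ≃ᵐ I, MeasurePreserving φ volume volume ∧ F.AEEq (mapD φ G)

/-! ### Alternating paths -/

/-- Realiser, on the space times both dialects, of an edge of `F` or of `G`. An edge of one
graphing leaves the dialect of the other one unchanged. -/
def step {Ω : Type*} (F G : Graphing Ω) : F.E ⊕ G.E → Y ≃ᵐ Y
  | .inl e => MeasurableEquiv.prodAssoc.symm.trans
      (((F.real e).prodCongr (MeasurableEquiv.refl I)).trans MeasurableEquiv.prodAssoc)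
  | .inr e => ((MeasurableEquiv.refl X).prodCongr MeasurableEquiv.prodComm).trans
      ((MeasurableEquiv.prodAssoc.symm.trans
        (((G.real e).prodCongr (MeasurableEquiv.refl I)).trans MeasurableEquiv.prodAssoc)).trans
        ((MeasurableEquiv.refl X).prodCongr MeasurableEquiv.prodComm))

/-- Source, in the space times both dialects, of an edge of `F` or of `G`. -/
def stepSource {Ω : Type*} (F G : Graphing Ω) : F.E ⊕ G.E → Set Y
  | .inl e => {y | (y.1, y.2.1) ∈ F.source e}
  | .inr e => {y | (y.1, y.2.2) ∈ G.source e}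

/-- Realiser of a path; the first edge of the list is followed first. -/
def pathReal {Ω : Type*} (F G : Graphing Ω) : List (F.E ⊕ G.E) → (Y ≃ᵐ Y)
  | [] => MeasurableEquiv.refl Y
  | e :: w => (step F G e).trans (pathReal F G w)

/-- Maximal domain of a path. -/
def pathSource {Ω : Type*} (F G : Graphing Ω) : List (F.E ⊕ G.E) → Set Y
  | [] => Set.univ
  | e :: w => stepSource F G e ∩ step F G e ⁻¹' pathSource F G w

/-- Weight `ω(e_k) ⋯ ω(e_1)` of the path `e_1 ⋯ e_k`. -/
def pathWeight {Ω : Type*} [Monoid Ω] (F G : Graphing Ω) : List (F.E ⊕ G.E) → Ω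
  | [] => 1
  | e :: w => pathWeight F G w * Sum.elim F.weight G.weight e

/-- Alternating paths: non-empty, alternating between `F` and `G`, with non-null domain. -/
def IsAltPath {Ω : Type*} (F G : Graphing Ω) (w : List (F.E ⊕ G.E)) : Prop :=
  w ≠ [] ∧ w.IsChain (fun e e' => e.isLeft ≠ e'.isLeft) ∧ muY (pathSource F G w) ≠ 0

/-- The part of the domain of a path that lies, together with its image, outside the cut. -/
def outerSource {Ω : Type*} (F G : Graphing Ω) (w : List (F.E ⊕ G.E)) : Set Y :=
  {y | y ∈ pathSource F G w ∧ y.1 ∉ F.supp ∩ G.supp ∧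
    (pathReal F G w y).1 ∉ F.supp ∩ G.supp}

theorem measurableSet_stepSource {Ω : Type*} (F G : Graphing Ω) (e : F.E ⊕ G.E) :
    MeasurableSet (stepSource F G e) := by
  cases e with
  | inl e =>
    have h : Measurable fun y : Y => (y.1, y.2.1) := by fun_prop
    exact h (F.measurable_source e)
  | inr e =>
    have h : Measurable fun y : Y => (y.1, y.2.2) := by fun_prop
    exact h (G.measurable_source e)

theorem measurableSet_pathSource {Ω : Type*} (F G : Graphing Ω) (w : List (F.E ⊕ G.E)) :
    MeasurableSet (pathSource F G w) := by
  induction w with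
  | nil => exact MeasurableSet.univ
  | cons e w ih =>
    exact (measurableSet_stepSource F G e).inter ((step F G e).measurable ih)

theorem measurableSet_outerSource {Ω : Type*} (F G : Graphing Ω) (w : List (F.E ⊕ G.E)) :
    MeasurableSet (outerSource F G w) := by
  have hC : MeasurableSet (F.supp ∩ G.supp) := F.measurable_supp.inter G.measurable_supp
  have h2 : Measurable fun y : Y => (pathReal F G w y).1 :=
    measurable_fst.comp (pathReal F G w).measurable
  exact (measurableSet_pathSource F G w).inter
    ((measurable_fst hC.compl).inter (h2 hC.compl))

theorem stepSource_fst {Ω : Type*} (F G : Graphing Ω) (e : F.E ⊕ G.E) {y : Y}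
    (hy : y ∈ stepSource F G e) :
    y.1 ∈ F.supp ∪ G.supp ∧ (step F G e y).1 ∈ F.supp ∪ G.supp := by
  cases e with
  | inl e => exact ⟨.inl (F.source_subset e _ hy), .inl (F.target_subset e _ hy)⟩
  | inr e => exact ⟨.inr (G.source_subset e _ hy), .inr (G.target_subset e _ hy)⟩

theorem pathSource_fst {Ω : Type*} (F G : Graphing Ω) (w : List (F.E ⊕ G.E)) (hw : w ≠ [])
    {y : Y} (hy : y ∈ pathSource F G w) :
    y.1 ∈ F.supp ∪ G.supp ∧ (pathReal F G w y).1 ∈ F.supp ∪ G.supp := by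
  induction w generalizing y with
  | nil => exact absurd rfl hw
  | cons e w ih =>
    refine ⟨(stepSource_fst F G e hy.1).1, ?_⟩
    cases w with
    | nil => exact (stepSource_fst F G e hy.1).2
    | cons e' w => exact (ih (List.cons_ne_nil _ _) hy.2).2

/-- Execution `F ⋈ G`: the support is the symmetric difference of the supports, the edges are the
alternating paths restricted to start and end outside the cut. The product of the two dialects
is identified with `[0,1]` along `ρ`. -/
def exec {Ω : Type*} [Monoid Ω] (ρ : I × I ≃ᵐ I) (F G : Graphing Ω) : Graphing Ω where
  supp := symmDiff F.supp G.supp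
  measurable_supp := F.measurable_supp.symmDiff G.measurable_supp
  E := {w : List (F.E ⊕ G.E) // IsAltPath F G w}
  source w := ((MeasurableEquiv.refl X).prodCongr ρ) '' outerSource F G w.1
  measurable_source w :=
    ((MeasurableEquiv.refl X).prodCongr ρ).measurableSet_image.2
      (measurableSet_outerSource F G w.1)
  source_subset w := by
    rintro _ ⟨y, hy, rfl⟩
    have h := (pathSource_fst F G w.1 w.2.1 hy.1).1
    have h' := hy.2.1
    show y.1 ∈ symmDiff F.supp G.supp
    rw [Set.mem_symmDiff]
    simp only [Set.mem_union, Set.mem_inter_iff] at h h'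
    tauto
  real w := ((MeasurableEquiv.refl X).prodCongr ρ).symm.trans
    ((pathReal F G w.1).trans ((MeasurableEquiv.refl X).prodCongr ρ))
  target_subset w := by
    rintro _ ⟨y, hy, rfl⟩
    have h := (pathSource_fst F G w.1 w.2.1 hy.1).2
    have h' := hy.2.2
    simp only [MeasurableEquiv.trans_apply, MeasurableEquiv.symm_apply_apply]
    show (pathReal F G w.1 y).1 ∈ symmDiff F.supp G.supp
    rw [Set.mem_symmDiff]
    simp only [Set.mem_union, Set.mem_inter_iff] at h h'
    tauto
  weight w := pathWeight F G w.1

/-! ### Measurement -/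

/-- A non-empty word that is not a proper power. -/
def IsPrimitive {α : Type*} (w : List α) : Prop :=
  w ≠ [] ∧ ∀ (u : List α) (n : ℕ), w = (List.replicate n u).flatten → n = 1

/-- The closed alternating path `f₁ g₁ f₂ g₂ ⋯` given by a list of pairs of edges. -/
def cycleWord {Ω : Type*} (F G : Graphing Ω) (w : List (F.E × G.E)) : List (F.E ⊕ G.E) :=
  w.flatMap fun p => [.inl p.1, .inr p.2]

/-- The support of a cycle: the points with a finite orbit under its realiser that stays in its
domain. -/
def cycleSupp {Ω : Type*} (F G : Graphing Ω) (w : List (F.E × G.E)) : Set Y :=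
  {y | 0 < Function.minimalPeriod (pathReal F G (cycleWord F G w)) y ∧
    ∀ n : ℕ, (pathReal F G (cycleWord F G w))^[n] y ∈ pathSource F G (cycleWord F G w)}

/-- The value of a cycle `π`: the integral over its support of `m(ω(π)^p) / p`, where `p` is the
period of the point under the realiser of `π`. -/
noncomputable def cycleValue {Ω : Type*} [Monoid Ω] (m : Ω → ℝ≥0∞) (F G : Graphing Ω)
    (w : List (F.E × G.E)) : ℝ≥0∞ :=
  ∫⁻ y in cycleSupp F G w,
    m (pathWeight F G (cycleWord F G w) ^
        Function.minimalPeriod (pathReal F G (cycleWord F G w)) y) /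
      (Function.minimalPeriod (pathReal F G (cycleWord F G w)) y : ℝ≥0∞) ∂muY

/-- The measurement: the sum over the primitive alternating circuits (cycles up to cyclic
permutation) of the value of a representative. -/
noncomputable def meas {Ω : Type*} [Monoid Ω] (m : Ω → ℝ≥0∞) (F G : Graphing Ω) : ℝ≥0∞ :=
  ∑' c : {c : Cycle (F.E × G.E) //
      IsPrimitive (Quotient.out (s := List.IsRotated.setoid (F.E × G.E)) c)},
    cycleValue m F G (Quotient.out (s := List.IsRotated.setoid (F.E × G.E)) c.1)

/-! ### Perennisation -/

end Graphing

/-- The support of the perennisation of a graphing of support `V`: the points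
`(a, (d, d') • s)` with `(a, s) ∈ V`. -/
def bangSupp (V : Set X) : Set X := {x | (BB.symm x).1 ∈ V}

theorem measurableSet_bangSupp {V : Set X} (hV : MeasurableSet V) :
    MeasurableSet (bangSupp V) :=
  (measurable_fst.comp BB.symm.measurable) hV

namespace Graphing

/-- Perennisation: on `(a, (d, d') • s, e)` an edge acts as on `(a, s, d)`, and leaves the fresh
copy `d'` and the dialect `e` unchanged. -/
def bang {Ω : Type*} (F : Graphing Ω) : Graphing Ω where
  supp := bangSupp F.supp
  measurable_supp := measurableSet_bangSupp F.measurable_supp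
  E := F.E
  source e := {z | ((BB.symm z.1).1, (BB.symm z.1).2.1) ∈ F.source e}
  measurable_source e := by
    have h : Measurable fun z : XD => ((BB.symm z.1).1, (BB.symm z.1).2.1) := by fun_prop
    exact h (F.measurable_source e)
  source_subset e := fun _ hz => F.source_subset e (_, _) hz
  real e := MeasurableEquiv.prodCongr
    (BB.symm.trans ((MeasurableEquiv.prodAssoc.symm.trans
      (((F.real e).prodCongr (MeasurableEquiv.refl I)).trans MeasurableEquiv.prodAssoc)).trans BB))
    (MeasurableEquiv.refl I)
  target_subset e := by
    intro z hz
    show (BB.symm (BB _)).1 ∈ F.supp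
    rw [MeasurableEquiv.symm_apply_apply]
    exact F.target_subset e _ hz
  weight := F.weight

/-- The dialect-free graphing of weight `1` exchanging `V` with `S(V)` along `S`, and `W` with
`T(W)` along `T`: four edges, in two pairs of mutually inverse edges. -/
def links {Ω : Type*} [Monoid Ω] (V W : Set X) (hV : MeasurableSet V) (hW : MeasurableSet W)
    (S T : X ≃ᵐ X) : Graphing Ω where
  supp := (V ∪ S '' V) ∪ (W ∪ T '' W)
  measurable_supp :=
    (hV.union (S.measurableSet_image.2 hV)).union (hW.union (T.measurableSet_image.2 hW))
  E := Bool × Bool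
  source
    | (false, false) => {z | z.1 ∈ V}
    | (false, true) => {z | z.1 ∈ S '' V}
    | (true, false) => {z | z.1 ∈ W}
    | (true, true) => {z | z.1 ∈ T '' W}
  measurable_source
    | (false, false) => measurable_fst hV
    | (false, true) => measurable_fst (S.measurableSet_image.2 hV)
    | (true, false) => measurable_fst hW
    | (true, true) => measurable_fst (T.measurableSet_image.2 hW)
  source_subset
    | (false, false) => fun _ h => .inl (.inl h)
    | (false, true) => fun _ h => .inl (.inr h)
    | (true, false) => fun _ h => .inr (.inl h)
    | (true, true) => fun _ h => .inr (.inr h)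
  real
    | (false, false) => S.prodCongr (MeasurableEquiv.refl I)
    | (false, true) => S.symm.prodCongr (MeasurableEquiv.refl I)
    | (true, false) => T.prodCongr (MeasurableEquiv.refl I)
    | (true, true) => T.symm.prodCongr (MeasurableEquiv.refl I)
  target_subset
    | (false, false) => fun z h => .inl (.inr ⟨z.1, h, rfl⟩)
    | (false, true) => by
        rintro ⟨_, d⟩ ⟨x, hx, rfl⟩
        exact .inl (.inl (by
          show S.symm (S x) ∈ V
          rwa [MeasurableEquiv.symm_apply_apply]))
    | (true, false) => fun z h => .inr (.inr ⟨z.1, h, rfl⟩)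
    | (true, true) => by
        rintro ⟨_, d⟩ ⟨x, hx, rfl⟩
        exact .inr (.inl (by
          show T.symm (T x) ∈ W
          rwa [MeasurableEquiv.symm_apply_apply]))
  weight _ := 1

/-- The graphing of the project `prom`, for delocations `θA` and `θB`. It links the location
`V_A` of `!(A ⊸ B)` to the location of `!θA(A)` along `θA ∘ twist`, and the location `V_B` of
`!(A ⊸ B)` to the location of `!θB(B)` along `θB ∘ merge ∘ twist`. -/
def prom {Ω : Type*} [Monoid Ω] (ρ : I × I ≃ᵐ I) (VA VB : Set X) (hA : MeasurableSet VA)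
    (hB : MeasurableSet VB) (θA θB : X ≃ᵐ X) : Graphing Ω :=
  links (bangSupp VA) (bangSupp VB) (measurableSet_bangSupp hA) (measurableSet_bangSupp hB)
    ((twist ρ).trans θA) ((twist ρ).trans ((merge ρ).trans θB))

end Graphing

/-! ## Projects -/

/-- A project: a wager in `ℝ ∪ {∞}` and a formal sum, finite and non-empty, with real
coefficients, of graphings of the same support. -/
structure Project (Ω : Type*) where
  wager : WithTop ℝ
  supp : Set X
  measurable_supp : MeasurableSet supp
  ι : Type
  [fintype : Fintype ι]
  [nonempty : Nonempty ι]
  coeff : ι → ℝ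
  slice : ι → Graphing Ω
  slice_supp : ∀ i, (slice i).supp = supp

attribute [instance] Project.fintype Project.nonempty

/-- Multiplication of an element of `ℝ ∪ {∞}` by a real number; `∞` is absorbing. -/
def wmul (r : ℝ) (x : WithTop ℝ) : WithTop ℝ := x.map fun t => r * t

/-- The embedding of `[0, ∞]` into `ℝ ∪ {∞}`. -/
def toW (x : ℝ≥0∞) : WithTop ℝ := WithTop.map (fun t : NNReal => (t : ℝ)) x

namespace Project

/-- The sum of the coefficients. -/
def unit {Ω : Type*} (a : Project Ω) : ℝ := ∑ i, a.coeff i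

def InMicrocosm {Ω : Type*} (ρ : I × I ≃ᵐ I) (Γ : Subgroup ℝˣ) (a : Project Ω) : Prop :=
  ∀ i, (a.slice i).InMicrocosm ρ Γ

/-- The project `(0, F)`. The balanced projects are those of this form. -/
def single {Ω : Type*} (F : Graphing Ω) : Project Ω where
  wager := 0
  supp := F.supp
  measurable_supp := F.measurable_supp
  ι := Unit
  coeff _ := 1
  slice _ := F
  slice_supp _ := rfl

/-- Equality of projects up to null sets and renaming of the index set of the formal sum. -/
def AEEq {Ω : Type*} (a b : Project Ω) : Prop :=
  a.wager = b.wager ∧ a.supp = b.supp ∧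
  ∃ θ : a.ι ≃ b.ι, ∀ i, a.coeff i = b.coeff (θ i) ∧ (a.slice i).AEEq (b.slice (θ i))

/-- Transport (delocation) of a project along a Borel automorphism of the space. -/
def mapX {Ω : Type*} (T : X ≃ᵐ X) (a : Project Ω) : Project Ω where
  wager := a.wager
  supp := T '' a.supp
  measurable_supp := T.measurableSet_image.2 a.measurable_supp
  ι := a.ι
  coeff := a.coeff
  slice i := (a.slice i).mapX T
  slice_supp i := congrArg (fun S => T '' S) (a.slice_supp i)

/-- The measurement `a · 1_B + b · 1_A + ⟦A, B⟧` of two projects `(a, A)` and `(b, B)`. -/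
noncomputable def meas {Ω : Type*} [Monoid Ω] (m : Ω → ℝ≥0∞) (a b : Project Ω) : WithTop ℝ :=
  wmul b.unit a.wager + wmul a.unit b.wager +
    ∑ p : a.ι × b.ι,
      wmul (a.coeff p.1 * b.coeff p.2) (toW ((a.slice p.1).meas m (b.slice p.2)))

/-- Orthogonality. -/
def Orth {Ω : Type*} [Monoid Ω] (m : Ω → ℝ≥0∞) (a b : Project Ω) : Prop :=
  a.supp = b.supp ∧ a.meas m b ≠ 0 ∧ a.meas m b ≠ ⊤

/-- Execution of projects, `(a, A) ⋈ (b, B) = (a · 1_B + b · 1_A + ⟦A, B⟧, A ⋈ B)`. For disjoint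
supports this is the tensor product of projects. -/
noncomputable def exec {Ω : Type*} [Monoid Ω] (m : Ω → ℝ≥0∞) (ρ : I × I ≃ᵐ I)
    (a b : Project Ω) : Project Ω where
  wager := a.meas m b
  supp := symmDiff a.supp b.supp
  measurable_supp := a.measurable_supp.symmDiff b.measurable_supp
  ι := a.ι × b.ι
  coeff p := a.coeff p.1 * b.coeff p.2
  slice p := (a.slice p.1).exec ρ (b.slice p.2)
  slice_supp p := congrArg₂ symmDiff (a.slice_supp p.1) (b.slice_supp p.2)

end Project

/-! ## Conducts -/

/-- The orthogonal of a set of projects of support `V`, among the projects of support `V` whose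
realisers lie in the microcosm. -/
def polar {Ω : Type*} [Monoid Ω] (m : Ω → ℝ≥0∞) (ρ : I × I ≃ᵐ I) (Γ : Subgroup ℝˣ) (V : Set X)
    (T : Set (Project Ω)) : Set (Project Ω) :=
  {a | a.supp = V ∧ a.InMicrocosm ρ Γ ∧ ∀ b ∈ T, a.Orth m b}

def bipolar {Ω : Type*} [Monoid Ω] (m : Ω → ℝ≥0∞) (ρ : I × I ≃ᵐ I) (Γ : Subgroup ℝˣ) (V : Set X)
    (T : Set (Project Ω)) : Set (Project Ω) :=
  polar m ρ Γ V (polar m ρ Γ V T)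

/-- Conducts of support `V`: bi-orthogonally closed sets of projects. -/
def IsConduct {Ω : Type*} [Monoid Ω] (m : Ω → ℝ≥0∞) (ρ : I × I ≃ᵐ I) (Γ : Subgroup ℝˣ)
    (V : Set X) (T : Set (Project Ω)) : Prop :=
  MeasurableSet V ∧ bipolar m ρ Γ V T = T

/-- `A ⊗ B`, for `A` and `B` of disjoint supports `V` and `W`. -/
def tensor {Ω : Type*} [Monoid Ω] (m : Ω → ℝ≥0∞) (ρ : I × I ≃ᵐ I) (Γ : Subgroup ℝˣ)
    (V W : Set X) (A B : Set (Project Ω)) : Set (Project Ω) :=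
  bipolar m ρ Γ (V ∪ W) {c | ∃ a ∈ A, ∃ b ∈ B, c = a.exec m ρ b}

/-- `A ⊸ B`, for `A` and `B` of disjoint supports `V` and `W`. -/
def lolli {Ω : Type*} [Monoid Ω] (m : Ω → ℝ≥0∞) (ρ : I × I ≃ᵐ I) (Γ : Subgroup ℝˣ)
    (V W : Set X) (A B : Set (Project Ω)) : Set (Project Ω) :=
  {f | f.supp = V ∪ W ∧ f.InMicrocosm ρ Γ ∧ ∀ a ∈ A, f.exec m ρ a ∈ B}

/-- `!A`, for `A` of support `V`: the bi-orthogonal closure of the perennisations of the balanced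
projects of `A`. -/
def ofCourse {Ω : Type*} [Monoid Ω] (m : Ω → ℝ≥0∞) (ρ : I × I ≃ᵐ I) (Γ : Subgroup ℝˣ)
    (V : Set X) (A : Set (Project Ω)) : Set (Project Ω) :=
  bipolar m ρ Γ (bangSupp V)
    {c | ∃ F : Graphing Ω, Project.single F ∈ A ∧ c = Project.single F.bang}

end IG

open IG

/-! What `prom` computes is seen by following paths. Outside the cut, a path of `prom` against
`!θA(G) ⊗ !F` has to start in the region of `θB(B)`, go back along `θB ∘ merge ∘ twist` to the
region of `V_B`, run through an edge of `!F`, perhaps visit `!θA(G)` and return to `!F` several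
times, and finally leave the way it came. The edges of `prom` have weight 1 and only change
coordinates; without them the path reads `f₀ g₁ f₁ ⋯ gₙ fₙ`, an alternating path of `!G` and
`twist(!F)`, and up to null sets every edge of their execution arises in this way (`Loc.Exp`,
`Graphing.prom_exec_aeEq`). On a point `(a, (p, ρ(q, z)) • s)`, `!G` uses `p` as its dialect and
`twist(!F)` uses `q`. So the two dialects are independent, and `merge` packs them into one: the
result is `!(G ⋈ F)` (`Graphing.merge_exec_twist_eEq`). Exchanging the two dialects shows that `G ⋈
F` is a variant of `F ⋈ G` (`Graphing.exec_isVariant`).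

Membership rests on the trefoil property (`Graphing.meas_exec_add`): if no point lies in all three
supports, `⟦F ⋈ G, H⟧ + ⟦F, G⟧` is symmetric in the three graphings. To obtain it, the measurement
is written as a sum over all closed alternating words `w` of `m(ω(w)) μ(prim w) / |w|`
(`Graphing.meas_eq_cyc`), where `prim w` consists of the points that return along `w` but not along
a proper root of it. Powers of primitive circuits account for the periods, and each term is
invariant under rotation of `w`, because `m(uv) = m(vu)` and `m` absorbs the ratios in `Γ`. A closed
word in the edges of `F`, `G`, `H` that visits `H` is cut after each letter of `H`, which gives a
cycle of `F ⋈ G` and `H`; the words that avoid `H` make up `⟦F, G⟧`. The passage between words and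
words of blocks is `Sys.Covers.cyc_eq`.

For projects, the trefoil property makes the joint measurement of three projects symmetric, whence
the adjunctions `meas_exec_exec` and `meas_exec_tensor`. A test of `!θB(B)` is moved onto `prom`,
and the bi-orthogonal closures in the definitions of `⊗` and `!` are removed one after the other,
until only perennisations `!θA(G)` and `!F` remain, with `(0, G)` in `A` and `(0, F)` in `A ⊸ B`
(`prom_mem_lolli`). For these the result is `(0, !θB(G ⋈ F))` (`nondeg_prom_tensor`): `G ⋈ F` has
the same measurements as `F ⋈ G`, hence lies in `B`; and the wager vanishes, because the cycles
between `prom` and its arguments come from those between `G` and `F` (`Graphing.meas_prom_eq_zero`),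
while `⟦F, G⟧` is the wager of a project of `B`.

In the formula for the value of `prom`, the perennisations are only known to lie in the closures, so
that this argument for the wager is not available. It is replaced by the membership just proved: all
projects of `!θB(B)` have wager 0 (`wager_eq_zero`). -/

namespace IG

/-! ## Combinatorics of words -/

namespace Words

variable {L L' : Type*}

/-- A family of words which all end in a marked letter and contain no other marked letter. -/
def IsBlockCode (M : L → Prop) (β : L' → List L) : Prop :=
  Function.Injective β ∧ ∀ l, ∃ u a, β l = u ++ [a] ∧ M a ∧ ∀ b ∈ u, ¬ M b

/-- The first marked letter determines where both words are cut. -/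
theorem append_marked_inj {M : L → Prop} {u u' : List L} {a a' : L} {r r' : List L}
    (hu : ∀ b ∈ u, ¬ M b) (hu' : ∀ b ∈ u', ¬ M b) (ha : M a) (ha' : M a')
    (h : u ++ a :: r = u' ++ a' :: r') : u = u' ∧ a = a' ∧ r = r' := by
  induction u generalizing u' with
  | nil =>
    cases u' with
    | nil => simpa using h
    | cons b u' =>
      simp only [List.nil_append, List.cons_append, List.cons.injEq] at h
      exact absurd (h.1 ▸ ha) (hu' b (by simp))
  | cons c u ih =>
    cases u' with
    | nil =>
      simp only [List.nil_append, List.cons_append, List.cons.injEq] at h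
      exact absurd (h.1 ▸ ha') (hu c (by simp))
    | cons b u' =>
      simp only [List.cons_append, List.cons.injEq] at h
      obtain ⟨rfl, h⟩ := h
      obtain ⟨rfl, h2⟩ := ih (fun b hb => hu b (by simp [hb])) (fun b hb => hu' b (by simp [hb])) h
      exact ⟨rfl, h2⟩

theorem IsBlockCode.flatMap_injective {M : L → Prop} {β : L' → List L} (h : IsBlockCode M β) :
    Function.Injective (List.flatMap β) := by
  intro W W' e
  induction W generalizing W' with
  | nil =>
    cases W' with
    | nil => rfl
    | cons l W' =>
      obtain ⟨u, a, hl, -⟩ := h.2 l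
      simp [hl] at e
  | cons l W ih =>
    obtain ⟨u, a, hl, ha, hu⟩ := h.2 l
    cases W' with
    | nil => simp [hl] at e
    | cons l' W' =>
      obtain ⟨u', a', hl', ha', hu'⟩ := h.2 l'
      simp only [List.flatMap_cons, hl, hl', List.append_assoc, List.singleton_append] at e
      obtain ⟨rfl, rfl, e'⟩ := append_marked_inj hu hu' ha ha' e
      rw [ih e', h.1 (hl.trans hl'.symm)]

/-- Marked letters occur only at the ends of blocks, so a prefix that ends in one stops at a block
boundary. -/
theorem IsBlockCode.exists_split {M : L → Prop} {β : L' → List L} (h : IsBlockCode M β)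
    {W : List L'} {u v : List L} {a : L} (ha : M a) (e : W.flatMap β = (u ++ [a]) ++ v) :
    ∃ W₁ W₂, W = W₁ ++ W₂ ∧ u ++ [a] = W₁.flatMap β ∧ v = W₂.flatMap β := by
  induction W generalizing u with
  | nil => simp at e
  | cons l W ih =>
    obtain ⟨u', a', hl, ha', hu'⟩ := h.2 l
    rw [List.flatMap_cons, List.append_eq_append_iff] at e
    rcases e with ⟨x, hx, hW⟩ | ⟨x, hx, hv⟩
    · rcases List.eq_nil_or_concat x with rfl | ⟨x, b, rfl⟩
      · refine ⟨[l], W, rfl, by simpa using hx, by simpa using hW.symm⟩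
      · have hb : a = b := by
          rw [List.concat_eq_append, ← List.append_assoc] at hx
          exact (List.append_inj' hx rfl).2 |> fun t => by simpa using t
        subst hb
        obtain ⟨W₁, W₂, rfl, h1, h2⟩ := ih (u := x) (by simpa using hW)
        exact ⟨l :: W₁, W₂, rfl, by rw [hx, List.flatMap_cons, ← h1, List.concat_eq_append], h2⟩
    · rcases List.eq_nil_or_concat x with rfl | ⟨x, b, rfl⟩
      · refine ⟨[l], W, rfl, by simpa using hx.symm, by simpa using hv⟩
      · rw [hl, List.concat_eq_append, ← List.append_assoc] at hx
        have := (List.append_inj' hx rfl).1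
        exact absurd ha (hu' a (by simp [this]))

open Classical in
-- Each block contains exactly one marked letter. This turns the denominator in `tsum_marked` into
-- the number of blocks.
theorem IsBlockCode.countP_flatMap {M : L → Prop} {β : L' → List L} (h : IsBlockCode M β)
    (W : List L') : (W.flatMap β).countP (fun a => decide (M a)) = W.length := by
  induction W with
  | nil => rfl
  | cons l W ih =>
    obtain ⟨u, a, hl, ha, hu⟩ := h.2 l
    have hu0 : u.countP (fun a => decide (M a)) = 0 := by
      rw [List.countP_eq_zero]
      intro b hb
      simpa using hu b hb
    rw [List.flatMap_cons, List.countP_append, ih, hl, List.countP_append, hu0]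
    simp [ha, Nat.add_comm]

theorem getLast?_rotate_succ (w : List L) {i : ℕ} (hi : i < w.length) :
    (w.rotate (i + 1)).getLast? = w[i]? := by
  rw [List.getLast?_eq_getElem?, List.length_rotate, List.getElem?_rotate (by omega)]
  congr 1
  rw [show w.length - 1 + (i + 1) = i + w.length by omega, Nat.add_mod_right, Nat.mod_eq_of_lt hi]

open Classical in
theorem sum_indicator_getElem? (M : L → Prop) (w : List L) :
    ∑ i ∈ Finset.range w.length, (if ∃ a, w[i]? = some a ∧ M a then (1 : ℝ≥0∞) else 0) =
      (w.countP (fun a => decide (M a)) : ℕ) := by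
  induction w using List.reverseRecOn with
  | nil => simp
  | append_singleton w a ih =>
    rw [List.length_append, List.length_singleton, Finset.sum_range_succ, List.countP_append,
      Nat.cast_add, ← ih]
    congr 1
    · refine Finset.sum_congr rfl fun i hi => ?_
      rw [List.getElem?_append_left (Finset.mem_range.1 hi)]
    · by_cases h : M a <;> simp [h]

theorem rotate_bijective (n : ℕ) : Function.Bijective fun w : List L => w.rotate n := by
  refine ⟨List.rotate_injective n, fun w => ?_⟩
  refine ⟨w.rotate (w.length - n % w.length), ?_⟩
  show (w.rotate _).rotate n = w
  rw [List.rotate_rotate]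
  rcases Nat.eq_zero_or_pos w.length with h | h
  · rw [List.length_eq_zero_iff] at h
    simp [h]
  · have h1 := Nat.mod_lt n h
    rw [← List.rotate_mod, Nat.add_mod, Nat.mod_add_mod, ← Nat.add_mod_mod, Nat.mod_mod,
      Nat.add_mod_mod, ← Nat.add_mod_mod, Nat.sub_add_cancel h1.le, Nat.mod_self, List.rotate_zero]

theorem rotate_invariant {α : Type*} {g : List L → α} (hrot : ∀ w, g (w.rotate 1) = g w) (n : ℕ)
    (w : List L) : g (w.rotate n) = g w := by
  induction n with
  | zero => simp
  | succ n ih => rw [← List.rotate_rotate, hrot, ih]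

open Classical in
/-- Double counting: a sum over closed words weighted by the inverse of the length, restricted to
those with a marked letter, is a sum over the words that end in a marked letter. -/
theorem tsum_marked (g : List L → ℝ≥0∞) (hrot : ∀ w, g (w.rotate 1) = g w) (M : L → Prop) :
    ∑' w, (if ∃ a ∈ w, M a then g w / (w.length : ℝ≥0∞) else 0) =
      ∑' w : List L, if ∃ a, w.getLast? = some a ∧ M a then
        g w / (w.countP (fun a => decide (M a)) : ℕ) else 0 := by
  let N : List L → ℕ := fun w => w.countP (fun a => decide (M a))
  let h : List L → ℝ≥0∞ := fun w => g w / (w.length : ℝ≥0∞) / (N w : ℕ)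
  have hinv : ∀ n w, h (w.rotate n) = h w := by
    intro n w
    have : N (w.rotate n) = N w := (List.rotate_perm w n).countP_eq _
    simp only [h, this, rotate_invariant hrot, List.length_rotate]
  let T : ℕ → List L → ℝ≥0∞ := fun i w =>
    if i < w.length ∧ ∃ a, w.getLast? = some a ∧ M a then h w else 0
  -- The term of `w` is shared equally among its marked letters. The letter at position `i` becomes
  -- the last one after rotation by `i + 1`.
  have e1 : ∀ w : List L, (if ∃ a ∈ w, M a then g w / (w.length : ℝ≥0∞) else 0) =
      ∑' i, T i (w.rotate (i + 1)) := by
    intro w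
    have hT : ∀ i, T i (w.rotate (i + 1)) =
        if i ∈ Finset.range w.length then
          (if ∃ a, w[i]? = some a ∧ M a then (1 : ℝ≥0∞) else 0) * h w else 0 := by
      intro i
      simp only [T, List.length_rotate, Finset.mem_range, hinv]
      by_cases hi : i < w.length
      · simp only [hi, true_and, getLast?_rotate_succ w hi, if_true]
        split_ifs <;> simp
      · simp [hi]
    simp_rw [hT]
    rw [tsum_eq_sum (s := Finset.range w.length) (fun i hi => by simp [hi]),
      Finset.sum_congr rfl (fun i hi => if_pos hi), ← Finset.sum_mul, sum_indicator_getElem?]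
    by_cases hw : ∃ a ∈ w, M a
    · rw [if_pos hw]
      have hN : N w ≠ 0 := by
        obtain ⟨a, ha, hMa⟩ := hw
        exact (List.countP_pos_iff.2 ⟨a, ha, by simpa using hMa⟩).ne'
      exact (ENNReal.mul_div_cancel (by exact_mod_cast hN) (ENNReal.natCast_ne_top _)).symm
    · rw [if_neg hw]
      have hN : w.countP (fun a => decide (M a)) = 0 := by
        rw [List.countP_eq_zero]
        intro b hb
        simp only [decide_eq_true_eq]
        exact fun hM => hw ⟨b, hb, hM⟩
      rw [hN]
      simp
  rw [tsum_congr e1, ENNReal.tsum_comm]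
  -- Rotation permutes the set of all words, so each word ending in a marked letter is counted once
  -- for every `i` below its length; this cancels the weight by the inverse of the length.
  have e2 : ∀ i, ∑' w : List L, T i (w.rotate (i + 1)) = ∑' w, T i w := fun i =>
    (Equiv.ofBijective (fun w : List L => w.rotate (i + 1)) (rotate_bijective (i + 1))).tsum_eq (T i)
  rw [tsum_congr e2, ENNReal.tsum_comm]
  refine tsum_congr fun w => ?_
  have hT : ∀ i, T i w = if i ∈ Finset.range w.length then
      (if ∃ a, w.getLast? = some a ∧ M a then h w else 0) else 0 := by
    intro i
    simp only [T, Finset.mem_range]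
    split_ifs <;> simp_all
  simp_rw [hT]
  rw [tsum_eq_sum (s := Finset.range w.length) (fun i hi => by simp [hi]),
    Finset.sum_congr rfl (fun i hi => if_pos hi), Finset.sum_const, Finset.card_range, nsmul_eq_mul]
  split_ifs with hw
  · have hl : w.length ≠ 0 := by
      obtain ⟨a, ha, -⟩ := hw
      intro h0
      rw [List.length_eq_zero_iff] at h0
      simp [h0] at ha
    simp only [h, N, div_eq_mul_inv]
    rw [← mul_assoc, mul_comm (g w), ← mul_assoc,
      ENNReal.mul_inv_cancel (by exact_mod_cast hl) (ENNReal.natCast_ne_top _), one_mul]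
  · simp

open Classical in
-- By `tsum_marked` the right side becomes a sum over words that end in a marked letter, weighted by
-- the inverse of the number of marked letters. Those with a non-zero term are words of blocks, with
-- as many marked letters as blocks.
theorem IsBlockCode.tsum_flatMap {M : L → Prop} {β : L' → List L} (h : IsBlockCode M β)
    (g : List L → ℝ≥0∞) (hg0 : g [] = 0) (hrot : ∀ w, g (w.rotate 1) = g w)
    (hrange : ∀ u a, M a → g (u ++ [a]) ≠ 0 → ∃ W : List L', W.flatMap β = u ++ [a]) :
    ∑' W : List L', g (W.flatMap β) / (W.length : ℝ≥0∞) =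
      ∑' w, (if ∃ a ∈ w, M a then g w / (w.length : ℝ≥0∞) else 0) := by
  rw [tsum_marked g hrot M, ← h.flatMap_injective.tsum_eq]
  · refine tsum_congr fun W => ?_
    rw [h.countP_flatMap]
    rcases List.eq_nil_or_concat W with rfl | ⟨W, l, rfl⟩
    · simp [hg0]
    · obtain ⟨u, a, hl, ha, hu⟩ := h.2 l
      rw [if_pos]
      refine ⟨a, ?_, ha⟩
      rw [List.concat_eq_append, List.flatMap_append, List.flatMap_singleton, hl,
        ← List.append_assoc, List.getLast?_append]
      simp
  · intro w hw
    rw [Function.mem_support] at hw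
    split_ifs at hw with hM
    · obtain ⟨a, ha, hMa⟩ := hM
      obtain ⟨u, rfl⟩ := List.getLast?_eq_some_iff.1 ha
      exact hrange u a hMa fun h0 => hw (by rw [h0]; simp)
    · exact absurd rfl hw

/-! ### Primitive words -/

/-- The `n`-th power of a word. -/
def pow (w : List L) (n : ℕ) : List L := (List.replicate n w).flatten

@[simp] theorem pow_zero (w : List L) : pow w 0 = [] := rfl

theorem pow_succ (w : List L) (n : ℕ) : pow w (n + 1) = w ++ pow w n := by
  simp [pow, List.replicate_succ]

theorem pow_add (w : List L) (n k : ℕ) : pow w (n + k) = pow w n ++ pow w k := by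
  rw [pow, List.replicate_add, List.flatten_append]; rfl

@[simp] theorem pow_one (w : List L) : pow w 1 = w := by simp [pow]

theorem pow_succ' (w : List L) (n : ℕ) : pow w (n + 1) = pow w n ++ w := by
  rw [pow_add, pow_one]

theorem length_pow (w : List L) (n : ℕ) : (pow w n).length = n * w.length := by
  simp [pow]

theorem pow_mul (w : List L) (n k : ℕ) : pow w (n * k) = pow (pow w n) k := by
  induction k with
  | zero => simp
  | succ k ih => rw [Nat.mul_succ, pow_add, ih, pow_add, pow_one]

/-- Euclid's algorithm on the lengths: the shorter of two commuting words is a prefix of the longer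
one, and still commutes with what remains of it. -/
theorem exists_pow_of_append_comm {u v : List L} (h : u ++ v = v ++ u) :
    ∃ z i j, u = pow z i ∧ v = pow z j := by
  induction hn : u.length + v.length using Nat.strong_induction_on generalizing u v with
  | _ n ih =>
    rcases eq_or_ne u [] with rfl | hu
    · exact ⟨v, 0, 1, rfl, by simp⟩
    rcases eq_or_ne v [] with rfl | hv
    · exact ⟨u, 1, 0, by simp, rfl⟩
    have hu' := List.length_pos_iff.2 hu
    have hv' := List.length_pos_iff.2 hv
    have h0 := h
    rw [List.append_eq_append_iff] at h
    rcases h with ⟨x, hx, hx'⟩ | ⟨x, hx, hx'⟩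
    · subst hx
      obtain ⟨z, i, j, rfl, rfl⟩ := ih (u.length + x.length)
        (by simp only [List.length_append] at hn; omega) (u := u) (v := x) hx' rfl
      exact ⟨z, i, i + j, rfl, by rw [pow_add]⟩
    · subst hx
      obtain ⟨z, i, j, rfl, rfl⟩ := ih (v.length + x.length)
        (by simp only [List.length_append] at hn; omega) (u := v) (v := x) hx' rfl
      exact ⟨z, i + j, i, by rw [pow_add], rfl⟩

/-- A cut whose two parts may be exchanged consists of powers of a common word. This is the form of
primitivity that matches the definition of `Sys.prim`. -/
theorem isPrimitive_iff {w : List L} : Graphing.IsPrimitive w ↔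
    w ≠ [] ∧ ∀ u v, u ≠ [] → v ≠ [] → u ++ v = w → v ++ u ≠ w := by
  constructor
  · rintro ⟨h0, h⟩
    refine ⟨h0, fun u v hu hv huv hvu => ?_⟩
    obtain ⟨z, i, j, rfl, rfl⟩ := exists_pow_of_append_comm (huv.trans hvu.symm)
    rw [← pow_add] at huv
    have := h z _ huv.symm
    rcases i with _ | i
    · exact hu rfl
    · rcases j with _ | j
      · exact hv rfl
      · omega
  · rintro ⟨h0, h⟩
    refine ⟨h0, fun u n hn => ?_⟩
    change w = pow u n at hn
    have hu : u ≠ [] := by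
      rintro rfl
      apply h0
      rw [hn, ← List.length_eq_zero_iff, length_pow]
      simp
    rcases n with _ | _ | n
    · exact absurd hn h0
    · rfl
    · exfalso
      refine h u (pow u (n + 1)) hu ?_ ?_ ?_
      · rw [pow_succ]
        simp [hu]
      · rw [hn, ← pow_succ]
      · rw [hn, ← pow_one u, ← pow_mul, ← pow_add, pow_one, one_mul]

theorem IsPrimitive.eq_pow_of_comm {w z : List L} (hw : Graphing.IsPrimitive w)
    (h : w ++ z = z ++ w) : ∃ n, z = pow w n := by
  obtain ⟨y, i, j, hy, rfl⟩ := exists_pow_of_append_comm h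
  have := hw.2 y i hy
  subst this
  exact ⟨j, by rw [hy, pow_one]⟩

theorem pow_append_comm (u x : List L) (n : ℕ) :
    pow (u ++ x) n ++ u = u ++ pow (x ++ u) n := by
  induction n with
  | zero => simp
  | succ n ih => rw [pow_succ, pow_succ, List.append_assoc, ih]; simp

/-- If `u` is longer than `w`, a copy of `w` can be removed from its front; if it is a prefix of
`w`, comparing the first blocks suffices. -/
theorem append_comm_of_append_pow_comm {u w : List L} {n : ℕ}
    (h : u ++ pow w (n + 1) = pow w (n + 1) ++ u) : u ++ w = w ++ u := by
  induction hk : u.length using Nat.strong_induction_on generalizing u with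
  | _ k ih =>
    rcases eq_or_ne w [] with rfl | hw
    · simp
    have hw' := List.length_pos_iff.2 hw
    have h0 := h
    rw [pow_succ, List.append_assoc, List.append_eq_append_iff] at h
    rcases h with ⟨x, rfl, -⟩ | ⟨x, rfl, hx⟩
    · rw [pow_append_comm, List.append_cancel_left_eq, pow_succ, pow_succ] at h0
      rw [List.append_assoc, ← (List.append_inj h0 (by simp [Nat.add_comm])).1]
    · have hx' : x ++ pow w (n + 1) = pow w (n + 1) ++ x := by
        rw [pow_succ, ← hx, ← List.append_assoc, ← pow_succ', pow_succ]
      have := ih x.length (by simp only [List.length_append] at hk; omega) hx' rfl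
      rw [List.append_assoc, this]

theorem exists_primitive_pow {v : List L} (hv : v ≠ []) :
    ∃ w n, Graphing.IsPrimitive w ∧ v = pow w (n + 1) := by
  induction hk : v.length using Nat.strong_induction_on generalizing v with
  | _ k ih =>
    by_cases hp : Graphing.IsPrimitive v
    · exact ⟨v, 0, hp, by simp⟩
    · have : ∃ u n, v = pow u n ∧ n ≠ 1 := by
        by_contra hcon
        push Not at hcon
        exact hp ⟨hv, hcon⟩
      obtain ⟨u, n, rfl, hn⟩ := this
      have hu : u ≠ [] := by
        rintro rfl
        apply hv
        rw [← List.length_eq_zero_iff, length_pow]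
        simp
      have hu' := List.length_pos_iff.2 hu
      rcases n with _ | _ | n
      · exact absurd rfl hv
      · exact absurd rfl hn
      rw [length_pow] at hk
      obtain ⟨w, p, hw, rfl⟩ := ih u.length (by rw [← hk]; nlinarith) hu rfl
      -- The exponents `p + 1` and `n + 2` multiply; one is subtracted because the statement counts
      -- exponents from `n + 1`.
      exact ⟨w, (p + 1) * (n + 2) - 1, hw, by
        rw [← pow_mul, Nat.sub_add_cancel (Nat.mul_pos (by omega) (by omega))]⟩

/-- Uniqueness of the primitive root: each root commutes with the common power, hence with the other
root. -/
theorem pow_primitive_inj {w w' : List L} (hw : Graphing.IsPrimitive w)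
    (hw' : Graphing.IsPrimitive w') {n k : ℕ} (h : pow w (n + 1) = pow w' (k + 1)) :
    w = w' ∧ n = k := by
  have hc : w ++ pow w (n + 1) = pow w (n + 1) ++ w := by
    rw [← pow_succ, pow_add _ (n + 1), pow_one]
  have hc' : w ++ w' = w' ++ w := append_comm_of_append_pow_comm (h ▸ hc)
  obtain ⟨i, hi⟩ := IsPrimitive.eq_pow_of_comm hw hc'
  have := hw'.2 w i hi
  subst this
  rw [pow_one] at hi
  subst hi
  have hl := congrArg List.length h
  rw [length_pow, length_pow] at hl
  have := Nat.eq_of_mul_eq_mul_right (List.length_pos_iff.2 hw.1) hl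
  exact ⟨rfl, by omega⟩

theorem isPrimitive_rotate_one {w : List L} (h : Graphing.IsPrimitive w) :
    Graphing.IsPrimitive (w.rotate 1) := by
  rw [isPrimitive_iff] at h ⊢
  cases w with
  | nil => exact absurd rfl h.1
  | cons e w =>
    rw [List.rotate_cons_succ, List.rotate_zero]
    refine ⟨by simp, fun u v hu hv huv hvu => ?_⟩
    obtain ⟨u, a, rfl⟩ := (List.eq_nil_or_concat u).resolve_left hu
    obtain ⟨v, b, rfl⟩ := (List.eq_nil_or_concat v).resolve_left hv
    simp only [List.concat_eq_append, ← List.append_assoc] at huv hvu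
    obtain ⟨h1, h2⟩ := List.append_inj' huv rfl
    obtain ⟨h3, h4⟩ := List.append_inj' hvu rfl
    simp only [List.cons.injEq, and_true] at h2 h4
    subst h2 h4
    refine h.2 (a :: u) (a :: v) (by simp) (by simp) ?_ ?_
    · simp [← h1]
    · simp [← h3]

theorem isPrimitive_rotate {w : List L} (h : Graphing.IsPrimitive w) (n : ℕ) :
    Graphing.IsPrimitive (w.rotate n) := by
  induction n with
  | zero => simpa
  | succ n ih => rw [← List.rotate_rotate]; exact isPrimitive_rotate_one ih

/-- Two coinciding rotations would give a rotation fixed by a proper shift, that is, a cut with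
exchangeable parts. -/
theorem IsPrimitive.rotate_inj {w : List L} (h : Graphing.IsPrimitive w) {i j : ℕ}
    (hi : i < w.length) (hj : j < w.length) (hij : w.rotate i = w.rotate j) : i = j := by
  wlog hle : i ≤ j generalizing i j
  · exact (this hj hi hij.symm (by omega)).symm
  by_contra hne
  have h1 := isPrimitive_rotate h i
  rw [isPrimitive_iff] at h1
  have hk : (w.rotate i).rotate (j - i) = w.rotate i := by
    rw [List.rotate_rotate, Nat.add_sub_cancel' hle, hij]
  have hl : (w.rotate i).length = w.length := List.length_rotate ..
  refine h1.2 ((w.rotate i).take (j - i)) ((w.rotate i).drop (j - i)) ?_ ?_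
    (List.take_append_drop ..) ?_
  · rw [← List.length_pos_iff, List.length_take, hl]; omega
  · rw [← List.length_pos_iff, List.length_drop, hl]; omega
  · rw [← List.rotate_eq_drop_append_take (by omega), hk]

theorem pow_rotate_one (w : List L) (n : ℕ) : (pow w n).rotate 1 = pow (w.rotate 1) n := by
  cases w with
  | nil =>
    have : ∀ n, pow ([] : List L) n = [] := fun n => by
      rw [← List.length_eq_zero_iff, length_pow]; simp
    simp [this]
  | cons e w =>
    rcases n with _ | n
    · simp
    · rw [pow_succ, List.cons_append, List.rotate_cons_succ, List.rotate_zero, List.rotate_cons_succ,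
        List.rotate_zero, pow_succ, List.append_assoc, List.append_assoc, ← List.singleton_append,
        pow_append_comm]

/-- A primitive word has exactly as many rotations as letters. -/
theorem tsum_fiber_isRotated {c : List L} (hc : Graphing.IsPrimitive c) (k : ℝ≥0∞) :
    ∑' _ : {w : List L // w ~r c}, k / (c.length : ℝ≥0∞) = k := by
  let f : Fin c.length → {w : List L // w ~r c} := fun i => ⟨c.rotate i, (List.IsRotated.forall c i)⟩
  have hf : Function.Bijective f := by
    refine ⟨fun i j hij => Fin.ext
      (IsPrimitive.rotate_inj hc i.2 j.2 (congrArg Subtype.val hij)), ?_⟩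
    rintro ⟨w, hw⟩
    obtain ⟨n, hn, rfl⟩ := List.isRotated_iff_mod.1 hw.symm
    have hpos := List.length_pos_iff.2 hc.1
    refine ⟨⟨n % c.length, Nat.mod_lt _ hpos⟩, Subtype.ext ?_⟩
    show c.rotate (n % c.length) = _
    rw [List.rotate_mod]
  rw [← (Equiv.ofBijective f hf).tsum_eq, tsum_fintype, Finset.sum_const, Finset.card_univ,
    Fintype.card_fin, nsmul_eq_mul]
  exact ENNReal.mul_div_cancel (by exact_mod_cast (List.length_pos_iff.2 hc.1).ne')
    (ENNReal.natCast_ne_top _)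

/-- A sum over closed words, weighted by the inverse of their length, is a sum over the powers of
the primitive circuits. -/
theorem tsum_primitive_cycle (g : List L → ℝ≥0∞) (hg0 : g [] = 0)
    (hrot : ∀ w, g (w.rotate 1) = g w) :
    ∑' c : {c : Cycle L // Graphing.IsPrimitive (Quotient.out (s := List.IsRotated.setoid L) c)},
      ∑' p : ℕ, g (pow (Quotient.out (s := List.IsRotated.setoid L) c.1) (p + 1)) /
        ((p + 1 : ℕ) : ℝ≥0∞) = ∑' w, g w / (w.length : ℝ≥0∞) := by
  let H : List L → ℝ≥0∞ := fun w => ∑' p : ℕ, g (pow w (p + 1)) / ((p + 1 : ℕ) : ℝ≥0∞)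
  have hH : ∀ w, H (w.rotate 1) = H w := fun w => by
    simp only [H, ← pow_rotate_one, hrot]
  -- Every non-empty word is a power of exactly one primitive word, with exactly one exponent `p +
  -- 1`, and its length is `p + 1` times that of the root.
  have e1 : ∑' w, g w / (w.length : ℝ≥0∞) =
      ∑' w : {w : List L // Graphing.IsPrimitive w}, H w / (w.1.length : ℝ≥0∞) := by
    let f : {w : List L // Graphing.IsPrimitive w} × ℕ → List L := fun x => pow x.1.1 (x.2 + 1)
    have hf : Function.Injective f := by
      rintro ⟨⟨w, hw⟩, n⟩ ⟨⟨w', hw'⟩, n'⟩ h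
      obtain ⟨rfl, rfl⟩ := pow_primitive_inj hw hw' h
      rfl
    rw [← hf.tsum_eq, ENNReal.tsum_prod']
    · refine tsum_congr fun w => ?_
      simp only [H, div_eq_mul_inv]
      rw [← ENNReal.tsum_mul_right]
      refine tsum_congr fun p => ?_
      rw [mul_assoc, length_pow, Nat.cast_mul, ENNReal.mul_inv] <;> simp
    · intro w hw
      have : w ≠ [] := by
        rintro rfl
        simp [hg0] at hw
      obtain ⟨v, n, hv, rfl⟩ := exists_primitive_pow this
      exact ⟨(⟨v, hv⟩, n), rfl⟩
  rw [e1]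
  let C := {c : Cycle L // Graphing.IsPrimitive (Quotient.out (s := List.IsRotated.setoid L) c)}
  let out : C → List L := fun c => Quotient.out (s := List.IsRotated.setoid L) c.1
  have hout : ∀ w : List L, Quotient.out (s := List.IsRotated.setoid L) (w : Cycle L) ~r w :=
    fun w => Quotient.mk_out (s := List.IsRotated.setoid L) w
  let q : {w : List L // Graphing.IsPrimitive w} → C := fun w => ⟨(w.1 : Cycle L), by
    obtain ⟨n, hn⟩ := (hout w.1).symm
    rw [← hn]
    exact isPrimitive_rotate w.2 n⟩
  -- Primitive words are grouped by circuit; the rotations of a representative share its term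
  -- equally.
  rw [← (Equiv.sigmaFiberEquiv q).tsum_eq, ENNReal.tsum_sigma']
  refine tsum_congr fun c => ?_
  have hc : ∀ w : List L, w ~r out c ↔ (w : Cycle L) = c.1 := fun w => by
    have hc' : (out c : Cycle L) = c.1 := Quotient.out_eq (s := List.IsRotated.setoid L) c.1
    rw [← hc', Cycle.coe_eq_coe]
  let e : {w : List L // w ~r out c} ≃ {w // q w = c} :=
    { toFun := fun w => ⟨⟨w.1, by
          obtain ⟨n, hn⟩ := w.2.symm
          rw [← hn]
          exact isPrimitive_rotate c.2 n⟩, Subtype.ext ((hc _).1 w.2)⟩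
      invFun := fun w => ⟨w.1.1, (hc _).2 (congrArg Subtype.val w.2)⟩
      left_inv := fun _ => rfl
      right_inv := fun _ => rfl }
  rw [← e.tsum_eq]
  refine Eq.trans (tsum_fiber_isRotated c.2 (H (out c))).symm (tsum_congr fun w => ?_)
  obtain ⟨n, hn⟩ := w.2.symm
  show _ = H w.1 / (w.1.length : ℝ≥0∞)
  rw [← hn, rotate_invariant hH, List.length_rotate]

end Words

/-! ## Maps which do not change weighted measures -/

/-- `T` multiplies the measure by a constant which is absorbed by all values of `m`. -/
def Compat {Ω Z : Type*} [MeasurableSpace Z] (m : Ω → ℝ≥0∞) (μ : Measure Z) (T : Z → Z) : Prop :=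
  Measurable T ∧ ∃ c : ℝ≥0∞, μ.map T = c • μ ∧ ∀ x, c * m x = m x

namespace Compat

variable {Ω Z : Type*} [MeasurableSpace Z] {m : Ω → ℝ≥0∞} {μ : Measure Z}

theorem comp {T T' : Z → Z} (h : Compat m μ T) (h' : Compat m μ T') : Compat m μ (T ∘ T') := by
  obtain ⟨hT, c, hc, hm⟩ := h
  obtain ⟨hT', c', hc', hm'⟩ := h'
  refine ⟨hT.comp hT', c' * c, ?_, fun x => by rw [mul_assoc, hm, hm']⟩
  rw [← Measure.map_map hT hT', hc', Measure.map_smul, hc, smul_smul]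

theorem of_measurePreserving {T : Z → Z} (h : MeasurePreserving T μ μ) : Compat m μ T :=
  ⟨h.measurable, 1, by rw [h.map_eq, one_smul], fun x => one_mul _⟩

theorem quasiMeasurePreserving {T : Z → Z} (h : Compat m μ T) :
    Measure.QuasiMeasurePreserving T μ μ := by
  obtain ⟨hT, c, hc, -⟩ := h
  exact ⟨hT, hc ▸ Measure.smul_absolutelyContinuous⟩

/-- The reason for the condition on `Γ`: an affine map scales the measure, but the factor disappears
in front of a value of `m`. -/
theorem mul_measure_image {T : Z ≃ᵐ Z} (h : Compat m μ T) (x : Ω) (A : Set Z) :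
    m x * μ (T '' A) = m x * μ A := by
  obtain ⟨hT, c, hc, hm⟩ := h
  have h1 : μ A = c * μ (T '' A) := by
    have := T.map_apply (μ := μ) (T '' A)
    rw [hc, Set.preimage_image_eq _ T.injective] at this
    rw [← this]
    rfl
  rw [h1, ← mul_assoc, mul_comm (m x) c, hm]

theorem prod_left {R : Type*} [MeasurableSpace R] {ν : Measure R} [SFinite μ] [SFinite ν]
    {T : Z → Z} (h : Compat m μ T) : Compat m (μ.prod ν) (Prod.map T id) := by
  obtain ⟨hT, c, hc, hm⟩ := h
  refine ⟨hT.prodMap measurable_id, c, ?_, hm⟩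
  rw [← Measure.map_prod_map _ _ hT measurable_id, hc, Measure.map_id, Measure.prod_smul_left]

theorem conj {Z' : Type*} [MeasurableSpace Z'] {ν : Measure Z'} {T : Z → Z} (h : Compat m μ T)
    {e : Z ≃ᵐ Z'} (he : MeasurePreserving e μ ν) : Compat m ν (e ∘ T ∘ e.symm) := by
  obtain ⟨hT, c, hc, hm⟩ := h
  refine ⟨by fun_prop, c, ?_, hm⟩
  rw [← Measure.map_map (by fun_prop) (by fun_prop), ← Measure.map_map (by fun_prop) (by fun_prop),
    (he.symm e).map_eq, hc, Measure.map_smul, he.map_eq]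

end Compat

/-! ## Systems of partial maps -/

/-- A family of weighted partial automorphisms of a measurable space. -/
structure Sys (Ω Z L : Type*) [MeasurableSpace Z] where
  st : L → Z ≃ᵐ Z
  src : L → Set Z
  measurable_src : ∀ l, MeasurableSet (src l)
  wt : L → Ω

namespace Sys

variable {Ω Z L : Type*} [Monoid Ω] [MeasurableSpace Z] (S : Sys Ω Z L)

def wreal : List L → Z ≃ᵐ Z
  | [] => MeasurableEquiv.refl Z
  | e :: w => (S.st e).trans (wreal w)

def wsrc : List L → Set Z
  | [] => Set.univ
  | e :: w => S.src e ∩ S.st e ⁻¹' wsrc w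

def wwt : List L → Ω
  | [] => 1
  | e :: w => wwt w * S.wt e

omit [Monoid Ω] in
theorem wreal_cons (e : L) (w : List L) (y : Z) : S.wreal (e :: w) y = S.wreal w (S.st e y) := rfl

omit [Monoid Ω] in
theorem mem_wsrc_cons {e : L} {w : List L} {y : Z} :
    y ∈ S.wsrc (e :: w) ↔ y ∈ S.src e ∧ S.st e y ∈ S.wsrc w := Iff.rfl

omit [Monoid Ω] in
theorem wreal_append (u v : List L) (y : Z) : S.wreal (u ++ v) y = S.wreal v (S.wreal u y) := by
  induction u generalizing y with
  | nil => rfl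
  | cons e u ih => exact ih _

omit [Monoid Ω] in
theorem mem_wsrc_append {u v : List L} {y : Z} :
    y ∈ S.wsrc (u ++ v) ↔ y ∈ S.wsrc u ∧ S.wreal u y ∈ S.wsrc v := by
  induction u generalizing y with
  | nil => exact ⟨fun h => ⟨trivial, h⟩, fun h => h.2⟩
  | cons e u ih =>
    rw [List.cons_append, mem_wsrc_cons, mem_wsrc_cons, ih, and_assoc]
    rfl

theorem wwt_append (u v : List L) : S.wwt (u ++ v) = S.wwt v * S.wwt u := by
  induction u with
  | nil => exact (mul_one _).symm
  | cons e u ih => rw [List.cons_append, wwt, ih, wwt, mul_assoc]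

omit [Monoid Ω] in
theorem measurableSet_wsrc (w : List L) : MeasurableSet (S.wsrc w) := by
  induction w with
  | nil => exact MeasurableSet.univ
  | cons e w ih => exact (S.measurable_src e).inter ((S.st e).measurable ih)

/-- The points which return to themselves along a word, and not along a proper divisor of it. -/
def prim (w : List L) : Set Z :=
  {y | w ≠ [] ∧ y ∈ S.wsrc w ∧ S.wreal w y = y ∧
    ∀ u v, u ≠ [] → v ≠ [] → u ++ v = w → v ++ u = w → S.wreal u y ≠ y}

omit [Monoid Ω] in
theorem measurableSet_prim [MeasurableEq Z] (w : List L) : MeasurableSet (S.prim w) := by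
  have h1 (w : List L) : MeasurableSet {y | S.wreal w y = y} :=
    measurableSet_eq_fun (S.wreal w).measurable measurable_id
  let C : Set (List L × List L) :=
    {p | p.1 ≠ [] ∧ p.2 ≠ [] ∧ p.1 ++ p.2 = w ∧ p.2 ++ p.1 = w}
  -- A cut of `w` is determined by the length of its first part.
  have hC : C.Countable := by
    refine (Set.countable_range fun k : ℕ => (w.take k, w.drop k)).mono ?_
    rintro ⟨u, v⟩ ⟨-, -, h, -⟩
    dsimp only at h
    subst h
    exact ⟨u.length, by simp⟩
  have : S.prim w = {_y | w ≠ []} ∩ (S.wsrc w ∩ ({y | S.wreal w y = y} ∩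
      ⋂ p ∈ C, {y | S.wreal p.1 y = y}ᶜ)) := by
    ext y
    simp only [prim, Set.mem_ofPred_eq, Set.mem_inter_iff, Set.mem_iInter, C, Set.mem_compl_iff,
      Prod.forall, and_imp]
  rw [this]
  exact (MeasurableSet.const _).inter ((S.measurableSet_wsrc w).inter
    ((h1 w).inter (MeasurableSet.biInter hC fun p _ => (h1 _).compl)))

noncomputable def val (m : Ω → ℝ≥0∞) (μ : Measure Z) (w : List L) : ℝ≥0∞ :=
  m (S.wwt w) * μ (S.prim w)

theorem val_nil (m : Ω → ℝ≥0∞) (μ : Measure Z) : S.val m μ [] = 0 := by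
  have : S.prim [] = ∅ := Set.eq_empty_of_forall_notMem fun y hy => hy.1 rfl
  rw [val, this, measure_empty, mul_zero]

omit [Monoid Ω] in
-- Following the first edge turns a loop along `e :: w` into a loop along `w ++ [e]`. A shorter
-- return along an exchangeable cut of the latter is conjugate, by that edge, to one of the former.
theorem image_prim_subset (e : L) (w : List L) :
    S.st e '' S.prim (e :: w) ⊆ S.prim (w ++ [e]) := by
  rintro _ ⟨y, ⟨-, hs, hf, hp⟩, rfl⟩
  have hf' : S.wreal w (S.st e y) = y := hf
  refine ⟨by simp, ?_, ?_, fun u v hu hv huv hvu => ?_⟩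
  · rw [mem_wsrc_append, hf']
    exact ⟨hs.2, hs.1, trivial⟩
  · rw [wreal_append, hf']
    rfl
  · obtain ⟨u, a, rfl⟩ := (List.eq_nil_or_concat u).resolve_left hu
    obtain ⟨v, b, rfl⟩ := (List.eq_nil_or_concat v).resolve_left hv
    simp only [List.concat_eq_append, ← List.append_assoc] at huv hvu ⊢
    obtain ⟨h1, h2⟩ := List.append_inj' huv rfl
    obtain ⟨h3, h4⟩ := List.append_inj' hvu rfl
    simp only [List.cons.injEq, and_true] at h2 h4
    subst h2 h4
    intro hc
    rw [wreal_append] at hc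
    exact hp (a :: u) (a :: v) (by simp) (by simp) (by simp [← h1]) (by simp [← h3])
      ((S.st a).injective hc)

theorem val_le_val_rotate {m : Ω → ℝ≥0∞} (hm : ∀ u v : Ω, m (u * v) = m (v * u)) {μ : Measure Z}
    (hS : ∀ l, Compat m μ (S.st l)) (w : List L) : S.val m μ w ≤ S.val m μ (w.rotate 1) := by
  cases w with
  | nil => simp
  | cons e w =>
    rw [List.rotate_cons_succ, List.rotate_zero, val, val, ← (hS e).mul_measure_image, wwt_append,
      wwt, hm]
    have : S.wwt [e] = S.wt e := one_mul _
    rw [this]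
    gcongr
    exact S.image_prim_subset e w

/-- One inequality is enough: as many rotations as there are letters lead back to `w`, so the chain
of inequalities closes up. -/
theorem val_rotate {m : Ω → ℝ≥0∞} (hm : ∀ u v : Ω, m (u * v) = m (v * u)) {μ : Measure Z}
    (hS : ∀ l, Compat m μ (S.st l)) (w : List L) : S.val m μ (w.rotate 1) = S.val m μ w := by
  refine le_antisymm ?_ (S.val_le_val_rotate hm hS w)
  have h : ∀ n (v : List L), S.val m μ v ≤ S.val m μ (v.rotate n) := by
    intro n
    induction n with
    | zero => simp
    | succ n ih =>
      intro v
      rw [← List.rotate_rotate]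
      exact (ih v).trans (S.val_le_val_rotate hm hS _)
  rcases Nat.eq_zero_or_pos w.length with h0 | h0
  · rw [List.length_eq_zero_iff] at h0
    simp [h0]
  · have := h (w.length - 1) (w.rotate 1)
    rwa [List.rotate_rotate, Nat.add_sub_cancel' h0, List.rotate_length] at this

/-- The sum over a set of closed words of their values, divided by the length. -/
noncomputable def cyc (m : Ω → ℝ≥0∞) (μ : Measure Z) (p : Set (List L)) : ℝ≥0∞ :=
  ∑' w, p.indicator (fun w => S.val m μ w / (w.length : ℝ≥0∞)) w

theorem cyc_union {m : Ω → ℝ≥0∞} {μ : Measure Z} {p q : Set (List L)} (h : Disjoint p q) :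
    S.cyc m μ (p ∪ q) = S.cyc m μ p + S.cyc m μ q := by
  rw [cyc, cyc, cyc, ← ENNReal.tsum_add, Set.indicator_union_of_disjoint h]

theorem cyc_congr {m : Ω → ℝ≥0∞} {μ : Measure Z} {p q : Set (List L)}
    (h : ∀ w, S.val m μ w ≠ 0 → (w ∈ p ↔ w ∈ q)) : S.cyc m μ p = S.cyc m μ q := by
  classical
  refine tsum_congr fun w => ?_
  rw [Set.indicator_apply, Set.indicator_apply]
  rcases eq_or_ne (S.val m μ w) 0 with h0 | h0
  · simp [h0]
  · simp [h w h0]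

/-! ### Block systems -/

variable {Z' L' R : Type*} [MeasurableSpace Z'] (S' : Sys Ω Z' L')

/-- The system `S'` is made of words of the system `S`, up to a coordinate `r` which these words
leave unchanged. -/
structure Covers (β : L' → List L) (φ : Z → Z') (r : Z → R) (K : Set Z) : Prop where
  wt : ∀ l, S'.wt l = S.wwt (β l)
  inj : ∀ y y', φ y = φ y' → r y = r y' → y = y'
  of_src : ∀ l y, φ y ∈ S'.src l → y ∈ S.wsrc (β l)
  to_src : ∀ l y, y ∈ K → y ∈ S.wsrc (β l) → φ y ∈ S'.src l
  real : ∀ l y, y ∈ S.wsrc (β l) → φ (S.wreal (β l) y) = S'.st l (φ y)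
  rest : ∀ l y, y ∈ S.wsrc (β l) → r (S.wreal (β l) y) = r y
  stay : ∀ l y, y ∈ S.wsrc (β l) → S.wreal (β l) y ∈ K

variable {S S'} {β : L' → List L} {φ : Z → Z'} {r : Z → R} {K : Set Z}

namespace Covers

theorem wwt_flatMap (h : Covers S S' β φ r K) (W : List L') :
    S'.wwt W = S.wwt (W.flatMap β) := by
  induction W with
  | nil => rfl
  | cons l W ih => rw [List.flatMap_cons, wwt_append, wwt, ih, h.wt]

theorem wsrc_of (h : Covers S S' β φ r K) {W : List L'} {y : Z} (hy : φ y ∈ S'.wsrc W) :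
    y ∈ S.wsrc (W.flatMap β) := by
  induction W generalizing y with
  | nil => trivial
  | cons l W ih =>
    have h1 := h.of_src l y hy.1
    rw [List.flatMap_cons, mem_wsrc_append]
    refine ⟨h1, ih ?_⟩
    rw [h.real l y h1]
    exact hy.2

/-- The converse of `wsrc_of` needs a start in `K`, since the domains of `S'` may be smaller than
those of the words: execution restricts paths to the outside of the cut. -/
theorem wsrc_to (h : Covers S S' β φ r K) {W : List L'} {y : Z} (hK : y ∈ K)
    (hy : y ∈ S.wsrc (W.flatMap β)) : φ y ∈ S'.wsrc W := by
  induction W generalizing y with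
  | nil => trivial
  | cons l W ih =>
    rw [List.flatMap_cons, mem_wsrc_append] at hy
    refine ⟨h.to_src l y hK hy.1, ?_⟩
    have := ih (h.stay l y hy.1) hy.2
    rwa [h.real l y hy.1] at this

theorem wreal_flatMap (h : Covers S S' β φ r K) {W : List L'} {y : Z}
    (hy : y ∈ S.wsrc (W.flatMap β)) :
    φ (S.wreal (W.flatMap β) y) = S'.wreal W (φ y) ∧ r (S.wreal (W.flatMap β) y) = r y ∧
      (W ≠ [] → S.wreal (W.flatMap β) y ∈ K) := by
  induction W generalizing y with
  | nil => exact ⟨rfl, rfl, fun h => absurd rfl h⟩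
  | cons l W ih =>
    rw [List.flatMap_cons, mem_wsrc_append] at hy
    rw [List.flatMap_cons, wreal_append]
    obtain ⟨h1, h2, h3⟩ := ih hy.2
    refine ⟨?_, ?_, fun _ => ?_⟩
    · rw [h1, h.real l y hy.1]
      rfl
    · rw [h2, h.rest l y hy.1]
    · rcases eq_or_ne W [] with rfl | hW
      · exact h.stay l y hy.1
      · exact h3 hW

/-- A block leaves `r` unchanged, and `φ` together with `r` separates points. -/
theorem wreal_eq_iff (h : Covers S S' β φ r K) {W : List L'} {y : Z}
    (hy : y ∈ S.wsrc (W.flatMap β)) :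
    S.wreal (W.flatMap β) y = y ↔ S'.wreal W (φ y) = φ y := by
  obtain ⟨h1, h2, -⟩ := h.wreal_flatMap hy
  rw [← h1]
  exact ⟨fun e => congrArg φ e, fun e => h.inj _ _ e h2⟩

/-- A closed word of blocks ends in `K`, hence also starts there, so the restriction to `K` costs
nothing. If the parts of a cut can be exchanged, each ends in the last, marked, letter; the cut is
then one between blocks. -/
theorem prim_eq {M : L → Prop} (hβ : Words.IsBlockCode M β) (h : Covers S S' β φ r K)
    (W : List L') : S.prim (W.flatMap β) = φ ⁻¹' S'.prim W := by
  have hne : ∀ {W : List L'}, W ≠ [] → W.flatMap β ≠ [] := fun hW h0 =>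
    hW (hβ.flatMap_injective (by simpa using h0))
  ext y
  constructor
  · rintro ⟨h0, hs, hf, hp⟩
    have hW : W ≠ [] := by rintro rfl; exact h0 rfl
    have hK : y ∈ K := by
      have := (h.wreal_flatMap hs).2.2 hW
      rwa [hf] at this
    refine ⟨hW, h.wsrc_to hK hs, (h.wreal_eq_iff hs).1 hf, ?_⟩
    rintro U V hU hV rfl hVU hc
    refine hp (U.flatMap β) (V.flatMap β) (hne hU) (hne hV) (by simp) ?_ ?_
    · rw [← List.flatMap_append, hVU]
    · rw [List.flatMap_append, mem_wsrc_append] at hs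
      exact (h.wreal_eq_iff hs.1).2 hc
  · rintro ⟨hW, hs', hf', hp⟩
    have hs := h.wsrc_of hs'
    refine ⟨hne hW, hs, (h.wreal_eq_iff hs).2 hf', fun u v hu hv huv hvu hc => ?_⟩
    -- the word ends in a marked letter, hence so do `u` and `v`
    obtain ⟨W₀, l, rfl⟩ := (List.eq_nil_or_concat W).resolve_left hW
    obtain ⟨u₀, a, hl, ha, -⟩ := hβ.2 l
    obtain ⟨u, b, rfl⟩ := (List.eq_nil_or_concat u).resolve_left hu
    obtain ⟨v, c, rfl⟩ := (List.eq_nil_or_concat v).resolve_left hv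
    have hend : ((W₀.concat l).flatMap β) = (W₀.flatMap β ++ u₀) ++ [a] := by
      rw [List.concat_eq_append, List.flatMap_append, List.flatMap_singleton, hl,
        List.append_assoc]
    simp only [List.concat_eq_append (as := u), List.concat_eq_append (as := v)] at hu hv huv hvu hc
    have hb : b = a := by
      have h1 := hvu.trans hend
      rw [← List.append_assoc] at h1
      simpa using (List.append_inj' h1 rfl).2
    subst hb
    obtain ⟨U, V, hUV, hU, hV⟩ := hβ.exists_split ha huv.symm
    have hVU : V ++ U = W₀.concat l := by
      apply hβ.flatMap_injective
      rw [List.flatMap_append, ← hU, ← hV, hvu]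
    rw [hUV, List.flatMap_append, mem_wsrc_append] at hs
    rw [hU, h.wreal_eq_iff hs.1] at hc
    refine hp U V ?_ ?_ hUV.symm hVU hc
    · rintro rfl
      simp at hU
    · rintro rfl
      simp at hV

theorem val_eq {M : L → Prop} (hβ : Words.IsBlockCode M β) (h : Covers S S' β φ r K)
    [MeasurableEq Z'] {m : Ω → ℝ≥0∞} {μ : Measure Z} {ν : Measure Z'}
    (hφ : MeasurePreserving φ μ ν) (W : List L') :
    S.val m μ (W.flatMap β) = S'.val m ν W := by
  rw [val, val, h.prim_eq hβ, h.wwt_flatMap,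
    hφ.measure_preimage (S'.measurableSet_prim W).nullMeasurableSet]

/-- The transfer principle: values agree by `val_eq`, and the weights by the inverse length agree by
`IsBlockCode.tsum_flatMap`. The assumption `hrange` says that words of non-zero value ending in a
marked letter decompose into blocks. -/
theorem cyc_eq {M : L → Prop} (hβ : Words.IsBlockCode M β) (h : Covers S S' β φ r K)
    [MeasurableEq Z'] {m : Ω → ℝ≥0∞} (hm : ∀ u v : Ω, m (u * v) = m (v * u))
    {μ : Measure Z} {ν : Measure Z'} (hS : ∀ l, Compat m μ (S.st l))
    (hφ : MeasurePreserving φ μ ν) (p : Set (List L)) (hp : ∀ w, w.rotate 1 ∈ p ↔ w ∈ p)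
    (hrange : ∀ u a, M a → u ++ [a] ∈ p → S.val m μ (u ++ [a]) ≠ 0 →
      ∃ W : List L', W.flatMap β = u ++ [a]) :
    S'.cyc m ν {W | W.flatMap β ∈ p} = S.cyc m μ (p ∩ {w | ∃ a ∈ w, M a}) := by
  classical
  have key := hβ.tsum_flatMap (p.indicator (S.val m μ)) ?_ ?_ ?_
  · rw [cyc, cyc]
    refine Eq.trans (tsum_congr fun W => ?_) (key.trans (tsum_congr fun w => ?_))
    · rw [Set.indicator_apply, Set.indicator_apply, h.val_eq hβ hφ]
      by_cases h1 : W.flatMap β ∈ p <;> simp [h1]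
    · rw [Set.indicator_apply, Set.indicator_apply]
      by_cases h1 : w ∈ p <;> by_cases h2 : ∃ a ∈ w, M a <;> simp [h1, h2]
  · simp [Set.indicator_apply, val_nil]
  · intro w
    rw [Set.indicator_apply, Set.indicator_apply, S.val_rotate hm hS]
    simp [hp]
  · intro u a ha hne
    have hmem := Set.mem_of_indicator_ne_zero hne
    rw [Set.indicator_of_mem hmem] at hne
    exact hrange u a ha hmem hne

end Covers

/-- Isomorphic systems have equal sums over closed words. -/
theorem cyc_map_equiv {S : Sys Ω Z L} {S' : Sys Ω Z' L'} (e : L' ≃ L) [MeasurableEq Z']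
    {m : Ω → ℝ≥0∞} (hm : ∀ u v : Ω, m (u * v) = m (v * u))
    {μ : Measure Z} {ν : Measure Z'} (hS : ∀ l, Compat m μ (S.st l)) {φ : Z ≃ᵐ Z'}
    (hφ : MeasurePreserving φ μ ν) (hwt : ∀ l, S'.wt l = S.wt (e l))
    (hsrc : ∀ l y, φ y ∈ S'.src l ↔ y ∈ S.src (e l))
    (hst : ∀ l y, φ (S.st (e l) y) = S'.st l (φ y)) (p : Set (List L))
    (hp : ∀ w, w.rotate 1 ∈ p ↔ w ∈ p) :
    S'.cyc m ν {W | W.map e ∈ p} = S.cyc m μ p := by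
  -- An isomorphism is a block code whose blocks are single letters, all of them marked.
  have hβ : Words.IsBlockCode (fun _ : L => True) fun l => [e l] :=
    ⟨fun l l' h => e.injective (by simpa using h), fun l => ⟨[], e l, rfl, trivial, by simp⟩⟩
  have hcov : Covers S S' (fun l => [e l]) φ (fun _ => ()) Set.univ :=
    { wt := fun l => (hwt l).trans (one_mul _).symm
      inj := fun y y' h _ => φ.injective h
      of_src := fun l y h => ⟨(hsrc l y).1 h, trivial⟩
      to_src := fun l y _ h => (hsrc l y).2 h.1
      real := fun l y _ => hst l y
      rest := fun _ _ _ => rfl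
      stay := fun _ _ _ => trivial }
  have hfl : ∀ W : List L', W.flatMap (fun l => [e l]) = W.map e := fun W => by
    induction W <;> simp_all
  have := hcov.cyc_eq hβ hm hS hφ p hp fun u a _ _ _ =>
    ⟨(u ++ [a]).map e.symm, by rw [hfl]; simp⟩
  simp only [hfl] at this
  rw [this]
  -- Only the empty word has no marked letter, and its value is zero.
  refine S.cyc_congr fun w hw => ⟨fun h => h.1, fun h => ⟨h, ?_⟩⟩
  rcases w with _ | ⟨a, w⟩
  · exact absurd (S.val_nil m μ) hw
  · exact ⟨a, by simp, trivial⟩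

/-! ### Cycles as closed words -/

variable (S)

omit [Monoid Ω] in
theorem wreal_pow (w : List L) (n : ℕ) (y : Z) :
    S.wreal (Words.pow w n) y = (S.wreal w)^[n] y := by
  induction n generalizing y with
  | zero => rfl
  | succ n ih => rw [Words.pow_succ, wreal_append, ih, Function.iterate_succ_apply]

theorem wwt_pow (w : List L) (n : ℕ) : S.wwt (Words.pow w n) = S.wwt w ^ n := by
  induction n with
  | zero => exact (_root_.pow_zero _).symm
  | succ n ih => rw [Words.pow_succ, wwt_append, ih, _root_.pow_succ]

omit [Monoid Ω] in
theorem mem_wsrc_pow {w : List L} {n : ℕ} {y : Z} :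
    y ∈ S.wsrc (Words.pow w n) ↔ ∀ k < n, (S.wreal w)^[k] y ∈ S.wsrc w := by
  induction n with
  | zero => exact ⟨fun _ k hk => absurd hk (Nat.not_lt_zero k), fun _ => trivial⟩
  | succ n ih =>
    rw [Words.pow_succ', mem_wsrc_append, ih, wreal_pow]
    constructor
    · rintro ⟨h1, h2⟩ k hk
      rcases Nat.lt_succ_iff_lt_or_eq.1 hk with hk | rfl
      · exact h1 k hk
      · exact h2
    · exact fun h => ⟨fun k hk => h k (by omega), h n (by omega)⟩

omit [Monoid Ω] in
-- For a primitive `w`, an exchangeable cut of a power of `w` commutes with `w`, so its parts are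
-- powers of `w`. Returning along `w ^ (p + 1)` and along no such part means having period exactly
-- `p + 1`.
theorem mem_prim_pow {w : List L} (hw : Graphing.IsPrimitive w) {p : ℕ} {y : Z} :
    y ∈ S.prim (Words.pow w (p + 1)) ↔
      Function.minimalPeriod (S.wreal w) y = p + 1 ∧ ∀ n, (S.wreal w)^[n] y ∈ S.wsrc w := by
  have hwl := List.length_pos_iff.2 hw.1
  have hne : ∀ {n}, n ≠ 0 → Words.pow w n ≠ [] := by
    intro n hn h0
    have := congrArg List.length h0
    rw [Words.length_pow] at this
    exact (Nat.mul_pos (Nat.pos_of_ne_zero hn) hwl).ne' this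
  constructor
  · rintro ⟨-, hs, hf, hp⟩
    rw [wreal_pow] at hf
    have hdvd : Function.minimalPeriod (S.wreal w) y ∣ p + 1 :=
      Function.IsPeriodicPt.minimalPeriod_dvd hf
    have hpos := Nat.pos_of_dvd_of_pos hdvd (Nat.succ_pos p)
    have hq : Function.minimalPeriod (S.wreal w) y = p + 1 := by
      refine (Nat.le_of_dvd (Nat.succ_pos p) hdvd).antisymm (not_lt.1 fun hlt => ?_)
      refine hp (Words.pow w (Function.minimalPeriod (S.wreal w) y))
        (Words.pow w (p + 1 - Function.minimalPeriod (S.wreal w) y)) (hne hpos.ne')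
        (hne (by omega)) ?_ ?_ ?_
      · rw [← Words.pow_add]; congr 1; omega
      · rw [← Words.pow_add]; congr 1; omega
      · rw [wreal_pow]
        exact Function.isPeriodicPt_minimalPeriod _ _
    refine ⟨hq, fun n => ?_⟩
    rw [mem_wsrc_pow] at hs
    rw [← Function.iterate_mod_minimalPeriod_eq (f := S.wreal w) (x := y), hq]
    exact hs _ (Nat.mod_lt _ (Nat.succ_pos p))
  · rintro ⟨hq, hs⟩
    refine ⟨hne (by omega), S.mem_wsrc_pow.2 fun k _ => hs k, ?_, fun u v hu hv huv hvu hc => ?_⟩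
    · rw [wreal_pow, ← hq]
      exact Function.isPeriodicPt_minimalPeriod _ _
    · have hcomm : u ++ Words.pow w (p + 1) = Words.pow w (p + 1) ++ u := by
        conv_lhs => rw [← hvu]
        rw [← huv]
        simp
      obtain ⟨i, rfl⟩ := Words.IsPrimitive.eq_pow_of_comm hw
        (Words.append_comm_of_append_pow_comm hcomm).symm
      rw [wreal_pow] at hc
      have hd := Function.IsPeriodicPt.minimalPeriod_dvd (f := S.wreal w) (x := y) (n := i) hc
      rw [hq] at hd
      have hi : i ≠ 0 := by rintro rfl; exact hu rfl
      have h1 := Nat.le_of_dvd (Nat.pos_of_ne_zero hi) hd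
      have h2 := congrArg List.length huv
      have h3 := List.length_pos_iff.2 hv
      rw [List.length_append, Words.length_pow, Words.length_pow] at h2
      nlinarith

/-- The integral over the points of finite orbit under a primitive cycle is a sum over the powers
of the cycle. -/
theorem lintegral_cycle [MeasurableEq Z] {w : List L} (hw : Graphing.IsPrimitive w)
    (m : Ω → ℝ≥0∞) (μ : Measure Z) :
    ∫⁻ y in {y | 0 < Function.minimalPeriod (S.wreal w) y ∧
        ∀ n : ℕ, (S.wreal w)^[n] y ∈ S.wsrc w},
      m (S.wwt w ^ Function.minimalPeriod (S.wreal w) y) /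
        (Function.minimalPeriod (S.wreal w) y : ℝ≥0∞) ∂μ =
    ∑' p : ℕ, S.val m μ (Words.pow w (p + 1)) / ((p + 1 : ℕ) : ℝ≥0∞) := by
  -- The support is sorted by period; on each piece the integrand is constant.
  have hset : {y | 0 < Function.minimalPeriod (S.wreal w) y ∧
      ∀ n : ℕ, (S.wreal w)^[n] y ∈ S.wsrc w} = ⋃ p : ℕ, S.prim (Words.pow w (p + 1)) := by
    ext y
    simp only [Set.mem_ofPred_eq, Set.mem_iUnion, S.mem_prim_pow hw]
    constructor
    · rintro ⟨h1, h2⟩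
      exact ⟨Function.minimalPeriod (S.wreal w) y - 1, by omega, h2⟩
    · rintro ⟨p, h1, h2⟩
      exact ⟨by omega, h2⟩
  rw [hset, lintegral_iUnion (fun p => S.measurableSet_prim _)]
  · refine tsum_congr fun p => ?_
    rw [setLIntegral_congr_fun (S.measurableSet_prim _)
      (g := fun _ => m (S.wwt w ^ (p + 1)) / ((p + 1 : ℕ) : ℝ≥0∞)), setLIntegral_const, val,
      wwt_pow, div_eq_mul_inv, div_eq_mul_inv, mul_right_comm]
    intro y hy
    simp only [((S.mem_prim_pow hw).1 hy).1]
  · intro p q hpq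
    refine Set.disjoint_left.2 fun y h1 h2 => hpq ?_
    have := ((S.mem_prim_pow hw).1 h1).1.symm.trans ((S.mem_prim_pow hw).1 h2).1
    omega

end Sys

/-! ### The measurement of graphings as a sum over closed words -/

instance : SFinite muX := by unfold muX; infer_instance
instance : SFinite muXD := by unfold muXD; infer_instance
instance : SFinite muY := by unfold muY; infer_instance

/-- The measure on the space times three dialects. -/
noncomputable def muY3 : Measure (Y × I) := muY.prod volume

/-- The first dialect put aside. -/
def viewL : Y ≃ᵐ XD × I := MeasurableEquiv.prodAssoc.symm

/-- The second dialect put aside. -/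
def viewR : Y ≃ᵐ XD × I :=
  ((MeasurableEquiv.refl X).prodCongr MeasurableEquiv.prodComm).trans MeasurableEquiv.prodAssoc.symm

/-- The first two dialects put aside. -/
def view3 : Y × I ≃ᵐ XD × (I × I) :=
  MeasurableEquiv.prodAssoc.trans
    (((MeasurableEquiv.refl X).prodCongr MeasurableEquiv.prodComm).trans
      MeasurableEquiv.prodAssoc.symm)

theorem measurePreserving_viewL : MeasurePreserving viewL muY (muXD.prod volume) :=
  (measurePreserving_prodAssoc muX volume volume).symm _

theorem measurePreserving_viewR : MeasurePreserving viewR muY (muXD.prod volume) :=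
  ((measurePreserving_prodAssoc muX volume volume).symm _).comp
    ((MeasurePreserving.id muX).prod Measure.measurePreserving_swap)

theorem measurePreserving_view3 :
    MeasurePreserving view3 muY3 (muXD.prod (volume.prod volume)) :=
  ((measurePreserving_prodAssoc muX volume (volume.prod volume)).symm _).comp
    (((MeasurePreserving.id muX).prod Measure.measurePreserving_swap).comp
      (measurePreserving_prodAssoc muX (volume.prod volume) volume))

namespace Graphing

variable {Ω : Type*}

/-- All realisers are compatible with `m`. -/
def Compat (m : Ω → ℝ≥0∞) (F : Graphing Ω) : Prop := ∀ e, IG.Compat m muXD (F.real e)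

theorem compat_step {m : Ω → ℝ≥0∞} {F G : Graphing Ω} (hF : F.Compat m) (hG : G.Compat m)
    (l : F.E ⊕ G.E) : IG.Compat m muY (step F G l) := by
  cases l with
  | inl e =>
    exact ((hF e).prod_left (ν := (volume : Measure I))).conj
      (measurePreserving_viewL.symm viewL)
  | inr e =>
    exact ((hG e).prod_left (ν := (volume : Measure I))).conj
      (measurePreserving_viewR.symm viewR)

/-- The system of the paths consisting of an edge of `F` and an edge of `G`. -/
def pairSys [Monoid Ω] (F G : Graphing Ω) : Sys Ω Y (F.E × G.E) where
  st p := (step F G (.inl p.1)).trans (step F G (.inr p.2))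
  src p := stepSource F G (.inl p.1) ∩ step F G (.inl p.1) ⁻¹' stepSource F G (.inr p.2)
  measurable_src _ := (measurableSet_stepSource F G _).inter
    ((step F G _).measurable (measurableSet_stepSource F G _))
  wt p := G.weight p.2 * F.weight p.1

/-- The system of the edges of three graphings. -/
def triSys (F G H : Graphing Ω) : Sys Ω (Y × I) ((F.E ⊕ G.E) ⊕ H.E) where
  st
    | .inl l => (step F G l).prodCongr (MeasurableEquiv.refl I)
    | .inr h => view3.trans (((H.real h).prodCongr (MeasurableEquiv.refl (I × I))).trans view3.symm)
  src
    | .inl l => {z | z.1 ∈ stepSource F G l}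
    | .inr h => {z | (z.1.1, z.2) ∈ H.source h}
  measurable_src
    | .inl l => measurable_fst (measurableSet_stepSource F G l)
    | .inr h => by
        have hm : Measurable fun z : Y × I => (z.1.1, z.2) := by fun_prop
        exact hm (H.measurable_source h)
  wt := Sum.elim (Sum.elim F.weight G.weight) H.weight

theorem compat_triSys {m : Ω → ℝ≥0∞} {F G H : Graphing Ω} (hF : F.Compat m) (hG : G.Compat m)
    (hH : H.Compat m) (l : (F.E ⊕ G.E) ⊕ H.E) : IG.Compat m muY3 ((triSys F G H).st l) := by
  rcases l with l | h
  · exact (compat_step hF hG l).prod_left (ν := (volume : Measure I))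
  · exact ((hH h).prod_left (ν := ((volume : Measure I).prod (volume : Measure I)))).conj
      (measurePreserving_view3.symm view3)

/-- The graphing to which an edge belongs. -/
def triCol {F G H : Graphing Ω} : (F.E ⊕ G.E) ⊕ H.E → Fin 3
  | .inl (.inl _) => 0
  | .inl (.inr _) => 1
  | .inr _ => 2

/-- Closed words in which cyclically consecutive letters belong to different graphings. -/
def good (F G H : Graphing Ω) : Set (List ((F.E ⊕ G.E) ⊕ H.E)) :=
  {w | Cycle.Chain (fun a b : (F.E ⊕ G.E) ⊕ H.E => triCol a ≠ triCol b)
    (w : Cycle ((F.E ⊕ G.E) ⊕ H.E))}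

theorem mem_good {F G H : Graphing Ω} {w : List ((F.E ⊕ G.E) ⊕ H.E)} : w ∈ good F G H ↔
    Cycle.Chain (fun a b : (F.E ⊕ G.E) ⊕ H.E => triCol a ≠ triCol b)
      (w : Cycle ((F.E ⊕ G.E) ⊕ H.E)) := Iff.rfl

theorem rotate_mem_good {F G H : Graphing Ω} (w : List ((F.E ⊕ G.E) ⊕ H.E)) :
    w.rotate 1 ∈ good F G H ↔ w ∈ good F G H := by
  have : ((w.rotate 1 : List _) : Cycle ((F.E ⊕ G.E) ⊕ H.E)) = w :=
    Cycle.coe_eq_coe.2 (List.IsRotated.forall w 1)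
  rw [mem_good, mem_good, this]

/-- Cyclic alternation is ordinary alternation once the last letter is repeated in front. -/
theorem append_singleton_mem_good {F G H : Graphing Ω} {w : List ((F.E ⊕ G.E) ⊕ H.E)} {a} :
    w ++ [a] ∈ good F G H ↔ List.IsChain (fun a b => triCol a ≠ triCol b) (a :: (w ++ [a])) := by
  rw [mem_good, ← Cycle.coe_cons_eq_coe_append, Cycle.chain_coe_cons]

/-- The sum over the alternating closed words in the edges of three graphings. -/
noncomputable def triMeas [Monoid Ω] (m : Ω → ℝ≥0∞) (F G H : Graphing Ω) : ℝ≥0∞ :=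
  (triSys F G H).cyc m muY3 (good F G H)

theorem wreal_pairSys [Monoid Ω] (F G : Graphing Ω) (w : List (F.E × G.E)) :
    (pairSys F G).wreal w = pathReal F G (cycleWord F G w) := by
  induction w with
  | nil => rfl
  | cons e w ih => rw [Sys.wreal, ih]; rfl

theorem wsrc_pairSys [Monoid Ω] (F G : Graphing Ω) (w : List (F.E × G.E)) :
    (pairSys F G).wsrc w = pathSource F G (cycleWord F G w) := by
  induction w with
  | nil => rfl
  | cons e w ih => rw [Sys.wsrc, ih]; exact Set.inter_assoc ..

theorem wwt_pairSys [Monoid Ω] (F G : Graphing Ω) (w : List (F.E × G.E)) :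
    (pairSys F G).wwt w = pathWeight F G (cycleWord F G w) := by
  induction w with
  | nil => rfl
  | cons e w ih =>
    rw [Sys.wwt, ih]
    exact (mul_assoc _ _ _).symm

theorem compat_pairSys [Monoid Ω] {m : Ω → ℝ≥0∞} {F G : Graphing Ω} (hF : F.Compat m)
    (hG : G.Compat m) (p : F.E × G.E) : IG.Compat m muY ((pairSys F G).st p) :=
  (compat_step hF hG (.inr p.2)).comp (compat_step hF hG (.inl p.1))

/-- The measurement as a sum over all closed words. -/
theorem meas_eq_cyc [Monoid Ω] {m : Ω → ℝ≥0∞} (hm : ∀ u v : Ω, m (u * v) = m (v * u))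
    {F G : Graphing Ω} (hF : F.Compat m) (hG : G.Compat m) :
    meas m F G = (pairSys F G).cyc m muY Set.univ := by
  rw [meas, Sys.cyc]
  simp only [Set.indicator_univ]
  -- The integral over a circuit is a sum over its powers by `lintegral_cycle`; rotations of powers
  -- of primitive circuits exhaust the non-empty closed words.
  rw [← Words.tsum_primitive_cycle _ (Sys.val_nil _ m muY)
    (Sys.val_rotate _ hm (compat_pairSys hF hG))]
  refine tsum_congr fun c => ?_
  rw [← Sys.lintegral_cycle _ c.2, cycleValue, cycleSupp]
  simp only [wreal_pairSys, wsrc_pairSys, wwt_pairSys]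

section Pairs

variable [Monoid Ω] (F G H : Graphing Ω)

/-- The word `f g` of an edge of `F` and an edge of `G`. -/
def pairWord (p : F.E × G.E) : List ((F.E ⊕ G.E) ⊕ H.E) := [.inl (.inl p.1), .inl (.inr p.2)]

omit [Monoid Ω] in
theorem isBlockCode_pairWord :
    Words.IsBlockCode (fun a => triCol a = 1) (pairWord F G H) := by
  refine ⟨fun p q h => ?_, fun p => ⟨[.inl (.inl p.1)], .inl (.inr p.2), rfl, rfl, ?_⟩⟩
  · simp only [pairWord, List.cons.injEq, Sum.inl.injEq, Sum.inr.injEq, and_true] at h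
    exact Prod.ext h.1 h.2
  · simp [triCol]

theorem covers_pairWord :
    Sys.Covers (triSys F G H) (pairSys F G) (pairWord F G H) Prod.fst Prod.snd Set.univ where
  wt p := by
    show _ = (1 * G.weight p.2) * F.weight p.1
    rw [one_mul]
    rfl
  inj y y' h1 h2 := Prod.ext h1 h2
  of_src p y h := ⟨h.1, h.2, trivial⟩
  to_src p y _ h := ⟨h.1, h.2.1⟩
  real p y _ := rfl
  rest p y _ := rfl
  stay _ _ _ := trivial

omit [Monoid Ω] in
-- Without letters of `H`, alternation after a letter of `G` forces the pattern `f g f g ⋯`.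
theorem exists_pairWords (u : List ((F.E ⊕ G.E) ⊕ H.E)) (a b : (F.E ⊕ G.E) ⊕ H.E)
    (ha : triCol a = 1) (hb : triCol b = 1) (hu : ∀ x ∈ u, triCol x ≠ 2)
    (h : List.IsChain (fun a b => triCol a ≠ triCol b) (a :: (u ++ [b]))) :
    ∃ W : List (F.E × G.E), W.flatMap (pairWord F G H) = u ++ [b] := by
  induction hn : u.length using Nat.strong_induction_on generalizing u a with
  | _ n ih =>
    rcases u with _ | ⟨x, u⟩
    · simp [ha, hb] at h
    obtain ⟨f, rfl⟩ : ∃ f, x = .inl (.inl f) := by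
      rcases x with (f | g) | k
      · exact ⟨f, rfl⟩
      · rw [List.cons_append, List.isChain_cons_cons] at h
        exact absurd ha h.1
      · exact absurd rfl (hu (.inr k) (by simp))
    have key : ∀ y : (F.E ⊕ G.E) ⊕ H.E, triCol y ≠ 2 → triCol (.inl (.inl f) :
        (F.E ⊕ G.E) ⊕ H.E) ≠ triCol y → ∃ g, y = .inl (.inr g) := by
      rintro ((f | g) | k) h1 h2
      · exact absurd rfl h2
      · exact ⟨g, rfl⟩
      · exact absurd rfl h1
    rcases u with _ | ⟨y, u⟩
    · simp only [List.cons_append, List.nil_append, List.isChain_cons_cons] at h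
      obtain ⟨g, rfl⟩ := key b (by simp [hb]) h.2.1
      exact ⟨[(f, g)], rfl⟩
    · simp only [List.cons_append, List.isChain_cons_cons] at h
      obtain ⟨g, rfl⟩ := key y (hu y (by simp)) h.2.1
      obtain ⟨W, hW⟩ := ih u.length (by simp only [List.length_cons] at hn; omega) u
        (.inl (.inr g)) rfl (fun x hx => hu x (by simp [hx])) h.2.2 rfl
      exact ⟨(f, g) :: W, by rw [List.flatMap_cons, hW]; rfl⟩

omit [Monoid Ω] in
theorem isChain_pairWords (g : G.E) (W : List (F.E × G.E)) :
    List.IsChain (fun a b => triCol a ≠ triCol b)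
      (.inl (.inr g) :: W.flatMap (pairWord F G H)) := by
  induction W generalizing g with
  | nil => simp
  | cons p W ih =>
    simp only [List.flatMap_cons, pairWord, List.cons_append, List.nil_append,
      List.isChain_cons_cons]
    exact ⟨by simp [triCol], by simp [triCol], ih p.2⟩

omit [Monoid Ω] in
theorem pairWords_mem_good (W : List (F.E × G.E)) : W.flatMap (pairWord F G H) ∈ good F G H := by
  rcases List.eq_nil_or_concat W with rfl | ⟨W, p, rfl⟩
  · exact mem_good.2 (Cycle.Chain.nil _)
  · have : (W.concat p).flatMap (pairWord F G H) =
        (W.flatMap (pairWord F G H) ++ [.inl (.inl p.1)]) ++ [.inl (.inr p.2)] := by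
      rw [List.concat_eq_append]
      simp [pairWord]
    have h := isChain_pairWords F G H p.2 (W.concat p)
    rw [this] at h ⊢
    exact append_singleton_mem_good.2 h

/-- The measurement of two graphings is the part of the sum over three graphings in which the
third one does not occur. -/
theorem meas_eq_triCyc {m : Ω → ℝ≥0∞} (hm : ∀ u v : Ω, m (u * v) = m (v * u))
    (hF : F.Compat m) (hG : G.Compat m) (hH : H.Compat m) :
    meas m F G = (triSys F G H).cyc m muY3 (good F G H ∩ {w | ¬ ∃ a ∈ w, triCol a = 2}) := by
  have hp : ∀ w : List ((F.E ⊕ G.E) ⊕ H.E),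
      w.rotate 1 ∈ good F G H ∩ {w | ¬ ∃ a ∈ w, triCol a = 2} ↔
        w ∈ good F G H ∩ {w | ¬ ∃ a ∈ w, triCol a = 2} := fun w => by
    simp only [Set.mem_inter_iff, rotate_mem_good, Set.mem_ofPred_eq, List.mem_rotate]
  have h := (covers_pairWord F G H).cyc_eq (isBlockCode_pairWord F G H) hm
    (compat_triSys hF hG hH) (φ := Prod.fst) (μ := muY3) (ν := muY) measurePreserving_fst _ hp ?_
  · rw [meas_eq_cyc hm hF hG]
    have huniv : {W : List (F.E × G.E) | W.flatMap (pairWord F G H) ∈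
        good F G H ∩ {w | ¬ ∃ a ∈ w, triCol a = 2}} = Set.univ := by
      refine Set.eq_univ_of_forall fun W => ⟨pairWords_mem_good F G H W, ?_⟩
      rintro ⟨a, ha, h2⟩
      simp only [List.mem_flatMap, pairWord, List.mem_cons, List.not_mem_nil, or_false] at ha
      obtain ⟨p, -, rfl | rfl⟩ := ha <;> simp [triCol] at h2
    rw [huniv] at h
    rw [h]
    refine Sys.cyc_congr _ fun w hw => ⟨fun hw' => hw'.1, fun hw' => ⟨hw', ?_⟩⟩
    rcases List.eq_nil_or_concat w with rfl | ⟨w, a, rfl⟩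
    · exact absurd (Sys.val_nil _ m muY3) hw
    rw [List.concat_eq_append] at hw' ⊢
    by_contra hcon
    -- A word that avoids both `G` and `H` would consist of letters of `F` only and could not
    -- alternate, so the missing words contribute nothing.
    have h0 : ∀ x ∈ w ++ [a], triCol x = 0 := by
      rintro ((f | g) | k) hx
      · rfl
      · exact absurd ⟨_, hx, rfl⟩ hcon
      · exact absurd ⟨_, hx, rfl⟩ hw'.2
    have hc := append_singleton_mem_good.1 hw'.1
    rcases w with _ | ⟨x, w⟩
    · simp at hc
    · rw [List.cons_append, List.isChain_cons_cons] at hc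
      exact hc.1 ((h0 a (by simp)).trans (h0 x (by simp)).symm)
  · intro u a ha hgood _
    refine exists_pairWords F G H u a a ha ha (fun x hx h2 => hgood.2 ⟨x, by simp [hx], h2⟩) ?_
    exact append_singleton_mem_good.1 hgood.1

end Pairs

end Graphing

/-! ### The trefoil property -/

namespace Graphing

variable {Ω : Type*} [Monoid Ω]

omit [Monoid Ω] in
theorem compat_pathReal {m : Ω → ℝ≥0∞} {F G : Graphing Ω} (hF : F.Compat m) (hG : G.Compat m)
    (w : List (F.E ⊕ G.E)) : IG.Compat m muY (pathReal F G w) := by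
  induction w with
  | nil => exact .of_measurePreserving (.id _)
  | cons e w ih => exact ih.comp (compat_step hF hG e)

/-- The identification of the product of two dialects with one dialect. -/
def fuse (ρ : I × I ≃ᵐ I) : Y ≃ᵐ XD := (MeasurableEquiv.refl X).prodCongr ρ

theorem measurePreserving_fuse {ρ : I × I ≃ᵐ I} (hρ : MeasurePreserving ρ volume volume) :
    MeasurePreserving (fuse ρ) muY muXD :=
  (MeasurePreserving.id muX).prod hρ

theorem compat_exec {m : Ω → ℝ≥0∞} {ρ : I × I ≃ᵐ I} (hρ : MeasurePreserving ρ volume volume)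
    {F G : Graphing Ω} (hF : F.Compat m) (hG : G.Compat m) : (exec ρ F G).Compat m := fun w =>
  (compat_pathReal hF hG w.1).conj (measurePreserving_fuse hρ)

theorem mem_exec_source {ρ : I × I ≃ᵐ I} {F G : Graphing Ω} {π : (exec ρ F G).E} {y : Y} :
    fuse ρ y ∈ (exec ρ F G).source π ↔ y ∈ outerSource F G π.1 :=
  (fuse ρ).injective.mem_set_image

theorem exec_real_fuse {ρ : I × I ≃ᵐ I} {F G : Graphing Ω} (π : (exec ρ F G).E) (y : Y) :
    (exec ρ F G).real π (fuse ρ y) = fuse ρ (pathReal F G π.1 y) := by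
  show fuse ρ (pathReal F G π.1 ((fuse ρ).symm (fuse ρ y))) = _
  rw [MeasurableEquiv.symm_apply_apply]

section Blocks

variable (ρ : I × I ≃ᵐ I) (F G H : Graphing Ω)

/-- The word of an alternating path of `F` and `G` followed by an edge of `H`. -/
def blockWord (p : (exec ρ F G).E × H.E) : List ((F.E ⊕ G.E) ⊕ H.E) :=
  p.1.1.map .inl ++ [.inr p.2]

/-- The space times three dialects, after identification of the product of the first two. -/
def fuse3 : Y × I ≃ᵐ Y :=
  ((fuse ρ).prodCongr (MeasurableEquiv.refl I)).trans MeasurableEquiv.prodAssoc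

omit [Monoid Ω] in
theorem measurePreserving_fuse3 {ρ : I × I ≃ᵐ I} (hρ : MeasurePreserving ρ volume volume) :
    MeasurePreserving (fuse3 ρ) muY3 muY :=
  (measurePreserving_prodAssoc muX volume volume).comp
    ((measurePreserving_fuse hρ).prod (MeasurePreserving.id (volume : Measure I)))

theorem isBlockCode_blockWord :
    Words.IsBlockCode (fun a => triCol a = 2) (blockWord ρ F G H) := by
  refine ⟨fun p q h => ?_, fun p => ⟨p.1.1.map .inl, .inr p.2, rfl, rfl, ?_⟩⟩
  · obtain ⟨h1, h2⟩ := List.append_inj' h rfl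
    refine Prod.ext (Subtype.ext (List.map_injective_iff.2 Sum.inl_injective h1)) ?_
    simpa using h2
  · intro b hb
    obtain ⟨l, -, rfl⟩ := List.mem_map.1 hb
    rcases l with f | g <;> simp [triCol]

omit [Monoid Ω] in
theorem wreal_triSys_inl (w : List (F.E ⊕ G.E)) (z : Y × I) :
    (triSys F G H).wreal (w.map .inl) z = (pathReal F G w z.1, z.2) := by
  induction w generalizing z with
  | nil => rfl
  | cons e w ih => exact ih _

omit [Monoid Ω] in
theorem wsrc_triSys_inl (w : List (F.E ⊕ G.E)) (z : Y × I) :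
    z ∈ (triSys F G H).wsrc (w.map .inl) ↔ z.1 ∈ pathSource F G w := by
  induction w generalizing z with
  | nil => exact Iff.rfl
  | cons e w ih => exact and_congr Iff.rfl (ih _)

theorem wwt_triSys_inl (w : List (F.E ⊕ G.E)) :
    (triSys F G H).wwt (w.map .inl) = pathWeight F G w := by
  induction w with
  | nil => rfl
  | cons e w ih =>
    rw [List.map_cons, Sys.wwt, ih]
    rfl

/-- In a closed word each block starts where an edge of `H` ended and is followed up to the source
of an edge of `H`. Since the three supports have no common point, its path in `F` and `G` then
starts and ends outside the cut of `F` and `G`, so the restriction made by execution removes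
nothing. -/
theorem covers_blockWord (hd : F.supp ∩ G.supp ∩ H.supp = ∅) :
    Sys.Covers (triSys F G H) (pairSys (exec ρ F G) H) (blockWord ρ F G H) (fuse3 ρ)
      (fun _ => ()) {z | z.1.1 ∈ H.supp} where
  wt p := by
    show H.weight p.2 * pathWeight F G p.1.1 = _
    rw [blockWord, Sys.wwt_append, wwt_triSys_inl]
    congr 1
    exact (one_mul _).symm
  inj y y' h1 _ := (fuse3 ρ).injective h1
  of_src p y h := by
    obtain ⟨h1, h2⟩ := h
    have h1' : y.1 ∈ outerSource F G p.1.1 := mem_exec_source.1 h1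
    rw [blockWord, Sys.mem_wsrc_append, wsrc_triSys_inl, wreal_triSys_inl]
    refine ⟨h1'.1, ?_, trivial⟩
    have h2' : (((exec ρ F G).real p.1 (fuse ρ y.1)).1, y.2) ∈ H.source p.2 := h2
    rwa [exec_real_fuse] at h2'
  to_src p y hK h := by
    rw [blockWord, Sys.mem_wsrc_append, wsrc_triSys_inl, wreal_triSys_inl] at h
    obtain ⟨h1, h2, -⟩ := h
    have h2' : ((pathReal F G p.1.1 y.1).1, y.2) ∈ H.source p.2 := h2
    refine ⟨mem_exec_source.2 ⟨h1, fun hc => ?_, fun hc => ?_⟩, ?_⟩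
    · exact (Set.eq_empty_iff_forall_notMem.1 hd) _ ⟨hc, hK⟩
    · exact (Set.eq_empty_iff_forall_notMem.1 hd) _ ⟨hc, H.source_subset _ _ h2'⟩
    · show (((exec ρ F G).real p.1 (fuse ρ y.1)).1, y.2) ∈ H.source p.2
      rw [exec_real_fuse]
      exact h2'
  real p y h := by
    rw [blockWord, Sys.wreal_append, wreal_triSys_inl]
    show _ = step (exec ρ F G) H (.inr p.2)
      (MeasurableEquiv.prodAssoc ((exec ρ F G).real p.1 (fuse ρ y.1), y.2))
    rw [exec_real_fuse]
    rfl
  rest _ _ _ := rfl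
  stay p y h := by
    rw [blockWord, Sys.mem_wsrc_append, wsrc_triSys_inl, wreal_triSys_inl] at h
    rw [blockWord, Sys.wreal_append, wreal_triSys_inl]
    exact H.target_subset p.2 _ h.2.1

theorem exists_leading_block {A B : Type*} (u : List (A ⊕ B)) (b : B) :
    ∃ (π : List A) (b' : B) (r : List (A ⊕ B)), u ++ [.inr b] = π.map .inl ++ .inr b' :: r ∧
      (r = [] ∨ ∃ u', r = u' ++ [.inr b]) := by
  induction u with
  | nil => exact ⟨[], b, [], rfl, .inl rfl⟩
  | cons x u ih =>
    rcases x with a | b'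
    · obtain ⟨π, b', r, h, h'⟩ := ih
      exact ⟨a :: π, b', r, by rw [List.cons_append, h]; rfl, h'⟩
    · exact ⟨[], b', u ++ [.inr b], rfl, .inr ⟨u, rfl⟩⟩

/-- The segments between letters of `H` are alternating in `F` and `G`. The assumption `hnull` is
needed because only paths with non-null domain are edges of the execution. -/
theorem exists_blockWords (u : List ((F.E ⊕ G.E) ⊕ H.E)) (h₀ h : H.E)
    (hc : List.IsChain (fun a b => triCol a ≠ triCol b) (.inr h₀ :: (u ++ [.inr h])))
    (hnull : ∀ u₁ π u₂, u ++ [.inr h] = u₁ ++ (π.map .inl ++ u₂) → muY (pathSource F G π) ≠ 0) :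
    ∃ W : List ((exec ρ F G).E × H.E), W.flatMap (blockWord ρ F G H) = u ++ [.inr h] := by
  induction hn : u.length using Nat.strong_induction_on generalizing u h₀ with
  | _ n ih =>
    obtain ⟨π, h', r, hu, hr⟩ := exists_leading_block u h
    rw [hu] at hc
    have hπ : π ≠ [] := by
      rintro rfl
      simp [triCol] at hc
    have hchain : π.IsChain (fun e e' => e.isLeft ≠ e'.isLeft) := by
      have h1 : List.IsChain (fun a b => triCol a ≠ triCol b)
          (π.map (Sum.inl : _ → (F.E ⊕ G.E) ⊕ H.E)) :=
        hc.infix ⟨[.inr h₀], .inr h' :: r, by simp⟩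
      rw [List.isChain_map] at h1
      refine h1.imp fun a b hab he => hab ?_
      rcases a with a | a <;> rcases b with b | b <;> simp_all [triCol]
    have halt : IsAltPath F G π := ⟨hπ, hchain, hnull [] π (.inr h' :: r) hu⟩
    rcases hr with rfl | ⟨u', rfl⟩
    · exact ⟨[(⟨π, halt⟩, h')], by rw [hu]; simp [blockWord]⟩
    · have hlen : u'.length < n := by
        have := congrArg List.length hu
        simp only [List.length_append, List.length_cons, List.length_map, List.length_nil] at this
        omega
      obtain ⟨W, hW⟩ := ih _ hlen u' h'
        (hc.infix ⟨.inr h₀ :: π.map .inl, [], by simp⟩)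
        (fun u₁ π' u₂ he => hnull (π.map .inl ++ .inr h' :: u₁) π' u₂ (by rw [hu, he]; simp)) rfl
      exact ⟨(⟨π, halt⟩, h') :: W, by
        rw [List.flatMap_cons, hW, hu]; simp [blockWord]⟩

theorem isChain_blockWords (h₀ : H.E) (W : List ((exec ρ F G).E × H.E)) :
    List.IsChain (fun a b => triCol a ≠ triCol b)
      (.inr h₀ :: W.flatMap (blockWord ρ F G H)) := by
  induction W generalizing h₀ with
  | nil => simp
  | cons p W ih =>
    obtain ⟨⟨π, hπ, hchain, -⟩, h⟩ := p
    have h2 : ∀ l : F.E ⊕ G.E, triCol (.inl l : (F.E ⊕ G.E) ⊕ H.E) ≠ 2 := by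
      rintro (f | g) <;> simp [triCol]
    have h1 : List.IsChain (fun a b => triCol a ≠ triCol b)
        (π.map (Sum.inl : _ → (F.E ⊕ G.E) ⊕ H.E)) := by
      rw [List.isChain_map]
      refine hchain.imp fun a b hab he => hab ?_
      rcases a with a | a <;> rcases b with b | b <;> simp_all [triCol]
    have h3 : List.IsChain (fun a b => triCol a ≠ triCol b)
        (π.map (Sum.inl : _ → (F.E ⊕ G.E) ⊕ H.E) ++ .inr h :: W.flatMap (blockWord ρ F G H)) := by
      rw [List.isChain_append]
      refine ⟨h1, ih h, ?_⟩
      intro x hx y hy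
      obtain ⟨l, -, rfl⟩ := List.mem_map.1 (List.mem_of_getLast? hx)
      simp only [List.head?_cons, Option.mem_def, Option.some.injEq] at hy
      subst hy
      exact h2 l
    obtain ⟨l, π, rfl⟩ := List.exists_cons_of_ne_nil hπ
    have h4 : List.flatMap (blockWord ρ F G H) ((⟨l :: π, hπ, hchain, by assumption⟩, h) :: W) =
        .inl l :: (π.map Sum.inl ++ .inr h :: W.flatMap (blockWord ρ F G H)) := by
      simp [blockWord]
    rw [h4, List.isChain_cons_cons]
    exact ⟨(h2 l).symm, h3⟩

theorem blockWords_mem_good (W : List ((exec ρ F G).E × H.E)) :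
    W.flatMap (blockWord ρ F G H) ∈ good F G H := by
  rcases List.eq_nil_or_concat W with rfl | ⟨W, p, rfl⟩
  · exact mem_good.2 (Cycle.Chain.nil _)
  · have : (W.concat p).flatMap (blockWord ρ F G H) =
        (W.flatMap (blockWord ρ F G H) ++ p.1.1.map .inl) ++ [.inr p.2] := by
      rw [List.concat_eq_append]
      simp [blockWord]
    have h := isChain_blockWords ρ F G H p.2 (W.concat p)
    rw [this] at h ⊢
    exact append_singleton_mem_good.2 h

/-- The closed words that visit `H` are cut after their letters of `H` into edges of the execution,
each followed by an edge of `H`. -/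
theorem meas_exec_eq_triCyc {m : Ω → ℝ≥0∞} (hm : ∀ u v : Ω, m (u * v) = m (v * u))
    {ρ : I × I ≃ᵐ I} (hρ : MeasurePreserving ρ volume volume)
    {F G H : Graphing Ω} (hF : F.Compat m) (hG : G.Compat m) (hH : H.Compat m)
    (hd : F.supp ∩ G.supp ∩ H.supp = ∅) :
    meas m (exec ρ F G) H =
      (triSys F G H).cyc m muY3 (good F G H ∩ {w | ∃ a ∈ w, triCol a = 2}) := by
  have hS := compat_triSys hF hG hH
  rw [meas_eq_cyc hm (compat_exec hρ hF hG) hH,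
    ← (covers_blockWord ρ F G H hd).cyc_eq (isBlockCode_blockWord ρ F G H) hm hS
      (measurePreserving_fuse3 hρ) _ rotate_mem_good ?_]
  · congr 1
    exact (Set.eq_univ_of_forall fun W => blockWords_mem_good ρ F G H W).symm
  · intro u a ha hgood hval
    obtain ⟨h, rfl⟩ : ∃ h, a = .inr h := by
      rcases a with (f | g) | h
      · simp [triCol] at ha
      · simp [triCol] at ha
      · exact ⟨h, rfl⟩
    refine exists_blockWords ρ F G H u h h (append_singleton_mem_good.1 hgood) ?_
    intro u₁ π u₂ he h0
    refine hval ?_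
    -- A segment with null domain makes the whole word null, because the realisers pull null sets
    -- back to null sets.
    have hq : ∀ w, Measure.QuasiMeasurePreserving ((triSys F G H).wreal w) muY3 muY3 := by
      intro w
      induction w with
      | nil => exact .id _
      | cons e w ih => exact ih.comp (hS e).quasiMeasurePreserving
    have h1 : muY3 (Prod.fst ⁻¹' pathSource F G π) = 0 :=
      Measure.quasiMeasurePreserving_fst.preimage_null h0
    have h2 := (hq u₁).preimage_null h1
    rw [Sys.val, measure_mono_null _ h2, mul_zero]
    rintro y ⟨-, hs, -⟩
    rw [he, Sys.mem_wsrc_append, Sys.mem_wsrc_append, wsrc_triSys_inl] at hs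
    exact hs.2.1

/-- The trefoil property. -/
theorem meas_exec_add {m : Ω → ℝ≥0∞} (hm : ∀ u v : Ω, m (u * v) = m (v * u))
    {ρ : I × I ≃ᵐ I} (hρ : MeasurePreserving ρ volume volume)
    {F G H : Graphing Ω} (hF : F.Compat m) (hG : G.Compat m) (hH : H.Compat m)
    (hd : F.supp ∩ G.supp ∩ H.supp = ∅) :
    meas m (exec ρ F G) H + meas m F G = triMeas m F G H := by
  rw [meas_exec_eq_triCyc hm hρ hF hG hH hd, meas_eq_triCyc F G H hm hF hG hH, ← Sys.cyc_union,
    triMeas]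
  · congr 1
    -- A closed alternating word either visits `H` or does not.
    rw [← Set.inter_union_distrib_left]
    refine Set.inter_eq_left.2 fun w _ => ?_
    exact em (∃ a ∈ w, triCol a = 2)
  · exact Set.disjoint_left.2 fun w h1 h2 => h2.2 h1.2

end Blocks

/-! ### Symmetry -/

/-- Exchange of the two dialects. -/
def swapD : Y ≃ᵐ Y := (MeasurableEquiv.refl X).prodCongr MeasurableEquiv.prodComm

theorem measurePreserving_swapD : MeasurePreserving swapD muY muY :=
  (MeasurePreserving.id muX).prod Measure.measurePreserving_swap

/-- Exchange of the last two of three dialects. -/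
def swap23 : Y × I ≃ᵐ Y × I := view3.trans viewY
where
  viewY : XD × (I × I) ≃ᵐ Y × I :=
    MeasurableEquiv.prodAssoc.trans
      (((MeasurableEquiv.refl X).prodCongr
        (MeasurableEquiv.prodAssoc.symm.trans
          (MeasurableEquiv.prodComm.prodCongr (MeasurableEquiv.refl I)))).trans
        MeasurableEquiv.prodAssoc.symm)

theorem measurePreserving_swap23 : MeasurePreserving swap23 muY3 muY3 :=
  (((measurePreserving_prodAssoc muX (volume.prod volume) volume).symm _).comp
    (((MeasurePreserving.id muX).prod
      ((Measure.measurePreserving_swap.prod (MeasurePreserving.id volume)).comp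
        ((measurePreserving_prodAssoc volume volume volume).symm _))).comp
      (measurePreserving_prodAssoc muX volume (volume.prod volume)))).comp
    measurePreserving_view3

def swapE12 (F G H : Graphing Ω) : (G.E ⊕ F.E) ⊕ H.E ≃ (F.E ⊕ G.E) ⊕ H.E :=
  Equiv.sumCongr (Equiv.sumComm _ _) (Equiv.refl _)

def swapE23 (F G H : Graphing Ω) : (F.E ⊕ H.E) ⊕ G.E ≃ (F.E ⊕ G.E) ⊕ H.E :=
  (Equiv.sumAssoc _ _ _).trans
    ((Equiv.sumCongr (Equiv.refl _) (Equiv.sumComm _ _)).trans (Equiv.sumAssoc _ _ _).symm)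

/-- Edges are relabelled and dialects exchanged. The alternation condition only asks that neighbours
belong to different graphings, so it is insensitive to their order. -/
theorem triMeas_swap12 {m : Ω → ℝ≥0∞} (hm : ∀ u v : Ω, m (u * v) = m (v * u))
    {F G H : Graphing Ω} (hF : F.Compat m) (hG : G.Compat m) (hH : H.Compat m) :
    triMeas m G F H = triMeas m F G H := by
  rw [triMeas, triMeas, ← Sys.cyc_map_equiv (S' := triSys G F H) (swapE12 F G H) hm
    (compat_triSys hF hG hH) (φ := swapD.prodCongr (MeasurableEquiv.refl I))
    (measurePreserving_swapD.prod (MeasurePreserving.id volume)) ?_ ?_ ?_ _ rotate_mem_good]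
  · congr 1
    ext W
    show W ∈ good G F H ↔ W.map (swapE12 F G H) ∈ good F G H
    rw [mem_good, mem_good, ← Cycle.map_coe, Cycle.chain_map]
    have : ∀ a : (G.E ⊕ F.E) ⊕ H.E, triCol (swapE12 F G H a) = Equiv.swap 0 1 (triCol a) := by
      rintro ((f | g) | h) <;> rfl
    simp only [this, ne_eq, EmbeddingLike.apply_eq_iff_eq]
  · rintro ((f | g) | h) <;> rfl
  · rintro ((f | g) | h) y <;> exact Iff.rfl
  · rintro ((f | g) | h) y <;> rfl

theorem triMeas_swap23 {m : Ω → ℝ≥0∞} (hm : ∀ u v : Ω, m (u * v) = m (v * u))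
    {F G H : Graphing Ω} (hF : F.Compat m) (hG : G.Compat m) (hH : H.Compat m) :
    triMeas m F H G = triMeas m F G H := by
  rw [triMeas, triMeas, ← Sys.cyc_map_equiv (S' := triSys F H G) (swapE23 F G H) hm
    (compat_triSys hF hG hH) (φ := swap23) measurePreserving_swap23 ?_ ?_ ?_ _ rotate_mem_good]
  · congr 1
    ext W
    show W ∈ good F H G ↔ W.map (swapE23 F G H) ∈ good F G H
    rw [mem_good, mem_good, ← Cycle.map_coe, Cycle.chain_map]
    have : ∀ a : (F.E ⊕ H.E) ⊕ G.E, triCol (swapE23 F G H a) = Equiv.swap 1 2 (triCol a) := by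
      rintro ((f | g) | h) <;> rfl
    simp only [this, ne_eq, EmbeddingLike.apply_eq_iff_eq]
  · rintro ((f | g) | h) <;> rfl
  · rintro ((f | g) | h) y <;> exact Iff.rfl
  · rintro ((f | g) | h) y <;> rfl

/-- The graphing without edges. -/
def empty (V : Set X) (hV : MeasurableSet V) : Graphing Ω where
  supp := V
  measurable_supp := hV
  E := Empty
  source := Empty.elim
  measurable_source := Empty.rec
  source_subset := Empty.rec
  real := Empty.elim
  target_subset := Empty.rec
  weight := Empty.elim

theorem meas_empty (m : Ω → ℝ≥0∞) (F : Graphing Ω) (V : Set X) (hV : MeasurableSet V) :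
    meas m F (empty V hV) = 0 := by
  rw [meas, ENNReal.tsum_eq_zero]
  rintro ⟨c, hc⟩
  obtain ⟨⟨f, e⟩, -⟩ := List.exists_mem_of_ne_nil _ hc.1
  exact e.elim

/-- The trefoil property with the empty graphing as third one, where only `⟦F, G⟧` survives. -/
theorem meas_comm {m : Ω → ℝ≥0∞} (hm : ∀ u v : Ω, m (u * v) = m (v * u))
    {ρ : I × I ≃ᵐ I} (hρ : MeasurePreserving ρ volume volume)
    {F G : Graphing Ω} (hF : F.Compat m) (hG : G.Compat m) : meas m F G = meas m G F := by
  have hE : (empty ∅ .empty : Graphing Ω).Compat m := Empty.rec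
  have h1 := meas_exec_add hm hρ hF hG hE (Set.inter_empty _)
  have h2 := meas_exec_add hm hρ hG hF hE (Set.inter_empty _)
  rw [meas_empty, zero_add] at h1 h2
  rw [h1, h2, triMeas_swap12 hm hF hG hE]

end Graphing

/-! ## Measure of the space -/

/-- It suffices to look at cylinders. Filling in full factors, a cylinder may be taken over an
initial segment of the coordinates, from which the first one splits off. -/
theorem measurePreserving_consEquiv :
    MeasurePreserving consEquiv
      ((volume : Measure I).prod (Measure.infinitePi fun _ : ℕ => (volume : Measure I)))
      (Measure.infinitePi fun _ : ℕ => (volume : Measure I)) := by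
  classical
  refine ⟨consEquiv.measurable, Measure.eq_infinitePi _ fun s t ht => ?_⟩
  obtain ⟨N, hN⟩ : ∃ N, s ⊆ Finset.range (N + 1) :=
    ⟨s.sup id, fun i hi => Finset.mem_range.2 (Nat.lt_succ_of_le (Finset.le_sup (f := id) hi))⟩
  let t' : ℕ → Set I := fun i => if i ∈ s then t i else Set.univ
  have ht' : ∀ i, MeasurableSet (t' i) := fun i => by
    by_cases hi : i ∈ s <;> simp [t', hi, ht]
  have h1 : (s : Set ℕ).pi t = (Finset.range (N + 1) : Set ℕ).pi t' := by
    ext x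
    simp only [Set.mem_pi, Finset.mem_coe, t']
    constructor
    · intro h i _
      by_cases hi : i ∈ s <;> simp [hi, h]
    · intro h i hi
      simpa [hi] using h i (hN hi)
  have h2 : ∏ i ∈ s, (volume : Measure I) (t i) =
      ∏ i ∈ Finset.range (N + 1), (volume : Measure I) (t' i) := by
    rw [← Finset.prod_subset hN]
    · exact Finset.prod_congr rfl fun i hi => by simp [t', hi]
    · intro i _ hi
      simp [t', hi]
  have h3 : consEquiv ⁻¹' (Finset.range (N + 1) : Set ℕ).pi t' =
      t' 0 ×ˢ (Finset.range N : Set ℕ).pi fun i => t' (i + 1) := by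
    ext ⟨d, x⟩
    simp only [Set.mem_preimage, Set.mem_pi, Finset.mem_coe, Finset.mem_range, Set.mem_prod]
    constructor
    · exact fun h => ⟨h 0 (Nat.succ_pos N), fun i hi => h (i + 1) (by omega)⟩
    · rintro ⟨h, h'⟩ (_ | i) hi
      · exact h
      · exact h' i (by omega)
  rw [consEquiv.map_apply, h1, h3, h2, Measure.prod_prod, Measure.infinitePi_pi _
    (fun i _ => ht' (i + 1)), Finset.prod_range_succ', mul_comm]

theorem measurePreserving_perm (τ : Equiv.Perm ℕ) :
    MeasurePreserving (fun (s : ℕ → I) n => s (τ n))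
      (Measure.infinitePi fun _ : ℕ => (volume : Measure I))
      (Measure.infinitePi fun _ : ℕ => (volume : Measure I)) := by
  refine ⟨by fun_prop, Measure.eq_infinitePi _ fun s t ht => ?_⟩
  rw [Measure.map_apply (by fun_prop) (.pi s.countable_toSet fun i _ => ht i)]
  have : (fun (x : ℕ → I) n => x (τ n)) ⁻¹' (s : Set ℕ).pi t =
      ((s.map τ.toEmbedding : Finset ℕ) : Set ℕ).pi fun i => t (τ.symm i) := by
    ext x
    simp only [Set.mem_preimage, Set.mem_pi, Finset.mem_coe, Finset.mem_map_equiv]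
    exact ⟨fun h i hi => by simpa using h _ hi, fun h i hi => by simpa using h (τ i) (by simpa)⟩
  rw [this, Measure.infinitePi_pi _ (fun i _ => ht _), Finset.prod_map]
  simp

theorem measurePreserving_B : MeasurePreserving B muXD muX :=
  ((MeasurePreserving.id (volume : Measure ℝ)).prod
    (measurePreserving_consEquiv.comp Measure.measurePreserving_swap)).comp
    (measurePreserving_prodAssoc _ _ _)

theorem measurePreserving_BB : MeasurePreserving BB muY muX :=
  measurePreserving_B.comp
    ((measurePreserving_B.prod (MeasurePreserving.id (volume : Measure I))).comp
      (((measurePreserving_prodAssoc muX volume volume).symm _).comp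
        ((MeasurePreserving.id muX).prod Measure.measurePreserving_swap)))

theorem map_affine (α : ℝˣ) (l : ℝ) :
    (volume : Measure ℝ).map (fun a => (α : ℝ) * a + l) =
      ENNReal.ofReal |((α⁻¹ : ℝˣ) : ℝ)| • volume := by
  have h := Real.map_volume_mul_left α.ne_zero
  have h' := (measurePreserving_add_right (volume : Measure ℝ) l).map_eq
  rw [show (fun a => (α : ℝ) * a + l) = (fun x => x + l) ∘ (fun x => (α : ℝ) * x) from rfl,
    ← Measure.map_map (by fun_prop) (by fun_prop), h, Measure.map_smul, h', Units.val_inv_eq_inv_val]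

section

variable {Ω : Type*} {m : Ω → ℝ≥0∞}

theorem compat_affine {Γ : Subgroup ℝˣ}
    (hΓ : ∀ α ∈ Γ, ∀ w : Ω, ENNReal.ofReal |(α : ℝ)| * m w = m w) {α : ℝˣ} (hα : α ∈ Γ) (l : ℝ) :
    Compat m volume fun a => (α : ℝ) * a + l :=
  -- The image measure is scaled by the inverse ratio, so the condition on `Γ` is applied to the
  -- inverse of `α`.
  ⟨by fun_prop, _, map_affine α l, hΓ _ (Γ.inv_mem hα)⟩

/-- Realisers in the microcosm are compatible with `m`. -/
theorem Microcosm.compat {ρ : I × I ≃ᵐ I} (hρ : MeasurePreserving ρ volume volume)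
    {Γ : Subgroup ℝˣ} (hΓ : ∀ α ∈ Γ, ∀ w : Ω, ENNReal.ofReal |(α : ℝ)| * m w = m w)
    {f : XD → XD} (hf : Microcosm ρ Γ f) : Compat m muXD f := by
  let π := Measure.infinitePi fun _ : ℕ => (volume : Measure I)
  have hS : ∀ {g : (ℕ → I) → (ℕ → I)}, MeasurePreserving g π π →
      Compat m muXD fun z => ((z.1.1, g z.1.2), z.2) := fun hg =>
    .of_measurePreserving (((MeasurePreserving.id volume).prod hg).prod (.id volume))
  have hc := measurePreserving_consEquiv
  have hcs := hc.symm consEquiv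
  have hid : MeasurePreserving (id : (ℕ → I) → (ℕ → I)) π π := .id _
  have hpair : MeasurePreserving (fun p : I × (I × (ℕ → I)) => (ρ (p.1, p.2.1), p.2.2))
      (volume.prod (volume.prod π)) (volume.prod π) :=
    (hρ.prod hid).comp ((measurePreserving_prodAssoc volume volume π).symm _)
  have hunpair : MeasurePreserving
      (fun p : I × (ℕ → I) => ((ρ.symm p.1).1, ((ρ.symm p.1).2, p.2)))
      (volume.prod π) (volume.prod (volume.prod π)) :=
    (measurePreserving_prodAssoc volume volume π).comp ((hρ.symm ρ).prod hid)
  induction hf with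
  | one => exact .of_measurePreserving (.id _)
  | comp _ _ ihf ihg => exact ihf.comp ihg
  | affine α hα l =>
    exact ((compat_affine hΓ hα l).prod_left (ν := π)).prod_left (ν := (volume : Measure I))
  | perm τ _ => exact hS (measurePreserving_perm τ)
  | pair =>
    exact hS (hc.comp (hpair.comp (((MeasurePreserving.id volume).prod hcs).comp hcs)))
  | unpair =>
    exact hS (hc.comp (((MeasurePreserving.id volume).prod hc).comp (hunpair.comp hcs)))
  | xch =>
    have hx : MeasurePreserving (fun p : (I × (ℕ → I)) × I => ((p.2, p.1.2), p.1.1))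
        ((volume.prod π).prod volume) ((volume.prod π).prod volume) :=
      ((Measure.measurePreserving_swap).prod (.id volume)).comp
        (Measure.measurePreserving_swap.comp (measurePreserving_prodAssoc volume π volume))
    have hy : MeasurePreserving (fun p : (ℕ → I) × I => (consEquiv (p.2, fun n => p.1 (n + 1)), p.1 0))
        (π.prod volume) (π.prod volume) :=
      (hc.prod (.id volume)).comp (hx.comp (hcs.prod (.id volume)))
    exact .of_measurePreserving (((measurePreserving_prodAssoc volume π volume).symm _).comp
      (((MeasurePreserving.id (volume : Measure ℝ)).prod hy).comp
        (measurePreserving_prodAssoc volume π volume)))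

end

/-! ## Closure properties of the microcosm -/

namespace Microcosm

variable {ρ : I × I ≃ᵐ I} {Γ : Subgroup ℝˣ}

/-- `0 ↔ 1` -/
def perm01 : Equiv.Perm ℕ where
  toFun | 0 => 1 | 1 => 0 | n + 2 => n + 2
  invFun | 0 => 1 | 1 => 0 | n + 2 => n + 2
  left_inv | 0 => rfl | 1 => rfl | _ + 2 => rfl
  right_inv | 0 => rfl | 1 => rfl | _ + 2 => rfl

/-- `0 ↔ 2` -/
def perm02 : Equiv.Perm ℕ where
  toFun | 0 => 2 | 1 => 1 | 2 => 0 | n + 3 => n + 3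
  invFun | 0 => 2 | 1 => 1 | 2 => 0 | n + 3 => n + 3
  left_inv | 0 => rfl | 1 => rfl | 2 => rfl | _ + 3 => rfl
  right_inv | 0 => rfl | 1 => rfl | 2 => rfl | _ + 3 => rfl

/-- `0 ↦ 1 ↦ 2 ↦ 0` -/
def perm012 : Equiv.Perm ℕ where
  toFun | 0 => 1 | 1 => 2 | 2 => 0 | n + 3 => n + 3
  invFun | 0 => 2 | 1 => 0 | 2 => 1 | n + 3 => n + 3
  left_inv | 0 => rfl | 1 => rfl | 2 => rfl | _ + 3 => rfl
  right_inv | 0 => rfl | 1 => rfl | 2 => rfl | _ + 3 => rfl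

/-- `0 ↔ 2` and `1 ↔ 3` -/
def perm0213 : Equiv.Perm ℕ where
  toFun | 0 => 2 | 1 => 3 | 2 => 0 | 3 => 1 | n + 4 => n + 4
  invFun | 0 => 2 | 1 => 3 | 2 => 0 | 3 => 1 | n + 4 => n + 4
  left_inv | 0 => rfl | 1 => rfl | 2 => rfl | 3 => rfl | _ + 4 => rfl
  right_inv | 0 => rfl | 1 => rfl | 2 => rfl | 3 => rfl | _ + 4 => rfl

/-- A permutation acting from the second coordinate on. -/
def permShift (τ : Equiv.Perm ℕ) : Equiv.Perm ℕ where
  toFun | 0 => 0 | 1 => 1 | n + 2 => τ n + 2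
  invFun | 0 => 0 | 1 => 1 | n + 2 => τ.symm n + 2
  left_inv | 0 => rfl | 1 => rfl | n + 2 => congrArg (· + 2) (τ.symm_apply_apply n)
  right_inv | 0 => rfl | 1 => rfl | n + 2 => congrArg (· + 2) (τ.apply_symm_apply n)

theorem of_perm {τ : Equiv.Perm ℕ} (N : ℕ) (h : ∀ n, τ (n + N) = n + N) :
    Microcosm ρ Γ fun z => ((z.1.1, fun n => z.1.2 (τ n)), z.2) := by
  refine .perm τ ((Set.finite_lt_nat N).subset fun n hn => ?_)
  by_contra hlt
  obtain ⟨k, rfl⟩ := Nat.exists_eq_add_of_le' (not_lt.1 hlt)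
  exact hn (h k)

theorem swap01 : Microcosm ρ Γ fun z => ((z.1.1, fun n => z.1.2 (perm01 n)), z.2) :=
  of_perm 2 fun _ => rfl

theorem swap02 : Microcosm ρ Γ fun z => ((z.1.1, fun n => z.1.2 (perm02 n)), z.2) :=
  of_perm 3 fun _ => rfl

theorem rot : Microcosm ρ Γ fun z => ((z.1.1, fun n => z.1.2 (perm012 n)), z.2) :=
  of_perm 3 fun _ => rfl

theorem rot_symm : Microcosm ρ Γ fun z => ((z.1.1, fun n => z.1.2 (perm012.symm n)), z.2) :=
  of_perm 3 fun _ => rfl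

theorem swap0213 : Microcosm ρ Γ fun z => ((z.1.1, fun n => z.1.2 (perm0213 n)), z.2) :=
  of_perm 4 fun _ => rfl

theorem congr {f g : XD → XD} (hf : Microcosm ρ Γ f) (h : ∀ z, f z = g z) : Microcosm ρ Γ g :=
  (funext h : f = g) ▸ hf

theorem ext_XD {z z' : XD} (h1 : z.1.1 = z'.1.1) (h2 : ∀ n, z.1.2 n = z'.1.2 n)
    (h3 : z.2 = z'.2) : z = z' :=
  Prod.ext (Prod.ext h1 (funext h2)) h3

theorem affineX_id {α : ℝˣ} (hα : α ∈ Γ) (l : ℝ) :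
    Microcosm ρ Γ ((affineX α l).prodCongr (MeasurableEquiv.refl I)) :=
  .affine α hα l

theorem affineX_symm_id {α : ℝˣ} (hα : α ∈ Γ) (l : ℝ) :
    Microcosm ρ Γ ((affineX α l).symm.prodCongr (MeasurableEquiv.refl I)) := by
  refine (Microcosm.affine α⁻¹ (Γ.inv_mem hα) (-((α⁻¹ : ℝˣ) : ℝ) * l)).congr fun z => ?_
  refine ext_XD ?_ (fun _ => rfl) rfl
  show ((α⁻¹ : ℝˣ) : ℝ) * z.1.1 + -((α⁻¹ : ℝˣ) : ℝ) * l = ((α⁻¹ : ℝˣ) : ℝ) * (z.1.1 - l)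
  ring

/-- On the leading coordinates: `(x, ρ(y,z)) ↦ (ρ(y,z), x) ↦ (y, z, x) ↦ (x, z, y) ↦ (ρ(x,z), y) ↦
(y, ρ(x,z))`. The map is an involution, so the same composite serves for its inverse. -/
theorem twist_id : Microcosm ρ Γ ((twist ρ).prodCongr (MeasurableEquiv.refl I)) := by
  refine (swap01.comp (pair.comp (swap02.comp (unpair.comp swap01)))).congr fun z => ?_
  refine ext_XD rfl (fun n => ?_) rfl
  match n with
  | 0 => rfl
  | 1 => rfl
  | n + 2 => rfl

theorem twist_symm_id : Microcosm ρ Γ ((twist ρ).symm.prodCongr (MeasurableEquiv.refl I)) := by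
  refine (swap01.comp (pair.comp (swap02.comp (unpair.comp swap01)))).congr fun z => ?_
  refine ext_XD rfl (fun n => ?_) rfl
  match n with
  | 0 => rfl
  | 1 => rfl
  | n + 2 => rfl

/-- On the leading coordinates: `(x, ρ(y,z)) ↦ (ρ(y,z), x) ↦ (y, z, x) ↦ (x, y, z) ↦ (ρ(x,y), z)`.
-/
theorem merge_id : Microcosm ρ Γ ((merge ρ).prodCongr (MeasurableEquiv.refl I)) := by
  refine (pair.comp (rot_symm.comp (unpair.comp swap01))).congr fun z => ?_
  refine ext_XD rfl (fun n => ?_) rfl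
  match n with
  | 0 => rfl
  | 1 => rfl
  | n + 2 => rfl

theorem merge_symm_id : Microcosm ρ Γ ((merge ρ).symm.prodCongr (MeasurableEquiv.refl I)) := by
  refine (swap01.comp (pair.comp (rot.comp unpair))).congr fun z => ?_
  refine ext_XD rfl (fun n => ?_) rfl
  match n with
  | 0 => rfl
  | 1 => rfl
  | n + 2 => rfl

/-- The exchange `(x, ρ (d, d')) ↦ (x, ρ (d', d))`. -/
theorem exchange : Microcosm ρ Γ fun z => (z.1, ρ ((ρ.symm z.2).2, (ρ.symm z.2).1)) := by
  refine (xch.comp (pair.comp (swap01.comp (unpair.comp xch)))).congr fun z => ?_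
  refine ext_XD rfl (fun n => ?_) rfl
  match n with
  | 0 => rfl
  | n + 1 => rfl

/-- The map `f` acting on the first component of the dialect. -/
def actL (ρ : I × I ≃ᵐ I) (f : XD → XD) (z : XD) : XD :=
  ((f (z.1, (ρ.symm z.2).1)).1, ρ ((f (z.1, (ρ.symm z.2).1)).2, (ρ.symm z.2).2))

/-- The map `f` acting on the second component of the dialect. -/
def actR (ρ : I × I ≃ᵐ I) (f : XD → XD) (z : XD) : XD :=
  ((f (z.1, (ρ.symm z.2).2)).1, ρ ((ρ.symm z.2).1, (f (z.1, (ρ.symm z.2).2)).2))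

/-- Only the exchange generator touches the dialect. For it, with the dialect after the semicolon:
`(x; ρ(d,d')) ↦ (ρ(d,d'); x) ↦ (d, d'; x) ↦ (x, d'; d) ↦ (ρ(x,d'); d) ↦ (d; ρ(x,d'))`. -/
theorem actL_mem {f : XD → XD} (hf : Microcosm ρ Γ f) : Microcosm ρ Γ (actL ρ f) := by
  have hid : ∀ (z : XD), ρ ((ρ.symm z.2).1, (ρ.symm z.2).2) = z.2 := fun z =>
    ρ.apply_symm_apply z.2
  induction hf with
  | one => exact one.congr fun z => Prod.ext rfl (hid z).symm
  | comp _ _ ihf ihg => exact (ihf.comp ihg).congr fun z => by simp [actL]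
  | affine α hα l => exact (affine α hα l).congr fun z => Prod.ext rfl (hid z).symm
  | perm τ hτ => exact (perm τ hτ).congr fun z => Prod.ext rfl (hid z).symm
  | pair => exact pair.congr fun z => Prod.ext rfl (hid z).symm
  | unpair => exact unpair.congr fun z => Prod.ext rfl (hid z).symm
  | xch =>
    refine (xch.comp (pair.comp (xch.comp (unpair.comp xch)))).congr fun z => ?_
    refine ext_XD rfl (fun n => ?_) rfl
    match n with
    | 0 => rfl
    | n + 1 => rfl

theorem actR_mem {f : XD → XD} (hf : Microcosm ρ Γ f) : Microcosm ρ Γ (actR ρ f) :=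
  (exchange.comp (hf.actL_mem.comp exchange)).congr fun z => by simp [actL, actR]

/-- The map `f` acting on the space without its first two coordinates, and on the first one as
dialect. -/
def bangMap (f : XD → XD) (z : XD) : XD :=
  (BB ((f ((BB.symm z.1).1, (BB.symm z.1).2.1)).1,
    ((f ((BB.symm z.1).1, (BB.symm z.1).2.1)).2, (BB.symm z.1).2.2)), z.2)

/-- Generators acting on the cube are conjugated past the two new coordinates. The exchange with the
dialect becomes a transposition, since the dialect is now the coordinate `0` and the head of the old
sequence is the coordinate `2`. -/
theorem bangMap_mem {f : XD → XD} (hf : Microcosm ρ Γ f) : Microcosm ρ Γ (bangMap f) := by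
  induction hf with
  | one => exact one.congr fun z => Prod.ext (BB.apply_symm_apply z.1).symm rfl
  | comp _ _ ihf ihg => exact (ihf.comp ihg).congr fun z => by simp [bangMap]
  | affine α hα l =>
    refine (affine α hα l).congr fun z => ext_XD rfl (fun n => ?_) rfl
    match n with
    | 0 => rfl
    | 1 => rfl
    | n + 2 => rfl
  | perm τ hτ =>
    have hτ' : {n | permShift τ n ≠ n}.Finite := by
      refine ((hτ.image (· + 2)).union ((Set.finite_lt_nat 2))).subset fun n hn => ?_
      match n with
      | 0 => exact .inr (by simp)
      | 1 => exact .inr (by simp)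
      | n + 2 => exact .inl ⟨n, fun h => hn (congrArg (· + 2) h), rfl⟩
    refine (perm (permShift τ) hτ').congr fun z => ext_XD rfl (fun n => ?_) rfl
    match n with
    | 0 => rfl
    | 1 => rfl
    | n + 2 => rfl
  | pair =>
    refine (rot.comp (pair.comp swap0213)).congr fun z => ext_XD rfl (fun n => ?_) rfl
    match n with
    | 0 => rfl
    | 1 => rfl
    | 2 => rfl
    | n + 3 => rfl
  | unpair =>
    refine (swap0213.comp (unpair.comp rot_symm)).congr fun z => ext_XD rfl (fun n => ?_) rfl
    match n with
    | 0 => rfl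
    | 1 => rfl
    | 2 => rfl
    | 3 => rfl
    | n + 4 => rfl
  | xch =>
    refine swap02.congr fun z => ext_XD rfl (fun n => ?_) rfl
    match n with
    | 0 => rfl
    | 1 => rfl
    | 2 => rfl
    | n + 3 => rfl

end Microcosm

/-! ### Stability of the microcosm under the operations on graphings -/

namespace Graphing

variable {Ω : Type*} {ρ : I × I ≃ᵐ I} {Γ : Subgroup ℝˣ} {F G : Graphing Ω}

theorem InMicrocosm.compat {m : Ω → ℝ≥0∞} (hF : F.InMicrocosm ρ Γ)
    (hρ : MeasurePreserving ρ volume volume)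
    (hΓ : ∀ α ∈ Γ, ∀ w : Ω, ENNReal.ofReal |(α : ℝ)| * m w = m w) : F.Compat m :=
  fun e => (hF e).compat hρ hΓ

theorem InMicrocosm.bang (hF : F.InMicrocosm ρ Γ) : F.bang.InMicrocosm ρ Γ :=
  fun e => (hF e).bangMap_mem

theorem InMicrocosm.mapX (hF : F.InMicrocosm ρ Γ) {T : X ≃ᵐ X}
    (hT : Microcosm ρ Γ (T.prodCongr (MeasurableEquiv.refl I)))
    (hT' : Microcosm ρ Γ (T.symm.prodCongr (MeasurableEquiv.refl I))) :
    (F.mapX T).InMicrocosm ρ Γ :=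
  fun e => hT.comp ((hF e).comp hT')

/-- After identification of the two dialects by `ρ`, an edge of `F` acts through the first half of
the dialect (`actL`) and an edge of `G` through the second (`actR`). -/
theorem InMicrocosm.exec [Monoid Ω] (hF : F.InMicrocosm ρ Γ) (hG : G.InMicrocosm ρ Γ) :
    (F.exec ρ G).InMicrocosm ρ Γ := by
  have key : ∀ w : List (F.E ⊕ G.E),
      Microcosm ρ Γ (fuse ρ ∘ pathReal F G w ∘ (fuse ρ).symm) := by
    intro w
    induction w with
    | nil => exact Microcosm.one.congr fun z => ((fuse ρ).apply_symm_apply z).symm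
    | cons e w ih =>
      have h : Microcosm ρ Γ (fuse ρ ∘ step F G e ∘ (fuse ρ).symm) := by
        cases e with
        | inl e => exact (hF e).actL_mem
        | inr e => exact (hG e).actR_mem
      refine (ih.comp h).congr fun z => ?_
      simp [pathReal]
  exact fun w => key w.1

theorem InMicrocosm.links [Monoid Ω] {V W : Set X} {hV : MeasurableSet V} {hW : MeasurableSet W}
    {S T : X ≃ᵐ X} (hS : Microcosm ρ Γ (S.prodCongr (MeasurableEquiv.refl I)))
    (hS' : Microcosm ρ Γ (S.symm.prodCongr (MeasurableEquiv.refl I)))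
    (hT : Microcosm ρ Γ (T.prodCongr (MeasurableEquiv.refl I)))
    (hT' : Microcosm ρ Γ (T.symm.prodCongr (MeasurableEquiv.refl I))) :
    (links V W hV hW S T : Graphing Ω).InMicrocosm ρ Γ := by
  rintro ⟨_ | _, _ | _⟩
  exacts [hS, hS', hT, hT']

theorem trans_id {S T : X ≃ᵐ X} (hS : Microcosm ρ Γ (S.prodCongr (MeasurableEquiv.refl I)))
    (hT : Microcosm ρ Γ (T.prodCongr (MeasurableEquiv.refl I))) :
    Microcosm ρ Γ ((S.trans T).prodCongr (MeasurableEquiv.refl I)) :=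
  hT.comp hS

theorem trans_symm_id {S T : X ≃ᵐ X}
    (hS : Microcosm ρ Γ (S.symm.prodCongr (MeasurableEquiv.refl I)))
    (hT : Microcosm ρ Γ (T.symm.prodCongr (MeasurableEquiv.refl I))) :
    Microcosm ρ Γ ((S.trans T).symm.prodCongr (MeasurableEquiv.refl I)) :=
  hS.comp hT

theorem prom_inMicrocosm [Monoid Ω] {VA VB : Set X} (hA : MeasurableSet VA)
    (hB : MeasurableSet VB) {αA αB : ℝˣ} (hαA : αA ∈ Γ) (hαB : αB ∈ Γ) (lA lB : ℝ) :
    (prom ρ VA VB hA hB (affineX αA lA) (affineX αB lB) : Graphing Ω).InMicrocosm ρ Γ := by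
  have hA' := Microcosm.affineX_id (ρ := ρ) hαA lA
  have hB' := Microcosm.affineX_id (ρ := ρ) hαB lB
  have hAs := Microcosm.affineX_symm_id (ρ := ρ) hαA lA
  have hBs := Microcosm.affineX_symm_id (ρ := ρ) hαB lB
  generalize affineX αA lA = θA at *
  generalize affineX αB lB = θB at *
  exact .links (trans_id .twist_id hA') (trans_symm_id .twist_symm_id hAs)
    (trans_id .twist_id (trans_id .merge_id hB'))
    (trans_symm_id .twist_symm_id (trans_symm_id .merge_symm_id hBs))

end Graphing

/-! ### Invariance under null sets -/

namespace Sys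

variable {Ω Z L L' N : Type*} [Monoid Ω] [MeasurableSpace Z]

omit [Monoid Ω] in
theorem mem_prim_map (S : Sys Ω Z L) {f : N → L} (hf : Function.Injective f) {w : List N} {y : Z} :
    y ∈ S.prim (w.map f) ↔ w ≠ [] ∧ y ∈ S.wsrc (w.map f) ∧ S.wreal (w.map f) y = y ∧
      ∀ u v, u ≠ [] → v ≠ [] → u ++ v = w → v ++ u = w → S.wreal (u.map f) y ≠ y := by
  have hinj := List.map_injective_iff.2 hf
  constructor
  · rintro ⟨h0, hs, hr, hp⟩
    refine ⟨by simpa using h0, hs, hr, fun u v hu hv huv hvu => ?_⟩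
    exact hp (u.map f) (v.map f) (by simpa) (by simpa) (by rw [← List.map_append, huv])
      (by rw [← List.map_append, hvu])
  · rintro ⟨h0, hs, hr, hp⟩
    refine ⟨by simpa using h0, hs, hr, fun u v hu hv huv hvu => ?_⟩
    obtain ⟨u, v, rfl, rfl, rfl⟩ := List.map_eq_append_iff.1 huv.symm
    refine hp u v (by simpa using hu) (by simpa using hv) rfl (hinj ?_)
    rw [List.map_append, hvu]

omit [Monoid Ω] in
theorem quasiMeasurePreserving_wreal {S : Sys Ω Z L} {μ : Measure Z}
    (hS : ∀ l, Measure.QuasiMeasurePreserving (S.st l) μ μ) (w : List L) :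
    Measure.QuasiMeasurePreserving (S.wreal w) μ μ := by
  induction w with
  | nil => exact .id _
  | cons e w ih => exact ih.comp (hS e)

/-- Letters with null source can be dropped from every sum: the points that reach such a source
along a prefix form a null set. -/
theorem measure_src_ne_zero {S : Sys Ω Z L} {μ : Measure Z}
    (hS : ∀ l, Measure.QuasiMeasurePreserving (S.st l) μ μ) {m : Ω → ℝ≥0∞} {w : List L}
    (hw : S.val m μ w ≠ 0) {l : L} (hl : l ∈ w) : μ (S.src l) ≠ 0 := by
  intro h0
  obtain ⟨u, v, rfl⟩ := List.append_of_mem hl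
  refine hw ?_
  rw [val, measure_mono_null _ ((quasiMeasurePreserving_wreal hS u).preimage_null h0), mul_zero]
  rintro y ⟨-, hs, -⟩
  rw [mem_wsrc_append] at hs
  exact hs.2.1

theorem cyc_eq_tsum_map {S : Sys Ω Z L} {μ : Measure Z} (m : Ω → ℝ≥0∞)
    (hS : ∀ l, Measure.QuasiMeasurePreserving (S.st l) μ μ) {f : N → L}
    (hf : Function.Injective f) (hrange : ∀ l, μ (S.src l) ≠ 0 → l ∈ Set.range f) :
    S.cyc m μ Set.univ = ∑' w : List N, S.val m μ (w.map f) / (w.length : ℝ≥0∞) := by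
  rw [cyc, ← (List.map_injective_iff.2 hf).tsum_eq]
  · simp
  · intro w hw
    have hw' : S.val m μ w ≠ 0 := by
      intro h0
      simp [h0] at hw
    rw [Set.range_list_map]
    exact fun l hl => hrange l (measure_src_ne_zero hS hw' hl)

/-- Systems which agree up to null sets have equal sums over closed words. -/
theorem cyc_congr_ae {S : Sys Ω Z L} {S' : Sys Ω Z L'} {μ : Measure Z} (m : Ω → ℝ≥0∞)
    (hS : ∀ l, Measure.QuasiMeasurePreserving (S.st l) μ μ)
    (hS' : ∀ l, Measure.QuasiMeasurePreserving (S'.st l) μ μ)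
    {f : N → L} {f' : N → L'} (hf : Function.Injective f) (hf' : Function.Injective f')
    (hrange : ∀ l, μ (S.src l) ≠ 0 → l ∈ Set.range f)
    (hrange' : ∀ l, μ (S'.src l) ≠ 0 → l ∈ Set.range f')
    (hwt : ∀ n, S.wt (f n) = S'.wt (f' n))
    (hae : ∀ n, ∀ᵐ y ∂μ, (y ∈ S.src (f n) ↔ y ∈ S'.src (f' n)) ∧
      (y ∈ S.src (f n) → S.st (f n) y = S'.st (f' n) y)) :
    S.cyc m μ Set.univ = S'.cyc m μ Set.univ := by
  have hword : ∀ w : List N, ∀ᵐ y ∂μ, (y ∈ S.wsrc (w.map f) ↔ y ∈ S'.wsrc (w.map f')) ∧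
      (y ∈ S.wsrc (w.map f) → S.wreal (w.map f) y = S'.wreal (w.map f') y) := by
    intro w
    induction w with
    | nil => exact .of_forall fun y => ⟨Iff.rfl, fun _ => rfl⟩
    | cons n w ih =>
      filter_upwards [hae n, (hS (f n)).ae ih] with y h1 h2
      simp only [List.map_cons, mem_wsrc_cons, wreal_cons]
      constructor
      · constructor
        · rintro ⟨h3, h4⟩
          exact ⟨h1.1.1 h3, by rw [← h1.2 h3]; exact h2.1.1 h4⟩
        · rintro ⟨h3, h4⟩
          have h5 := h1.1.2 h3
          rw [← h1.2 h5] at h4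
          exact ⟨h5, h2.1.2 h4⟩
      · rintro ⟨h3, h4⟩
        rw [h2.2 h4, h1.2 h3]
  rw [cyc_eq_tsum_map m hS hf hrange, cyc_eq_tsum_map m hS' hf' hrange']
  refine tsum_congr fun w => ?_
  have hw : S.wwt (w.map f) = S'.wwt (w.map f') := by
    induction w with
    | nil => rfl
    | cons n w ih => rw [List.map_cons, List.map_cons, wwt, wwt, ih, hwt]
  have hprim : S.prim (w.map f) =ᵐ[μ] S'.prim (w.map f') := by
    -- The conditions in `prim` concern the word and its prefixes, hence only countably many
    -- statements that hold almost everywhere.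
    have hall : ∀ᵐ y ∂μ, ∀ k, (y ∈ S.wsrc ((w.take k).map f) ↔ y ∈ S'.wsrc ((w.take k).map f')) ∧
        (y ∈ S.wsrc ((w.take k).map f) →
          S.wreal ((w.take k).map f) y = S'.wreal ((w.take k).map f') y) :=
      ae_all_iff.2 fun k => hword _
    filter_upwards [hall] with y hy
    refine propext ?_
    show y ∈ S.prim (w.map f) ↔ y ∈ S'.prim (w.map f')
    rw [S.mem_prim_map hf, S'.mem_prim_map hf']
    have h1 := hy w.length
    rw [List.take_length] at h1
    refine and_congr Iff.rfl ?_
    constructor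
    · rintro ⟨hs, hr, hp⟩
      refine ⟨h1.1.1 hs, by rw [← h1.2 hs, hr], fun u v hu hv huv hvu => ?_⟩
      have h2 := hy u.length
      rw [← huv, List.take_left] at h2
      rw [← huv, List.map_append, mem_wsrc_append] at hs
      rw [← h2.2 hs.1]
      exact hp u v hu hv huv hvu
    · rintro ⟨hs, hr, hp⟩
      have hs' := h1.1.2 hs
      refine ⟨hs', by rw [h1.2 hs', hr], fun u v hu hv huv hvu => ?_⟩
      have h2 := hy u.length
      rw [← huv, List.take_left] at h2
      rw [← huv, List.map_append, mem_wsrc_append] at hs'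
      rw [h2.2 hs'.1]
      exact hp u v hu hv huv hvu
  rw [val, val, hw, measure_congr hprim]

end Sys

namespace Graphing

variable {Ω : Type*}

/-- The measurement is invariant under equality up to null sets. -/
theorem AEEq.meas_eq [Monoid Ω] {m : Ω → ℝ≥0∞} (hm : ∀ u v : Ω, m (u * v) = m (v * u))
    {F F' H : Graphing Ω} (h : F.AEEq F') (hF : F.Compat m) (hF' : F'.Compat m)
    (hH : H.Compat m) : meas m F H = meas m F' H := by
  obtain ⟨-, θ, hθ⟩ := h
  rw [meas_eq_cyc hm hF hH, meas_eq_cyc hm hF' hH]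
  have hπ : Measure.QuasiMeasurePreserving (fun y : Y => (y.1, y.2.1)) muY muXD :=
    Measure.quasiMeasurePreserving_fst.comp measurePreserving_viewL.quasiMeasurePreserving
  have hstep : ∀ e : {e : F.E // muXD (F.source e) ≠ 0}, ∀ᵐ y ∂muY,
      (y ∈ stepSource F H (.inl e.1) ↔ y ∈ stepSource F' H (.inl (θ e).1)) ∧
        (y ∈ stepSource F H (.inl e.1) →
          step F H (.inl e.1) y = step F' H (.inl (θ e).1) y) := by
    intro e
    have h1 := hπ.ae (hθ e).2.1.mem_iff
    have h2 := hπ.ae (ae_imp_of_ae_restrict (hθ e).2.2)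
    filter_upwards [h1, h2] with y hy1 hy2
    refine ⟨hy1, fun hy => ?_⟩
    have h3 := hy2 hy
    show (((F.real e.1 (y.1, y.2.1)).1), ((F.real e.1 (y.1, y.2.1)).2, y.2.2)) =
      (((F'.real (θ e).1 (y.1, y.2.1)).1), ((F'.real (θ e).1 (y.1, y.2.1)).2, y.2.2))
    rw [h3]
  have hnull : ∀ {F : Graphing Ω} (p : F.E × H.E), muY ((pairSys F H).src p) ≠ 0 →
      muXD (F.source p.1) ≠ 0 := fun p hp h0 =>
    hp (measure_mono_null (fun y hy => hy.1) (hπ.preimage_null h0))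
  refine Sys.cyc_congr_ae m (N := {e : F.E // muXD (F.source e) ≠ 0} × H.E)
    (fun p => (compat_pairSys hF hH p).quasiMeasurePreserving)
    (fun p => (compat_pairSys hF' hH p).quasiMeasurePreserving)
    (f := fun p => (p.1.1, p.2)) (f' := fun p => ((θ p.1).1, p.2)) ?_ ?_ ?_ ?_ ?_ ?_
  · rintro ⟨e, h⟩ ⟨e', h'⟩ he
    simp only [Prod.mk.injEq] at he
    exact Prod.ext (Subtype.ext he.1) he.2
  · rintro ⟨e, h⟩ ⟨e', h'⟩ he
    simp only [Prod.mk.injEq] at he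
    exact Prod.ext (θ.injective (Subtype.ext he.1)) he.2
  · exact fun p hp => ⟨(⟨p.1, hnull p hp⟩, p.2), rfl⟩
  · exact fun p hp => ⟨(θ.symm ⟨p.1, hnull p hp⟩, p.2), by simp⟩
  · intro p
    show H.weight p.2 * F.weight p.1.1 = H.weight p.2 * F'.weight (θ p.1).1
    rw [(hθ p.1).1]
  · rintro ⟨e, h⟩
    filter_upwards [hstep e] with y hy
    constructor
    · show (y ∈ stepSource F H (.inl e.1) ∧ step F H (.inl e.1) y ∈ stepSource F H (.inr h)) ↔
        (y ∈ stepSource F' H (.inl (θ e).1) ∧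
          step F' H (.inl (θ e).1) y ∈ stepSource F' H (.inr h))
      constructor
      · rintro ⟨h1, h2⟩
        refine ⟨hy.1.1 h1, ?_⟩
        rw [← hy.2 h1]
        exact h2
      · rintro ⟨h1, h2⟩
        have h3 := hy.1.2 h1
        rw [← hy.2 h3] at h2
        exact ⟨h3, h2⟩
    · rintro ⟨h1, -⟩
      show step F H (.inr h) (step F H (.inl e.1) y) =
        step F' H (.inr h) (step F' H (.inl (θ e).1) y)
      rw [hy.2 h1]
      rfl

/-- Equality of graphings up to a renaming of the edges. -/
def EEq (F G : Graphing Ω) : Prop :=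
  F.supp = G.supp ∧ ∃ θ : F.E ≃ G.E, ∀ e, F.weight e = G.weight (θ e) ∧
    F.source e = G.source (θ e) ∧ ∀ z ∈ F.source e, F.real e z = G.real (θ e) z

theorem AEEq.trans_eEq {F G H : Graphing Ω} (h : F.AEEq G) (h' : G.EEq H) : F.AEEq H := by
  obtain ⟨h0, θ, hθ⟩ := h
  obtain ⟨h0', η, hη⟩ := h'
  refine ⟨h0.trans h0', θ.trans (η.subtypeEquiv fun e => by rw [(hη e).2.1]), fun e => ?_⟩
  refine ⟨(hθ e).1.trans (hη _).1, (hη _).2.1 ▸ (hθ e).2.1, ?_⟩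
  rw [ae_restrict_iff' (F.measurable_source _)]
  filter_upwards [(hθ e).2.1.mem_iff, ae_imp_of_ae_restrict (hθ e).2.2] with z h1 h2 hz
  rw [h2 hz, (hη _).2.2 z (h1.1 hz)]
  rfl

theorem AEEq.refl (F : Graphing Ω) : F.AEEq F :=
  ⟨rfl, Equiv.refl _, fun _ => ⟨rfl, .rfl, .of_forall fun _ => rfl⟩⟩

theorem EEq.aeEq {F G : Graphing Ω} (h : F.EEq G) : F.AEEq G := (AEEq.refl F).trans_eEq h

theorem EEq.mapX {F G : Graphing Ω} (h : F.EEq G) (T : X ≃ᵐ X) : (F.mapX T).EEq (G.mapX T) := by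
  obtain ⟨h0, θ, hθ⟩ := h
  refine ⟨congrArg (T '' ·) h0, θ, fun e => ⟨(hθ e).1, ?_, ?_⟩⟩
  · exact congrArg (_ '' ·) (hθ e).2.1
  · rintro _ ⟨z, hz, rfl⟩
    show (T.prodCongr (MeasurableEquiv.refl I)) (F.real e
      ((T.prodCongr (MeasurableEquiv.refl I)).symm _)) = (T.prodCongr (MeasurableEquiv.refl I))
        (G.real (θ e) ((T.prodCongr (MeasurableEquiv.refl I)).symm _))
    rw [MeasurableEquiv.symm_apply_apply, (hθ e).2.2 z hz]

end Graphing

/-! ### Perennisation, twist and merge -/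

namespace Graphing

variable {Ω : Type*}

theorem mem_mapX_source {F : Graphing Ω} {T : X ≃ᵐ X} {e : F.E} {z : XD} :
    z ∈ (F.mapX T).source e ↔ (T.symm z.1, z.2) ∈ F.source e := by
  show z ∈ (T.prodCongr (MeasurableEquiv.refl I)) '' F.source e ↔ _
  rw [MeasurableEquiv.image_eq_preimage_symm]
  rfl

theorem mem_mapX_supp {F : Graphing Ω} {T : X ≃ᵐ X} {x : X} :
    x ∈ (F.mapX T).supp ↔ T.symm x ∈ F.supp := by
  show x ∈ T '' F.supp ↔ _
  rw [MeasurableEquiv.image_eq_preimage_symm]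
  rfl

theorem mem_exec_source' [Monoid Ω] {ρ : I × I ≃ᵐ I} {F G : Graphing Ω} {π : (exec ρ F G).E}
    {z : XD} : z ∈ (exec ρ F G).source π ↔ (fuse ρ).symm z ∈ outerSource F G π.1 := by
  rw [← mem_exec_source (ρ := ρ), MeasurableEquiv.apply_symm_apply]

theorem IsAltPath.map_iff {F G F' G' : Graphing Ω} {j : F.E ⊕ G.E → F'.E ⊕ G'.E}
    (hj : ∀ a b, (j a).isLeft ≠ (j b).isLeft ↔ a.isLeft ≠ b.isLeft) {w : List (F.E ⊕ G.E)}
    (h : muY (pathSource F G w) = muY (pathSource F' G' (w.map j))) :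
    IsAltPath F G w ↔ IsAltPath F' G' (w.map j) := by
  unfold IsAltPath
  rw [h, List.isChain_map]
  simp only [hj]
  simp

section Promotion

variable (ρ : I × I ≃ᵐ I)

/-- `(a, (p, ρ (q, z)) • s, e) ↦ (a, s, (p, q))` -/
def unpack (y : Y) : Y := ((BB.symm y.1).1, ((BB.symm y.1).2.1, (ρ.symm (BB.symm y.1).2.2).1))

/-- `(a, (p, ρ (q, z)) • s, e) ↦ (z, e)` -/
def unpackRest (y : Y) : I × (I × I) := ((ρ.symm (BB.symm y.1).2.2).2, y.2)

theorem unpack_injective {y y' : Y} (h : unpack ρ y = unpack ρ y')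
    (h' : unpackRest ρ y = unpackRest ρ y') : y = y' := by
  simp only [unpack, unpackRest, Prod.mk.injEq] at h h'
  refine Prod.ext (BB.symm.injective (Prod.ext h.1 (Prod.ext h.2.1 (ρ.symm.injective ?_)))) h'.2
  exact Prod.ext h.2.2 h'.1

theorem measurePreserving_unpack (hρ : MeasurePreserving ρ volume volume) :
    MeasurePreserving (unpack ρ) muY muY := by
  have h1 : MeasurePreserving (fun y : Y => BB.symm y.1) muY muY :=
    (measurePreserving_BB.symm BB).comp measurePreserving_fst
  have h2 : MeasurePreserving (fun p : I × I => (p.1, (ρ.symm p.2).1))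
      (volume.prod volume) (volume.prod volume) :=
    (MeasurePreserving.id volume).prod (measurePreserving_fst.comp (hρ.symm ρ))
  exact ((MeasurePreserving.id muX).prod h2).comp h1

theorem BB_symm_twist (x : X) : BB.symm (twist ρ x) = ((BB.symm x).1,
    ((ρ.symm (BB.symm x).2.2).1, ρ ((BB.symm x).2.1, (ρ.symm (BB.symm x).2.2).2))) := rfl

theorem BB_symm_twist_symm (x : X) : BB.symm ((twist ρ).symm x) = ((BB.symm x).1,
    ((ρ.symm (BB.symm x).2.2).1, ρ ((BB.symm x).2.1, (ρ.symm (BB.symm x).2.2).2))) := rfl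

theorem BB_symm_merge_symm (x : X) : BB.symm ((merge ρ).symm x) = ((BB.symm x).1,
    ((ρ.symm (BB.symm x).2.1).1, ρ ((ρ.symm (BB.symm x).2.1).2, (BB.symm x).2.2))) := rfl

variable (G F : Graphing Ω)

theorem unpack_stepSource (l : G.E ⊕ F.E) (y : Y) :
    y ∈ stepSource G.bang (F.bang.mapX (twist ρ)) l ↔ unpack ρ y ∈ stepSource G F l := by
  rcases l with g | f
  · exact Iff.rfl
  · exact mem_mapX_source

/-- The twist is there to separate the dialects: `!G` stores its dialect in `p`, and `twist(!F)`
stores its own in `q`. Seen through `unpack`, they act as `G` and `F` with independent dialects, and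
`unpackRest` is never touched. -/
theorem unpack_step (l : G.E ⊕ F.E) (y : Y) :
    unpack ρ (step G.bang (F.bang.mapX (twist ρ)) l y) = step G F l (unpack ρ y) ∧
      unpackRest ρ (step G.bang (F.bang.mapX (twist ρ)) l y) = unpackRest ρ y := by
  rcases l with g | f
  · suffices h : ∀ y', y' = (BB ((G.real g ((BB.symm y.1).1, (BB.symm y.1).2.1)).1,
        ((G.real g ((BB.symm y.1).1, (BB.symm y.1).2.1)).2, (BB.symm y.1).2.2)), y.2) →
        unpack ρ y' = step G F (.inl g) (unpack ρ y) ∧ unpackRest ρ y' = unpackRest ρ y from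
      h _ rfl
    rintro y' rfl
    simp only [unpack, unpackRest, MeasurableEquiv.symm_apply_apply]
    exact ⟨rfl, trivial⟩
  · let x := (twist ρ).symm y.1
    suffices h : ∀ y', y' = (twist ρ (BB ((F.real f ((BB.symm x).1, (BB.symm x).2.1)).1,
        ((F.real f ((BB.symm x).1, (BB.symm x).2.1)).2, (BB.symm x).2.2))), y.2) →
        unpack ρ y' = step G F (.inr f) (unpack ρ y) ∧ unpackRest ρ y' = unpackRest ρ y from
      h _ rfl
    rintro y' rfl
    simp only [unpack, unpackRest, BB_symm_twist, MeasurableEquiv.symm_apply_apply, x,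
      BB_symm_twist_symm]
    exact ⟨rfl, trivial⟩

theorem unpack_pathSource (w : List (G.E ⊕ F.E)) (y : Y) :
    y ∈ pathSource G.bang (F.bang.mapX (twist ρ)) w ↔ unpack ρ y ∈ pathSource G F w := by
  induction w generalizing y with
  | nil => exact Iff.rfl
  | cons l w ih =>
    refine and_congr (unpack_stepSource ρ G F l y) ((ih _).trans ?_)
    rw [(unpack_step ρ G F l y).1]
    rfl

theorem unpack_pathReal (w : List (G.E ⊕ F.E)) (y : Y) :
    unpack ρ (pathReal G.bang (F.bang.mapX (twist ρ)) w y) = pathReal G F w (unpack ρ y) ∧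
      unpackRest ρ (pathReal G.bang (F.bang.mapX (twist ρ)) w y) = unpackRest ρ y := by
  induction w generalizing y with
  | nil => exact ⟨rfl, rfl⟩
  | cons l w ih =>
    obtain ⟨h1, h2⟩ := ih (step G.bang (F.bang.mapX (twist ρ)) l y)
    obtain ⟨h3, h4⟩ := unpack_step ρ G F l y
    refine ⟨h1.trans ?_, h2.trans h4⟩
    rw [h3]
    rfl

theorem unpack_supp (y : Y) : y.1 ∈ G.bang.supp ∩ (F.bang.mapX (twist ρ)).supp ↔
    (unpack ρ y).1 ∈ G.supp ∩ F.supp :=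
  and_congr Iff.rfl mem_mapX_supp

theorem unpack_outerSource (w : List (G.E ⊕ F.E)) (y : Y) :
    y ∈ outerSource G.bang (F.bang.mapX (twist ρ)) w ↔ unpack ρ y ∈ outerSource G F w := by
  refine and_congr (unpack_pathSource ρ G F w y) (and_congr (unpack_supp ρ G F y).not ?_)
  rw [← (unpack_pathReal ρ G F w y).1]
  exact (unpack_supp ρ G F _).not

/-- This makes the same words alternating paths on both sides, as paths must have non-null domain.
-/
theorem muY_pathSource_bang (hρ : MeasurePreserving ρ volume volume) (w : List (G.E ⊕ F.E)) :
    muY (pathSource G.bang (F.bang.mapX (twist ρ)) w) = muY (pathSource G F w) := by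
  rw [← (measurePreserving_unpack ρ hρ).measure_preimage
    (measurableSet_pathSource G F w).nullMeasurableSet]
  exact congrArg muY (Set.ext (unpack_pathSource ρ G F w))

theorem unpack_fuse_symm_merge_symm (z : XD) :
    unpack ρ ((fuse ρ).symm ((merge ρ).symm z.1, z.2)) =
      (fuse ρ).symm ((BB.symm z.1).1, (BB.symm z.1).2.1) ∧
    unpackRest ρ ((fuse ρ).symm ((merge ρ).symm z.1, z.2)) = ((BB.symm z.1).2.2, ρ.symm z.2) := by
  have h : (fuse ρ).symm ((merge ρ).symm z.1, z.2) = ((merge ρ).symm z.1, ρ.symm z.2) := rfl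
  rw [h]
  simp only [unpack, unpackRest, BB_symm_merge_symm, MeasurableEquiv.symm_apply_apply]
  exact ⟨rfl, trivial⟩

/-- `merge (!G ⋈ twist (!F)) = !(G ⋈ F)`. -/
theorem merge_exec_twist_eEq [Monoid Ω] (hρ : MeasurePreserving ρ volume volume) :
    EEq ((G.bang.exec ρ (F.bang.mapX (twist ρ))).mapX (merge ρ)) (G.exec ρ F).bang := by
  refine ⟨?_, (Equiv.refl (List (G.E ⊕ F.E))).subtypeEquiv fun w => ?_, fun w => ⟨?_, ?_, ?_⟩⟩
  · ext x
    have h1 : (merge ρ).symm x ∈ G.bang.supp ↔ (BB.symm x).1 ∈ G.supp := Iff.rfl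
    have h2 : (merge ρ).symm x ∈ (F.bang.mapX (twist ρ)).supp ↔ (BB.symm x).1 ∈ F.supp :=
      mem_mapX_supp
    refine mem_mapX_supp.trans ?_
    show (merge ρ).symm x ∈ symmDiff _ _ ↔ (BB.symm x).1 ∈ symmDiff G.supp F.supp
    rw [Set.mem_symmDiff, Set.mem_symmDiff, h1, h2]
  · exact and_congr Iff.rfl (and_congr Iff.rfl (by rw [muY_pathSource_bang ρ G F hρ]; rfl))
  · show pathWeight G.bang (F.bang.mapX (twist ρ)) w.1 = pathWeight G F w.1
    generalize w.1 = v
    induction v with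
    | nil => rfl
    | cons l v ih =>
      rw [pathWeight, ih]
      rfl
  · ext z
    refine mem_mapX_source.trans (mem_exec_source'.trans
      ((unpack_outerSource ρ G F w.1 _).trans ?_))
    rw [(unpack_fuse_symm_merge_symm ρ z).1]
    exact (mem_exec_source' (F := G) (G := F) (π := ⟨w.1, _⟩)).symm
  · intro z _
    let y := (fuse ρ).symm ((merge ρ).symm z.1, z.2)
    let y' := pathReal G.bang (F.bang.mapX (twist ρ)) w.1 y
    let ζ : XD := ((BB.symm z.1).1, (BB.symm z.1).2.1)
    let p := fuse ρ (pathReal G F w.1 ((fuse ρ).symm ζ))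
    show (merge ρ (fuse ρ y').1, (fuse ρ y').2) = (BB (p.1, (p.2, (BB.symm z.1).2.2)), z.2)
    -- Points are compared after undoing `merge` and `fuse`; there `unpack` and `unpackRest`
    -- together determine them.
    have e1 : ∀ {z₁ z₂ : XD}, (fuse ρ).symm ((merge ρ).symm z₁.1, z₁.2) =
        (fuse ρ).symm ((merge ρ).symm z₂.1, z₂.2) → z₁ = z₂ := by
      intro z₁ z₂ h
      have h' := (fuse ρ).symm.injective h
      simp only [Prod.mk.injEq, EmbeddingLike.apply_eq_iff_eq] at h'
      exact Prod.ext h'.1 h'.2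
    apply e1
    obtain ⟨h1, h2⟩ := unpack_pathReal ρ G F w.1 y
    obtain ⟨h3, h4⟩ := unpack_fuse_symm_merge_symm ρ z
    obtain ⟨h5, h6⟩ := unpack_fuse_symm_merge_symm ρ (BB (p.1, (p.2, (BB.symm z.1).2.2)), z.2)
    have e2 : (fuse ρ).symm ((merge ρ).symm (merge ρ (fuse ρ y').1), (fuse ρ y').2) = y' := by
      rw [MeasurableEquiv.symm_apply_apply]
      exact (fuse ρ).symm_apply_apply y'
    show (fuse ρ).symm ((merge ρ).symm (merge ρ (fuse ρ y').1), (fuse ρ y').2) = _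
    rw [e2]
    refine unpack_injective ρ ?_ ?_
    · rw [h5]
      simp only [MeasurableEquiv.symm_apply_apply]
      refine h1.trans ?_
      rw [h3]
      exact ((fuse ρ).symm_apply_apply _).symm
    · rw [h6]
      simp only [MeasurableEquiv.symm_apply_apply]
      exact h2.trans h4

theorem step_swap (l : G.E ⊕ F.E) (y : Y) :
    step F G l.swap (swapD y) = swapD (step G F l y) := by
  rcases l with g | f <;> rfl

theorem pathReal_swap (w : List (G.E ⊕ F.E)) (y : Y) :
    pathReal F G (w.map Sum.swap) (swapD y) = swapD (pathReal G F w y) := by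
  induction w generalizing y with
  | nil => rfl
  | cons l w ih =>
    show pathReal F G (w.map Sum.swap) (step F G l.swap (swapD y)) = _
    rw [step_swap, ih]
    rfl

theorem pathSource_swap (w : List (G.E ⊕ F.E)) (y : Y) :
    swapD y ∈ pathSource F G (w.map Sum.swap) ↔ y ∈ pathSource G F w := by
  induction w generalizing y with
  | nil => exact Iff.rfl
  | cons l w ih =>
    refine and_congr ?_ ?_
    · rcases l with g | f <;> exact Iff.rfl
    · show step F G l.swap (swapD y) ∈ pathSource F G (w.map Sum.swap) ↔ _
      rw [step_swap, ih]
      rfl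

theorem outerSource_swap (w : List (G.E ⊕ F.E)) (y : Y) :
    swapD y ∈ outerSource F G (w.map Sum.swap) ↔ y ∈ outerSource G F w := by
  refine and_congr (pathSource_swap G F w y) (and_congr ?_ ?_)
  · rw [Set.inter_comm]
    rfl
  · rw [pathReal_swap, Set.inter_comm]
    rfl

/-- `G ⋈ F` is a variant of `F ⋈ G`. -/
theorem exec_isVariant [Monoid Ω] (hρ : MeasurePreserving ρ volume volume) :
    (G.exec ρ F).IsVariant (F.exec ρ G) := by
  -- The exchange of the two halves into which `ρ` splits the dialect.
  let φ : I ≃ᵐ I := ρ.symm.trans (MeasurableEquiv.prodComm.trans ρ)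
  have hφ : ∀ y : Y, fuse ρ (swapD y) = ((MeasurableEquiv.refl X).prodCongr φ) (fuse ρ y) := by
    intro y
    show (y.1, ρ (y.2.2, y.2.1)) = (y.1, ρ (ρ.symm (ρ y.2)).swap)
    rw [MeasurableEquiv.symm_apply_apply]
    rfl
  refine ⟨φ, hρ.comp (Measure.measurePreserving_swap.comp (hρ.symm ρ)), EEq.aeEq ⟨?_,
    (Equiv.listEquivOfEquiv (Equiv.sumComm G.E F.E)).subtypeEquiv fun w => ?_,
    fun w => ⟨?_, ?_, ?_⟩⟩⟩
  · exact symmDiff_comm _ _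
  · refine IsAltPath.map_iff (j := Sum.swap) (fun a b => ?_) ?_
    · rcases a with a | a <;> rcases b with b | b <;> simp
    · rw [← measurePreserving_swapD.measure_preimage
        (measurableSet_pathSource F G _).nullMeasurableSet]
      exact congrArg muY (Set.ext fun y => (pathSource_swap G F w y).symm)
  · show pathWeight G F w.1 = pathWeight F G (w.1.map Sum.swap)
    generalize w.1 = v
    induction v with
    | nil => rfl
    | cons l v ih =>
      rw [List.map_cons, pathWeight, ih, pathWeight]
      rcases l with g | f <;> rfl
  · show fuse ρ '' outerSource G F w.1 = ((MeasurableEquiv.refl X).prodCongr φ) ''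
      (fuse ρ '' outerSource F G (w.1.map Sum.swap))
    have : outerSource F G (w.1.map Sum.swap) = swapD '' outerSource G F w.1 := by
      ext y
      obtain ⟨y, rfl⟩ := swapD.surjective y
      rw [outerSource_swap, swapD.injective.mem_set_image]
    rw [this, Set.image_image, Set.image_image]
    refine Set.image_congr fun y _ => ?_
    rw [hφ]
    show _ = (y.1, φ (φ (ρ y.2)))
    show _ = (y.1, ρ (ρ.symm (ρ (ρ.symm (ρ y.2)).swap)).swap)
    simp only [MeasurableEquiv.symm_apply_apply, Prod.swap_swap]
    rfl
  · intro z _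
    obtain ⟨y, rfl⟩ := (fuse ρ).surjective z
    show fuse ρ (pathReal G F w.1 ((fuse ρ).symm (fuse ρ y))) =
      ((MeasurableEquiv.refl X).prodCongr φ) (fuse ρ (pathReal F G (w.1.map Sum.swap)
        ((fuse ρ).symm (((MeasurableEquiv.refl X).prodCongr φ).symm (fuse ρ y)))))
    have h : ((MeasurableEquiv.refl X).prodCongr φ).symm (fuse ρ y) = fuse ρ (swapD y) := by
      rw [MeasurableEquiv.symm_apply_eq, ← hφ]
      rfl
    rw [h, MeasurableEquiv.symm_apply_apply, MeasurableEquiv.symm_apply_apply, pathReal_swap,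
      ← hφ]
    rfl

end Promotion

end Graphing

/-! ## Words of partial maps of the space -/

section PartialMaps

variable {L : Type*} (μ : L → X → X) (s : L → Set X)

/-- The composite of a word of maps, the first one being applied first. -/
def pmap : List L → X → X
  | [], x => x
  | l :: w, x => pmap w (μ l x)

/-- The domain of the composite of a word of partial maps. -/
def psrc : List L → Set X
  | [] => Set.univ
  | l :: w => {x | x ∈ s l ∧ μ l x ∈ psrc w}

theorem mem_psrc_cons {l : L} {w : List L} {x : X} :
    x ∈ psrc μ s (l :: w) ↔ x ∈ s l ∧ μ l x ∈ psrc μ s w := Iff.rfl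

theorem pmap_cons (l : L) (w : List L) (x : X) : pmap μ (l :: w) x = pmap μ w (μ l x) := rfl

/-- The part of the domain of a word that lies, together with its image, outside a set. -/
def outer (C : Set X) (w : List L) : Set X := {x | x ∈ psrc μ s w ∧ x ∉ C ∧ pmap μ w x ∉ C}

end PartialMaps

/-- Alternation between two sets of letters. -/
def Alt {A B : Type*} (w : List (A ⊕ B)) : Prop := w.IsChain fun e e' => e.isLeft ≠ e'.isLeft

/-- The maps of the space from which the interaction of the promotion graphing with
perennisations is made: `bg` and `bf` act on the regions `RA` and `RA ∪ RB`, `T` preserves the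
regions, `θ` sends `RA` and `Ψ` sends `RB` to new regions. -/
structure Loc (γ φ : Type*) where
  (T θ Ψ : X ≃ᵐ X)
  (RA RB : Set X)
  bg : γ → X → X
  sg : γ → Set X
  bf : φ → X → X
  sf : φ → Set X
  T_RA : ∀ x, T x ∈ RA ↔ x ∈ RA
  T_RB : ∀ x, T x ∈ RB ↔ x ∈ RB
  sg_sub : ∀ g x, x ∈ sg g → x ∈ RA ∧ bg g x ∈ RA
  sf_sub : ∀ f x, x ∈ sf f → (x ∈ RA ∨ x ∈ RB) ∧ (bf f x ∈ RA ∨ bf f x ∈ RB)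
  not_A_B : ∀ x, x ∈ RA → x ∉ RB
  not_A_A' : ∀ x, x ∈ RA → θ.symm x ∉ RA
  not_B_A' : ∀ x, x ∈ RB → θ.symm x ∉ RA
  not_A_B' : ∀ x, x ∈ RA → Ψ.symm x ∉ RB
  not_B_B' : ∀ x, x ∈ RB → Ψ.symm x ∉ RB
  not_A'_B' : ∀ x, θ.symm x ∈ RA → Ψ.symm x ∉ RB

namespace Loc

variable {γ φ κ : Type*} (l : Loc γ φ) (t : κ → γ ⊕ φ)

/-- The four maps of the promotion graphing. -/
def pm : Bool × Bool → X → X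
  | (false, false) => fun x => l.θ (l.T x)
  | (false, true) => fun x => l.T.symm (l.θ.symm x)
  | (true, false) => fun x => l.Ψ (l.T x)
  | (true, true) => fun x => l.T.symm (l.Ψ.symm x)

def ps : Bool × Bool → Set X
  | (false, false) => l.RA
  | (false, true) => {x | l.θ.symm x ∈ l.RA}
  | (true, false) => l.RB
  | (true, true) => {x | l.Ψ.symm x ∈ l.RB}

/-- The maps of the tensor product. -/
def cm : γ ⊕ φ → X → X := Sum.elim (fun g x => l.θ (l.bg g (l.θ.symm x))) l.bf

def cs : γ ⊕ φ → Set X := Sum.elim (fun g => {x | l.θ.symm x ∈ l.sg g}) l.sf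

/-- The maps of the promotion graphing and of the tensor product. -/
def lm : (Bool × Bool) ⊕ κ → X → X := Sum.elim l.pm fun c => l.cm (t c)

def ls : (Bool × Bool) ⊕ κ → Set X := Sum.elim l.ps fun c => l.cs (t c)

/-- The maps of `G` and of `F` transported along `T`. -/
def um : γ ⊕ φ → X → X := Sum.elim l.bg fun f x => l.T (l.bf f (l.T.symm x))

def us : γ ⊕ φ → Set X := Sum.elim l.sg fun f => {x | l.T.symm x ∈ l.sf f}

/-- The region in which the promotion graphing meets the tensor product. -/
def cut : Set X := {x | (x ∈ l.RA ∨ x ∈ l.RB) ∨ l.θ.symm x ∈ l.RA}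

theorem cm_sub (a : γ ⊕ φ) (x : X) (hx : x ∈ l.cs a) : x ∈ l.cut ∧ l.cm a x ∈ l.cut := by
  rcases a with g | f
  · obtain ⟨h1, h2⟩ := l.sg_sub g _ hx
    refine ⟨.inr h1, .inr ?_⟩
    show l.θ.symm (l.θ _) ∈ l.RA
    rwa [MeasurableEquiv.symm_apply_apply]
  · exact ⟨.inl (l.sf_sub f x hx).1, .inl (l.sf_sub f x hx).2⟩

/-- The words of the promotion graphing and the tensor product which correspond to a word
`f₀ g₁ f₁ ⋯ gₙ fₙ`, without their first letter. -/
inductive Exp : List (γ ⊕ φ) → List ((Bool × Bool) ⊕ κ) → Prop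
  | last (f : φ) (c : κ) (hc : t c = .inr f) : Exp [.inr f] [.inr c, .inl (true, false)]
  | step (f : φ) (g : γ) (c c' : κ) (hc : t c = .inr f) (hc' : t c' = .inl g)
      (v : List (γ ⊕ φ)) (w : List ((Bool × Bool) ⊕ κ)) (h : Exp v w) :
      Exp (.inr f :: .inl g :: v)
        (.inr c :: .inl (false, false) :: .inr c' :: .inl (false, true) :: w)

variable {t}

theorem Exp.right_unique (ht : Function.Injective t) {v : List (γ ⊕ φ)}
    {w w' : List ((Bool × Bool) ⊕ κ)} (h : Exp t v w) (h' : Exp t v w') : w = w' := by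
  induction h generalizing w' with
  | last f c hc =>
    cases h' with
    | last _ c' hc' => rw [ht (hc.trans hc'.symm)]
  | step f g c c' hc hc' v w h ih =>
    cases h' with
    | step _ _ d d' hd hd' _ w' h' =>
      rw [ih h', ht (hc.trans hd.symm), ht (hc'.trans hd'.symm)]

theorem Exp.left_unique {v v' : List (γ ⊕ φ)} {w : List ((Bool × Bool) ⊕ κ)} (h : Exp t v w)
    (h' : Exp t v' w) : v = v' := by
  induction h generalizing v' with
  | last f c hc =>
    cases h' with
    | last f' _ hc' =>
      rw [hc] at hc'
      rw [Sum.inr.inj hc']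
  | step f g c c' hc hc' v w h ih =>
    cases h' with
    | step f' g' _ _ hd hd' v' _ h' =>
      rw [hc] at hd
      rw [hc'] at hd'
      rw [ih h', Sum.inr.inj hd, Sum.inl.inj hd']

theorem Exp.alt {v : List (γ ⊕ φ)} {w : List ((Bool × Bool) ⊕ κ)} (h : Exp t v w) :
    (∃ f v', v = .inr f :: v') ∧ (∃ c w', w = .inr c :: w') ∧ Alt v ∧ Alt w := by
  induction h with
  | last f c hc => exact ⟨⟨f, _, rfl⟩, ⟨c, _, rfl⟩, by simp [Alt], by simp [Alt]⟩
  | step f g c c' hc hc' v w h ih =>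
    obtain ⟨⟨f', v', rfl⟩, ⟨d, w', rfl⟩, h3, h4⟩ := ih
    refine ⟨⟨f, _, rfl⟩, ⟨c, _, rfl⟩, ?_, ?_⟩
    · simp only [Alt, List.isChain_cons_cons]
      exact ⟨by simp, by simp, h3⟩
    · simp only [Alt, List.isChain_cons_cons]
      exact ⟨by simp, by simp, by simp, by simp, h4⟩

variable (t)

/-- The word `w` follows `v` in the coordinates changed by `T`: each visit to a map `bg` is made
through `θ ∘ T` and undone on return. The last edge of the promotion graphing asks for a point of
`RB`. As the maps `bf` stay in `RA ∪ RB` and `T` preserves both regions, this is the condition that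
`v` ends outside `RA`. -/
theorem Exp.data {v : List (γ ⊕ φ)} {w : List ((Bool × Bool) ⊕ κ)} (h : Exp t v w) (x : X) :
    (x ∈ psrc (l.lm t) (l.ls t) w ↔
      l.T x ∈ psrc l.um l.us v ∧ pmap l.um v (l.T x) ∉ l.RA) ∧
    (x ∈ psrc (l.lm t) (l.ls t) w →
      pmap (l.lm t) w x = l.Ψ (pmap l.um v (l.T x)) ∧ pmap l.um v (l.T x) ∈ l.RB) := by
  induction h generalizing x with
  | last f c hc =>
    have e1 : l.cm (t c) x = l.bf f x := by rw [hc]; rfl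
    have e2 : x ∈ l.cs (t c) ↔ x ∈ l.sf f := by rw [hc]; rfl
    have hL : x ∈ psrc (l.lm t) (l.ls t) [.inr c, .inl (true, false)] ↔
        x ∈ l.sf f ∧ l.bf f x ∈ l.RB := by
      show x ∈ l.cs (t c) ∧ l.cm (t c) x ∈ l.RB ∧ True ↔ _
      rw [e1, e2, and_true]
    have hR : l.T x ∈ psrc l.um l.us [.inr f] ↔ x ∈ l.sf f := by
      show l.T.symm (l.T x) ∈ l.sf f ∧ True ↔ _
      rw [MeasurableEquiv.symm_apply_apply, and_true]
    have hR' : pmap l.um [.inr f] (l.T x) = l.T (l.bf f x) := by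
      show l.T (l.bf f (l.T.symm (l.T x))) = _
      rw [MeasurableEquiv.symm_apply_apply]
    rw [hL, hR, hR', l.T_RA, l.T_RB]
    refine ⟨⟨fun h => ⟨h.1, fun h' => l.not_A_B _ h' h.2⟩, fun h => ⟨h.1, ?_⟩⟩, fun h => ⟨?_, h.2⟩⟩
    · exact (l.sf_sub f x h.1).2.resolve_left h.2
    · show l.Ψ (l.T (l.cm (t c) x)) = _
      rw [e1]
  | step f g c c' hc hc' v w h ih =>
    have e1 : l.cm (t c) x = l.bf f x := by rw [hc]; rfl
    have e2 : x ∈ l.cs (t c) ↔ x ∈ l.sf f := by rw [hc]; rfl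
    have e3 : l.cm (t c') (l.θ (l.T (l.bf f x))) = l.θ (l.bg g (l.T (l.bf f x))) := by
      rw [hc']
      show l.θ (l.bg g (l.θ.symm (l.θ _))) = _
      rw [MeasurableEquiv.symm_apply_apply]
    have e4 : l.θ (l.T (l.bf f x)) ∈ l.cs (t c') ↔ l.T (l.bf f x) ∈ l.sg g := by
      rw [hc']
      show l.θ.symm (l.θ _) ∈ l.sg g ↔ _
      rw [MeasurableEquiv.symm_apply_apply]
    obtain ⟨ih1, ih2⟩ := ih (l.T.symm (l.bg g (l.T (l.bf f x))))
    rw [MeasurableEquiv.apply_symm_apply] at ih1 ih2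
    have hL : x ∈ psrc (l.lm t) (l.ls t)
        (.inr c :: .inl (false, false) :: .inr c' :: .inl (false, true) :: w) ↔
        x ∈ l.sf f ∧ l.bf f x ∈ l.RA ∧ l.T (l.bf f x) ∈ l.sg g ∧
          l.bg g (l.T (l.bf f x)) ∈ l.RA ∧
          l.T.symm (l.bg g (l.T (l.bf f x))) ∈ psrc (l.lm t) (l.ls t) w := by
      show x ∈ l.cs (t c) ∧ l.cm (t c) x ∈ l.RA ∧ l.θ (l.T (l.cm (t c) x)) ∈ l.cs (t c') ∧
        l.θ.symm (l.cm (t c') (l.θ (l.T (l.cm (t c) x)))) ∈ l.RA ∧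
          l.T.symm (l.θ.symm (l.cm (t c') (l.θ (l.T (l.cm (t c) x))))) ∈ _ ↔ _
      rw [e1, e2, e3, e4, MeasurableEquiv.symm_apply_apply]
    have hL' : pmap (l.lm t)
        (.inr c :: .inl (false, false) :: .inr c' :: .inl (false, true) :: w) x =
        pmap (l.lm t) w (l.T.symm (l.bg g (l.T (l.bf f x)))) := by
      show pmap (l.lm t) w (l.T.symm (l.θ.symm (l.cm (t c') (l.θ (l.T (l.cm (t c) x)))))) = _
      rw [e1, e3, MeasurableEquiv.symm_apply_apply]
    have hR : l.T x ∈ psrc l.um l.us (.inr f :: .inl g :: v) ↔ x ∈ l.sf f ∧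
        l.T (l.bf f x) ∈ l.sg g ∧ l.bg g (l.T (l.bf f x)) ∈ psrc l.um l.us v := by
      show l.T.symm (l.T x) ∈ l.sf f ∧ l.T (l.bf f (l.T.symm (l.T x))) ∈ l.sg g ∧
        l.bg g (l.T (l.bf f (l.T.symm (l.T x)))) ∈ _ ↔ _
      rw [MeasurableEquiv.symm_apply_apply]
    have hR' : pmap l.um (.inr f :: .inl g :: v) (l.T x) =
        pmap l.um v (l.bg g (l.T (l.bf f x))) := by
      show pmap l.um v (l.bg g (l.T (l.bf f (l.T.symm (l.T x))))) = _
      rw [MeasurableEquiv.symm_apply_apply]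
    rw [hL, hL', hR, hR']
    refine ⟨⟨fun h => ?_, fun h => ?_⟩, fun h => ih2 h.2.2.2.2⟩
    · have := ih1.1 h.2.2.2.2
      exact ⟨⟨h.1, h.2.2.1, this.1⟩, this.2⟩
    · obtain ⟨⟨h1, h2, h3⟩, h4⟩ := h
      obtain ⟨h5, h6⟩ := l.sg_sub g _ h2
      exact ⟨h1, (l.T_RA _).1 h5, h2, h6, ih1.2 ⟨h3, h4⟩⟩

/-- The first letter enters along the inverse of `Ψ ∘ T`. Entry and exit lie in the image of `RB`
under `Ψ`, which is disjoint from the meeting region; a start outside `RA` is a start in `RB`,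
because the first map of `v` comes from some `bf`. -/
theorem Exp.mem_outer {v : List (γ ⊕ φ)} {w : List ((Bool × Bool) ⊕ κ)} (h : Exp t v w) (x : X) :
    x ∈ outer (l.lm t) (l.ls t) l.cut (.inl (true, true) :: w) ↔
      l.Ψ.symm x ∈ outer l.um l.us l.RA v := by
  obtain ⟨h1, h2⟩ := h.data l t (l.T.symm (l.Ψ.symm x))
  rw [MeasurableEquiv.apply_symm_apply] at h1 h2
  have hns : ∀ {y}, l.Ψ.symm y ∈ l.RB → y ∉ l.cut := by
    rintro y hy ((h | h) | h)
    · exact l.not_A_B' _ h hy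
    · exact l.not_B_B' _ h hy
    · exact l.not_A'_B' _ h hy
  constructor
  · rintro ⟨⟨hB, hs⟩, -, -⟩
    obtain ⟨h3, h4⟩ := h1.1 hs
    exact ⟨h3, fun hA => l.not_A_B _ hA hB, h4⟩
  · rintro ⟨hs, hA, he⟩
    have hB : l.Ψ.symm x ∈ l.RB := by
      obtain ⟨⟨f, v', rfl⟩, -⟩ := h.alt
      have h3 : l.T.symm (l.Ψ.symm x) ∈ l.sf f := hs.1
      have h4 := (l.sf_sub f _ h3).1
      rw [← l.T_RA, ← l.T_RB, MeasurableEquiv.apply_symm_apply] at h4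
      exact h4.resolve_left hA
    have h3 := h1.2 ⟨hs, he⟩
    refine ⟨⟨hB, h3⟩, hns hB, ?_⟩
    show pmap (l.lm t) w (l.T.symm (l.Ψ.symm x)) ∉ l.cut
    rw [(h2 h3).1]
    apply hns
    rw [MeasurableEquiv.symm_apply_apply]
    exact (h2 h3).2

theorem Exp.pmap_eq {v : List (γ ⊕ φ)} {w : List ((Bool × Bool) ⊕ κ)} (h : Exp t v w) {x : X}
    (hx : x ∈ outer (l.lm t) (l.ls t) l.cut (.inl (true, true) :: w)) :
    pmap (l.lm t) (.inl (true, true) :: w) x = l.Ψ (pmap l.um v (l.Ψ.symm x)) := by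
  have := ((h.data l t (l.T.symm (l.Ψ.symm x))).2 hx.1.2).1
  rwa [MeasurableEquiv.apply_symm_apply] at this

/-- A word followed from a point outside the meeting region back to such a point. -/
theorem exists_exp_of_mem {w : List ((Bool × Bool) ⊕ κ)} (hw : w ≠ []) (halt : Alt w)
    {x : X} (hx : x ∈ outer (l.lm t) (l.ls t) l.cut w) :
    ∃ v w', w = .inl (true, true) :: w' ∧ Exp t v w' := by
  have hC : ∀ {c x}, x ∈ l.cs (t c) → (x ∈ l.RA ∨ x ∈ l.RB) →
      ∃ f, t c = .inr f ∧ x ∈ l.sf f := by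
    intro c x hx hr
    rcases hc : t c with g | f
    · rw [hc] at hx
      have h1 := (l.sg_sub g _ hx).1
      exact absurd h1 (hr.elim (l.not_A_A' x) (l.not_B_A' x))
    · rw [hc] at hx
      exact ⟨f, rfl, hx⟩
  -- The position forces the next letter. From `RA ∪ RB` the tensor product offers only a map `bf`;
  -- the promotion graphing then leads to `θ(RA)` or to `Ψ(RB)`. In `Ψ(RB)` no edge of the tensor
  -- product starts, so the word is over. In `θ(RA)` only a map `bg` is possible, and then the
  -- return to `RA`. Stopping anywhere else would be stopping in the meeting region. A full turn
  -- uses four letters, whence the induction on the length.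
  have tail : ∀ (n : ℕ) (w : List ((Bool × Bool) ⊕ κ)) (c : κ), w.length = n →
      Alt (.inr c :: w) → ∀ x, (x ∈ l.RA ∨ x ∈ l.RB) →
      x ∈ psrc (l.lm t) (l.ls t) (.inr c :: w) →
      pmap (l.lm t) (.inr c :: w) x ∉ l.cut → ∃ v, Exp t v (.inr c :: w) := by
    intro n
    induction n using Nat.strong_induction_on with
    | _ n ih =>
      intro w c hn halt x hr hs he
      obtain ⟨f, hc, hf⟩ := hC hs.1 hr
      have hf' := (l.sf_sub f x hf).2
      have e1 : l.lm t (.inr c) x = l.bf f x := by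
        show l.cm (t c) x = _
        rw [hc]
        rfl
      rw [mem_psrc_cons, e1] at hs
      rw [pmap_cons, e1] at he
      rcases w with _ | ⟨p | c', w⟩
      · exact absurd (Or.inl hf') he
      · have hs2 := hs.2.1
        rcases p with ⟨_ | _, _ | _⟩
        · -- to the region of the argument
          have e2 : l.lm t (.inl (false, false)) (l.bf f x) = l.θ (l.T (l.bf f x)) := rfl
          rw [mem_psrc_cons, e2] at hs
          rw [pmap_cons, e2] at he
          have hA : l.θ.symm (l.θ (l.T (l.bf f x))) ∈ l.RA := by
            rw [MeasurableEquiv.symm_apply_apply, l.T_RA]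
            exact hs2
          rcases w with _ | ⟨p | c', w⟩
          · exact absurd (Or.inr hA) he
          · simp [Alt] at halt
          · have hs3 : l.θ (l.T (l.bf f x)) ∈ l.cs (t c') := hs.2.2.1
            obtain ⟨g, hc', hg⟩ : ∃ g, t c' = .inl g ∧ l.T (l.bf f x) ∈ l.sg g := by
              rcases hc' : t c' with g | f'
              · rw [hc'] at hs3
                refine ⟨g, rfl, ?_⟩
                have : l.θ.symm (l.θ (l.T (l.bf f x))) ∈ l.sg g := hs3
                rwa [MeasurableEquiv.symm_apply_apply] at this
              · rw [hc'] at hs3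
                exact absurd hA ((l.sf_sub f' _ hs3).1.elim (l.not_A_A' _) (l.not_B_A' _))
            have e3 : l.lm t (.inr c') (l.θ (l.T (l.bf f x))) =
                l.θ (l.bg g (l.T (l.bf f x))) := by
              show l.cm (t c') _ = _
              rw [hc']
              show l.θ (l.bg g (l.θ.symm (l.θ _))) = _
              rw [MeasurableEquiv.symm_apply_apply]
            rw [mem_psrc_cons, e3] at hs
            rw [pmap_cons, e3] at he
            have hA2 : l.θ.symm (l.θ (l.bg g (l.T (l.bf f x)))) ∈ l.RA := by
              rw [MeasurableEquiv.symm_apply_apply]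
              exact (l.sg_sub g _ hg).2
            rcases w with _ | ⟨p | c'', w⟩
            · exact absurd (Or.inr hA2) he
            · have hs4 := hs.2.2.2.1
              rcases p with ⟨_ | _, _ | _⟩
              · exact absurd hA2 (l.not_A_A' _ hs4)
              · have e4 : l.lm t (.inl (false, true)) (l.θ (l.bg g (l.T (l.bf f x)))) =
                    l.T.symm (l.bg g (l.T (l.bf f x))) := by
                  show l.T.symm (l.θ.symm (l.θ _)) = _
                  rw [MeasurableEquiv.symm_apply_apply]
                rw [mem_psrc_cons, e4] at hs
                rw [pmap_cons, e4] at he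
                have hA3 : l.T.symm (l.bg g (l.T (l.bf f x))) ∈ l.RA := by
                  rw [← l.T_RA, MeasurableEquiv.apply_symm_apply]
                  exact (l.sg_sub g _ hg).2
                rcases w with _ | ⟨p | d, w⟩
                · exact absurd (Or.inl (Or.inl hA3)) he
                · simp [Alt] at halt
                · simp only [Alt, List.isChain_cons_cons] at halt
                  obtain ⟨v, hv⟩ := ih w.length (by simp only [List.length_cons] at hn; omega) w d
                    rfl halt.2.2.2.2 _ (.inl hA3) hs.2.2.2.2 he
                  exact ⟨_, .step f g c c' hc hc' v _ hv⟩
              · exact absurd hA2 (l.not_B_A' _ hs4)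
              · exact absurd hs4 (l.not_A'_B' _ hA2)
            · simp [Alt] at halt
        · exact absurd hs2 (hf'.elim (l.not_A_A' _) (l.not_B_A' _))
        · -- to the region of the result
          have e2 : l.lm t (.inl (true, false)) (l.bf f x) = l.Ψ (l.T (l.bf f x)) := rfl
          rw [mem_psrc_cons, e2] at hs
          rcases w with _ | ⟨p | c', w⟩
          · exact ⟨_, .last f c hc⟩
          · simp [Alt] at halt
          · have hB : l.Ψ.symm (l.Ψ (l.T (l.bf f x))) ∈ l.RB := by
              rw [MeasurableEquiv.symm_apply_apply, l.T_RB]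
              exact hs2
            rcases (l.cm_sub _ _ hs.2.2.1).1 with (h | h) | h
            · exact absurd hB (l.not_A_B' _ h)
            · exact absurd hB (l.not_B_B' _ h)
            · exact absurd hB (l.not_A'_B' _ h)
        · exact absurd hs2 (hf'.elim (l.not_A_B' _) (l.not_B_B' _))
      · simp [Alt] at halt
  -- Outside the meeting region only the edge that comes back from `Ψ(RB)` can start.
  obtain ⟨hs, h0, he⟩ := hx
  rcases w with _ | ⟨p | c, w⟩
  · exact absurd rfl hw
  · rcases p with ⟨_ | _, _ | _⟩
    · exact absurd (Or.inl (Or.inl hs.1)) h0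
    · exact absurd (Or.inr hs.1) h0
    · exact absurd (Or.inl (Or.inr hs.1)) h0
    · have hB : l.Ψ.symm x ∈ l.RB := hs.1
      have hB' : l.T.symm (l.Ψ.symm x) ∈ l.RB := by
        rwa [← l.T_RB, MeasurableEquiv.apply_symm_apply]
      rcases w with _ | ⟨p | c, w⟩
      · exact absurd (Or.inl (Or.inr hB')) he
      · simp [Alt] at halt
      · simp only [Alt, List.isChain_cons_cons] at halt
        obtain ⟨v, hv⟩ := tail _ w c rfl halt.2 _ (.inr hB') hs.2 he
        exact ⟨v, _, rfl, hv⟩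
  · exact absurd (l.cm_sub _ _ hs.1).1 h0

/-- A word followed from a point outside `RA` back to such a point. -/
theorem exists_exp_right {v : List (γ ⊕ φ)} (hv : v ≠ []) (halt : Alt v)
    (hc : ∀ a ∈ v, ∃ c, t c = a) {x : X} (hx : x ∈ outer l.um l.us l.RA v) :
    ∃ w, Exp t v w := by
  -- A map `bg` starts and ends in `RA`. So a word between points outside `RA` begins and ends with
  -- a map from `bf`, and alternates in between.
  have tail : ∀ (n : ℕ) (v : List (γ ⊕ φ)) (f : φ), v.length = n → Alt (.inr f :: v) →
      (∀ a ∈ (.inr f :: v : List (γ ⊕ φ)), ∃ c, t c = a) → ∀ x,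
      x ∈ psrc l.um l.us (.inr f :: v) → pmap l.um (.inr f :: v) x ∉ l.RA →
      ∃ w, Exp t (.inr f :: v) w := by
    intro n
    induction n using Nat.strong_induction_on with
    | _ n ih =>
      intro v f hn halt hc x hs he
      obtain ⟨c, hcf⟩ := hc (.inr f) (by simp)
      rcases v with _ | ⟨g | f', v⟩
      · exact ⟨_, .last f c hcf⟩
      · obtain ⟨c', hcg⟩ := hc (.inl g) (by simp)
        have h2 := l.sg_sub g _ hs.2.1
        rcases v with _ | ⟨g' | f', v⟩
        · exact absurd h2.2 he
        · simp [Alt] at halt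
        · simp only [Alt, List.isChain_cons_cons] at halt
          obtain ⟨w, hw⟩ := ih v.length (by simp only [List.length_cons] at hn; omega) v f' rfl
            halt.2.2 (fun a ha => hc a (List.mem_cons_of_mem _ (List.mem_cons_of_mem _ ha))) _
            hs.2.2 he
          exact ⟨_, .step f g c c' hcf hcg _ w hw⟩
      · simp [Alt] at halt
  obtain ⟨hs, h0, he⟩ := hx
  rcases v with _ | ⟨g | f, v⟩
  · exact absurd rfl hv
  · exact absurd (l.sg_sub g _ hs.1).1 h0
  · exact tail _ v f rfl halt hc x hs he

end Loc

/-! ### Graphings which ignore their dialect -/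

theorem muXD_fst (A : Set X) : muXD {z : XD | z.1 ∈ A} = muX A := by
  have h : {z : XD | z.1 ∈ A} = A ×ˢ Set.univ := by ext z; simp
  rw [h, muXD, Measure.prod_prod, measure_univ, mul_one]

theorem muY_fst (A : Set X) : muY {y : Y | y.1 ∈ A} = muX A := by
  have h : {y : Y | y.1 ∈ A} = A ×ˢ Set.univ := by ext z; simp
  rw [h, muY, Measure.prod_prod, measure_univ, mul_one]

/-- For `m = 0` the absorption condition is void, so that nothing is asked of `Γ`. -/
theorem Microcosm.quasiMeasurePreserving {ρ : I × I ≃ᵐ I}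
    (hρ : MeasurePreserving ρ volume volume) {Γ : Subgroup ℝˣ} {f : XD → XD}
    (hf : Microcosm ρ Γ f) : Measure.QuasiMeasurePreserving f muXD muXD :=
  (hf.compat hρ (m := fun _ : Unit => 0) (by simp)).quasiMeasurePreserving

/-- The preimage of a null set under a map which acts trivially on the dialect. -/
theorem muX_preimage_null {f : XD → XD} (hf : Measure.QuasiMeasurePreserving f muXD muXD)
    {T : X → X} (hT : ∀ z, f z = (T z.1, z.2)) {A : Set X} (hA : muX A = 0) :
    muX (T ⁻¹' A) = 0 := by
  rw [← muXD_fst] at hA ⊢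
  have h := hf.preimage_null hA
  have h2 : f ⁻¹' {z : XD | z.1 ∈ A} = {z : XD | z.1 ∈ T ⁻¹' A} := by
    ext z
    show (f z).1 ∈ A ↔ _
    rw [hT]
    rfl
  rwa [h2] at h

theorem exists_equiv_of_rel {A B : Type*} (R : A → B → Prop) (h1 : ∀ a, ∃ b, R a b)
    (h2 : ∀ b, ∃ a, R a b) (u1 : ∀ a b b', R a b → R a b' → b = b')
    (u2 : ∀ a a' b, R a b → R a' b → a = a') : ∃ e : A ≃ B, ∀ a, R a (e a) := by
  choose f hf using h1
  refine ⟨Equiv.ofBijective f ⟨fun a a' h => ?_, fun b => ?_⟩, hf⟩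
  · exact u2 a a' (f a) (hf a) (h ▸ hf a')
  · obtain ⟨a, ha⟩ := h2 b
    exact ⟨a, u1 a _ _ (hf a) ha⟩

namespace Graphing

variable {Ω : Type*}

/-- A graphing which does not use its dialect. -/
structure Flat (F : Graphing Ω) where
  map : F.E → X → X
  src : F.E → Set X
  real_eq : ∀ e z, F.real e z = (map e z.1, z.2)
  mem_source : ∀ e z, z ∈ F.source e ↔ z.1 ∈ src e

namespace Flat

variable {F G : Graphing Ω}

theorem source_eq (f : Flat F) (e : F.E) : F.source e = {z | z.1 ∈ f.src e} :=
  Set.ext (f.mem_source e)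

theorem muXD_source (f : Flat F) (e : F.E) : muXD (F.source e) = muX (f.src e) := by
  rw [f.source_eq, muXD_fst]

/-- Equality up to null sets of graphings which do not use the dialect. -/
theorem aeEq (f : Flat F) (g : Flat G) (hs : F.supp = G.supp) (R : F.E → G.E → Prop)
    (h1 : ∀ e, muX (f.src e) ≠ 0 → ∃ e', R e e') (h2 : ∀ e', muX (g.src e') ≠ 0 → ∃ e, R e e')
    (u1 : ∀ a b b', R a b → R a b' → b = b') (u2 : ∀ a a' b, R a b → R a' b → a = a')
    (hR : ∀ e e', R e e' → F.weight e = G.weight e' ∧ f.src e = g.src e' ∧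
      ∀ x ∈ f.src e, f.map e x = g.map e' x) : F.AEEq G := by
  have hnull : ∀ e e', R e e' → (muXD (F.source e) ≠ 0 ↔ muXD (G.source e') ≠ 0) := by
    intro e e' h
    rw [f.muXD_source, g.muXD_source, (hR e e' h).2.1]
  obtain ⟨θ, hθ⟩ := exists_equiv_of_rel
    (fun (e : {e : F.E // muXD (F.source e) ≠ 0}) (e' : {e : G.E // muXD (G.source e) ≠ 0}) =>
      R e.1 e'.1)
    (fun e => by
      obtain ⟨e', h⟩ := h1 e.1 (by rw [← f.muXD_source]; exact e.2)
      exact ⟨⟨e', (hnull _ _ h).1 e.2⟩, h⟩)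
    (fun e' => by
      obtain ⟨e, h⟩ := h2 e'.1 (by rw [← g.muXD_source]; exact e'.2)
      exact ⟨⟨e, (hnull _ _ h).2 e'.2⟩, h⟩)
    (fun a b b' h h' => Subtype.ext (u1 _ _ _ h h'))
    (fun a a' b h h' => Subtype.ext (u2 _ _ _ h h'))
  refine ⟨hs, θ, fun e => ?_⟩
  obtain ⟨hw, hsrc, hmap⟩ := hR _ _ (hθ e)
  refine ⟨hw, ?_, ?_⟩
  · rw [f.source_eq, g.source_eq, hsrc]
    exact .rfl
  · rw [ae_restrict_iff' (F.measurable_source _)]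
    refine .of_forall fun z hz => ?_
    rw [f.real_eq, g.real_eq, hmap _ ((f.mem_source _ _).1 hz)]

def mapX (f : Flat F) (T : X ≃ᵐ X) : Flat (F.mapX T) where
  map e x := T (f.map e (T.symm x))
  src e := {x | T.symm x ∈ f.src e}
  real_eq e z := congrArg (fun p : XD => (T p.1, p.2)) (f.real_eq e (T.symm z.1, z.2))
  mem_source e _ := mem_mapX_source.trans (f.mem_source e _)

/-- The dialect of `F` has become a coordinate of the space. Hence all the graphings met by `prom`
reduce to partial maps of the space. -/
def bang (F : Graphing Ω) : Flat F.bang where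
  map e x := BB ((F.real e ((BB.symm x).1, (BB.symm x).2.1)).1,
    ((F.real e ((BB.symm x).1, (BB.symm x).2.1)).2, (BB.symm x).2.2))
  src e := {x | ((BB.symm x).1, (BB.symm x).2.1) ∈ F.source e}
  real_eq _ _ := rfl
  mem_source _ _ := Iff.rfl

variable (f : Flat F) (g : Flat G)

theorem pathReal_eq (w : List (F.E ⊕ G.E)) (y : Y) :
    pathReal F G w y = (pmap (Sum.elim f.map g.map) w y.1, y.2) := by
  induction w generalizing y with
  | nil => rfl
  | cons e w ih =>
    show pathReal F G w (step F G e y) = _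
    rw [ih, pmap_cons]
    have : step F G e y = (Sum.elim f.map g.map e y.1, y.2) := by
      rcases e with e | e
      · show ((F.real e (y.1, y.2.1)).1, ((F.real e (y.1, y.2.1)).2, y.2.2)) = _
        rw [f.real_eq]
        rfl
      · show ((G.real e (y.1, y.2.2)).1, (y.2.1, (G.real e (y.1, y.2.2)).2)) = _
        rw [g.real_eq]
        rfl
    rw [this]

theorem mem_stepSource (e : F.E ⊕ G.E) (y : Y) :
    y ∈ stepSource F G e ↔ y.1 ∈ Sum.elim f.src g.src e := by
  rcases e with e | e
  · exact f.mem_source e _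
  · exact g.mem_source e _

theorem mem_pathSource (w : List (F.E ⊕ G.E)) (y : Y) :
    y ∈ pathSource F G w ↔ y.1 ∈ psrc (Sum.elim f.map g.map) (Sum.elim f.src g.src) w := by
  induction w generalizing y with
  | nil => exact Iff.rfl
  | cons e w ih =>
    refine and_congr (mem_stepSource f g e y) ((ih _).trans ?_)
    have := pathReal_eq f g [e] y
    have h : step F G e y = (Sum.elim f.map g.map e y.1, y.2) := this
    rw [h]

theorem muY_pathSource (w : List (F.E ⊕ G.E)) : muY (pathSource F G w) =
    muX (psrc (Sum.elim f.map g.map) (Sum.elim f.src g.src) w) := by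
  rw [← muY_fst]
  exact congrArg muY (Set.ext (mem_pathSource f g w))

theorem mem_outerSource (w : List (F.E ⊕ G.E)) (y : Y) : y ∈ outerSource F G w ↔
    y.1 ∈ outer (Sum.elim f.map g.map) (Sum.elim f.src g.src) (F.supp ∩ G.supp) w := by
  refine and_congr (mem_pathSource f g w y) (and_congr Iff.rfl ?_)
  rw [pathReal_eq f g]

def exec [Monoid Ω] (ρ : I × I ≃ᵐ I) : Flat (F.exec ρ G) where
  map π := pmap (Sum.elim f.map g.map) π.1
  src π := outer (Sum.elim f.map g.map) (Sum.elim f.src g.src) (F.supp ∩ G.supp) π.1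
  real_eq π z := by
    show fuse ρ (pathReal F G π.1 ((fuse ρ).symm z)) = _
    rw [pathReal_eq f g]
    exact Prod.ext rfl (ρ.apply_symm_apply _)
  mem_source π z := by
    rw [mem_exec_source', mem_outerSource f g]
    rfl

end Flat

section Disjoint

variable {F G : Graphing Ω}

/-- Between two consecutive edges, the point would have to lie in both supports; a longer path has
empty domain. -/
theorem eq_singleton_of_disjoint (hd : Disjoint F.supp G.supp) {w : List (F.E ⊕ G.E)}
    (hw : IsAltPath F G w) : ∃ x, w = [x] := by
  obtain ⟨h0, hc, hn⟩ := hw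
  rcases w with _ | ⟨x, _ | ⟨y, w⟩⟩
  · exact absurd rfl h0
  · exact ⟨x, rfl⟩
  · exfalso
    apply hn
    rw [List.isChain_cons_cons] at hc
    convert measure_empty (μ := muY)
    refine Set.eq_empty_iff_forall_notMem.2 ?_
    rintro z ⟨h1, h2, -⟩
    rcases x with x | x <;> rcases y with y | y
    · simp at hc
    · have h3 := G.source_subset y _ h2
      exact Set.disjoint_left.1 hd (F.target_subset x _ h1) h3
    · have h3 := F.source_subset y _ h2
      exact Set.disjoint_left.1 hd h3 (G.target_subset x _ h1)
    · simp at hc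

theorem isAltPath_singleton {x : F.E ⊕ G.E} (hx : muY (stepSource F G x) ≠ 0) :
    IsAltPath F G [x] := by
  refine ⟨List.cons_ne_nil _ _, List.isChain_singleton _, ?_⟩
  rwa [pathSource, pathSource, Set.preimage_univ, Set.inter_univ]

/-- The edge of which an edge of a tensor product consists. -/
noncomputable def tensorLetter [Monoid Ω] (ρ : I × I ≃ᵐ I) (hd : Disjoint F.supp G.supp)
    (π : (F.exec ρ G).E) : F.E ⊕ G.E :=
  (eq_singleton_of_disjoint hd π.2).choose

variable [Monoid Ω] {ρ : I × I ≃ᵐ I} (hd : Disjoint F.supp G.supp)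

theorem tensorLetter_spec (π : (F.exec ρ G).E) : π.1 = [tensorLetter ρ hd π] :=
  (eq_singleton_of_disjoint hd π.2).choose_spec

theorem tensorLetter_injective : Function.Injective (tensorLetter ρ hd) := fun π π' h =>
  Subtype.ext (by rw [tensorLetter_spec hd π, tensorLetter_spec hd π', h])

theorem exists_tensorLetter {x : F.E ⊕ G.E} (hx : muY (stepSource F G x) ≠ 0) :
    ∃ π, tensorLetter ρ hd π = x := by
  refine ⟨⟨[x], isAltPath_singleton hx⟩, ?_⟩
  have := tensorLetter_spec (ρ := ρ) hd ⟨[x], isAltPath_singleton hx⟩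
  exact (List.cons.inj this).1.symm

theorem tensor_weight (π : (F.exec ρ G).E) :
    (F.exec ρ G).weight π = Sum.elim F.weight G.weight (tensorLetter ρ hd π) := by
  show pathWeight F G π.1 = _
  rw [tensorLetter_spec hd π, pathWeight, pathWeight, one_mul]

/-- Unlike `Flat.exec`, it gives each edge of a tensor product the maps of its single letter: the
cut is empty and restricts nothing. -/
noncomputable def Flat.tensor (f : Flat F) (g : Flat G) : Flat (F.exec ρ G) where
  map π := Sum.elim f.map g.map (tensorLetter ρ hd π)
  src π := Sum.elim f.src g.src (tensorLetter ρ hd π)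
  real_eq π z := by
    rw [(f.exec g ρ).real_eq]
    show (pmap _ π.1 z.1, z.2) = _
    rw [tensorLetter_spec hd π]
    rfl
  mem_source π z := by
    rw [(f.exec g ρ).mem_source]
    show z.1 ∈ outer _ _ _ π.1 ↔ _
    rw [tensorLetter_spec hd π, Set.disjoint_iff_inter_eq_empty.1 hd]
    simp [outer, psrc]

end Disjoint

end Graphing

/-! ### Delocations and perennisation -/

/-- The map acts on the space without its first two coordinates. -/
def Shallow (θ : X ≃ᵐ X) : Prop := ∀ x, BB.symm (θ x) = (θ (BB.symm x).1, (BB.symm x).2)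

theorem shallow_affineX (α : ℝˣ) (l : ℝ) : Shallow (affineX α l) := fun _ => rfl

theorem Shallow.symm {θ : X ≃ᵐ X} (h : Shallow θ) : Shallow θ.symm := by
  intro x
  obtain ⟨x, rfl⟩ := θ.surjective x
  rw [h x, MeasurableEquiv.symm_apply_apply, MeasurableEquiv.symm_apply_apply]

theorem Shallow.apply_BB {θ : X ≃ᵐ X} (h : Shallow θ) (y : Y) : θ (BB y) = BB (θ y.1, y.2) := by
  rw [← BB.symm_apply_eq, h, MeasurableEquiv.symm_apply_apply]

theorem mem_bangSupp {V : Set X} {x : X} : x ∈ bangSupp V ↔ (BB.symm x).1 ∈ V := Iff.rfl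

theorem mem_bangSupp_image {V : Set X} {θ : X ≃ᵐ X} (h : Shallow θ) {x : X} :
    x ∈ bangSupp (θ '' V) ↔ θ.symm x ∈ bangSupp V := by
  rw [mem_bangSupp, mem_bangSupp, h.symm, MeasurableEquiv.image_eq_preimage_symm]
  rfl

theorem bangSupp_injective {V W : Set X} (h : bangSupp V = bangSupp W) : V = W := by
  ext x
  have := Set.ext_iff.1 h (BB (x, (0, 0)))
  rwa [mem_bangSupp, mem_bangSupp, MeasurableEquiv.symm_apply_apply] at this

theorem disjoint_bangSupp {V W : Set X} (h : Disjoint V W) :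
    Disjoint (bangSupp V) (bangSupp W) :=
  Set.disjoint_left.2 fun _ h1 h2 => Set.disjoint_left.1 h h1 h2

theorem psrc_null {K : Type*} {μ : K → X → X} {s : K → Set X}
    (hμ : ∀ l A, muX A = 0 → muX (μ l ⁻¹' A) = 0) {a : K} {w : List K} (ha : a ∈ w)
    (h0 : muX (s a) = 0) : muX (psrc μ s w) = 0 := by
  induction w with
  | nil => simp at ha
  | cons l w ih =>
    rcases List.mem_cons.1 ha with rfl | ha
    · exact measure_mono_null (fun x hx => hx.1) h0
    · exact measure_mono_null (fun x hx => hx.2) (hμ l _ (ih ha))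

namespace Graphing

variable {Ω : Type*} {ρ : I × I ≃ᵐ I}

/-- `!` commutes with delocations. -/
def Flat.mapX_bang (G : Graphing Ω) {θ : X ≃ᵐ X} (h : Shallow θ) : Flat (G.mapX θ).bang where
  map e x := θ ((Flat.bang G).map e (θ.symm x))
  src e := {x | θ.symm x ∈ (Flat.bang G).src e}
  real_eq e z := by
    show (BB (θ (G.real e (θ.symm (BB.symm z.1).1, (BB.symm z.1).2.1)).1,
      ((G.real e (θ.symm (BB.symm z.1).1, (BB.symm z.1).2.1)).2, (BB.symm z.1).2.2)), z.2) =
      (θ (BB ((G.real e ((BB.symm (θ.symm z.1)).1, (BB.symm (θ.symm z.1)).2.1)).1,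
      ((G.real e ((BB.symm (θ.symm z.1)).1, (BB.symm (θ.symm z.1)).2.1)).2,
        (BB.symm (θ.symm z.1)).2.2))), z.2)
    rw [h.apply_BB, h.symm z.1]
  mem_source e z := by
    refine (mem_mapX_source (F := G) (T := θ) (e := e)).trans ?_
    show (θ.symm (BB.symm z.1).1, (BB.symm z.1).2.1) ∈ G.source e ↔
      ((BB.symm (θ.symm z.1)).1, (BB.symm (θ.symm z.1)).2.1) ∈ G.source e
    rw [h.symm z.1]

theorem Flat.eEq {F G : Graphing Ω} (f : Flat F) (g : Flat G) (hs : F.supp = G.supp)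
    (θ : F.E ≃ G.E) (hw : ∀ e, F.weight e = G.weight (θ e))
    (hsrc : ∀ e x, x ∈ f.src e ↔ x ∈ g.src (θ e)) (hmap : ∀ e x, f.map e x = g.map (θ e) x) :
    EEq F G := by
  refine ⟨hs, θ, fun e => ⟨hw e, ?_, fun z _ => ?_⟩⟩
  · ext z
    rw [f.mem_source, g.mem_source, hsrc]
  · rw [f.real_eq, g.real_eq, hmap]

theorem bang_mapX_eEq (D : Graphing Ω) {θ : X ≃ᵐ X} (h : Shallow θ) :
    EEq (D.bang.mapX θ) (D.mapX θ).bang := by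
  refine Flat.eEq ((Flat.bang D).mapX θ) (Flat.mapX_bang D h) ?_ (Equiv.refl _) (fun _ => rfl)
    (fun _ _ => Iff.rfl) fun _ _ => rfl
  ext x
  exact mem_mapX_supp.trans (mem_bangSupp_image h).symm

/-- For a perennisation that is only known to lie in a bi-orthogonal closure, the microcosm
condition bears on `!θ(G)`; conjugation by `θ` carries it over to `!G`. -/
theorem InMicrocosm.of_bang_mapX {Γ : Subgroup ℝˣ} {G : Graphing Ω} {θ : X ≃ᵐ X}
    (h : Shallow θ) (hG : (G.mapX θ).bang.InMicrocosm ρ Γ)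
    (hθ : Microcosm ρ Γ (θ.prodCongr (MeasurableEquiv.refl I)))
    (hθ' : Microcosm ρ Γ (θ.symm.prodCongr (MeasurableEquiv.refl I))) :
    G.bang.InMicrocosm ρ Γ := fun e => by
  refine (hθ'.comp ((hG e).comp hθ)).congr fun z => ?_
  have h1 := (Flat.mapX_bang G h).real_eq e (θ z.1, z.2)
  have h2 := (Flat.bang G).real_eq e z
  refine Eq.trans ?_ h2.symm
  show (θ.symm ((G.mapX θ).bang.real e (θ z.1, z.2)).1, ((G.mapX θ).bang.real e (θ z.1, z.2)).2) = _
  rw [h1]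
  show (θ.symm (θ ((Flat.bang G).map e (θ.symm (θ z.1)))), z.2) = _
  rw [MeasurableEquiv.symm_apply_apply, MeasurableEquiv.symm_apply_apply]

/-! ### The promotion graphing and its execution -/

section Promotion

variable {VA VB : Set X} {θA θB : X ≃ᵐ X}

/-- The positions of the supports in the functorial promotion. -/
structure Layout (VA VB : Set X) (θA θB : X ≃ᵐ X) : Prop where
  measurable_left : MeasurableSet VA
  measurable_right : MeasurableSet VB
  shallow_left : Shallow θA
  shallow_right : Shallow θB
  left_right : Disjoint VA VB
  left_left' : Disjoint VA (θA '' VA)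
  right_left' : Disjoint VB (θA '' VA)
  left_right' : Disjoint VA (θB '' VB)
  right_right' : Disjoint VB (θB '' VB)
  left'_right' : Disjoint (θA '' VA) (θB '' VB)

variable (ρ) (L : Layout VA VB θA θB) (G F : Graphing Ω) (hG : G.supp = VA)
  (hF : F.supp = VA ∪ VB)

theorem mem_merge_symm {x : X} {V : Set X} : (merge ρ).symm x ∈ bangSupp V ↔ x ∈ bangSupp V :=
  Iff.rfl

include L in
theorem Layout.disjoint_bang : Disjoint (bangSupp VA) (bangSupp VB) ∧
    Disjoint (bangSupp VA) (bangSupp (θA '' VA)) ∧ Disjoint (bangSupp VB) (bangSupp (θA '' VA)) ∧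
    Disjoint (bangSupp VA) (bangSupp (θB '' VB)) ∧ Disjoint (bangSupp VB) (bangSupp (θB '' VB)) ∧
    Disjoint (bangSupp (θA '' VA)) (bangSupp (θB '' VB)) :=
  ⟨disjoint_bangSupp L.left_right, disjoint_bangSupp L.left_left', disjoint_bangSupp L.right_left',
    disjoint_bangSupp L.left_right', disjoint_bangSupp L.right_right',
    disjoint_bangSupp L.left'_right'⟩

/-- The maps by which the promotion graphing interacts with perennisations. -/
def promLoc : Loc G.E F.E where
  T := twist ρ
  θ := θA
  Ψ := (merge ρ).trans θB
  RA := bangSupp VA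
  RB := bangSupp VB
  bg := (Flat.bang G).map
  sg := (Flat.bang G).src
  bf := (Flat.bang F).map
  sf := (Flat.bang F).src
  -- The twist changes only the first two coordinates, which the support of a perennisation does not
  -- see.
  T_RA _ := Iff.rfl
  T_RB _ := Iff.rfl
  sg_sub g x hx := by
    subst hG
    exact ⟨G.bang.source_subset g (x, 0) hx, G.bang.target_subset g (x, 0) hx⟩
  sf_sub f x hx := by
    have h1 : x ∈ bangSupp F.supp := F.bang.source_subset f (x, 0) hx
    have h2 : (Flat.bang F).map f x ∈ bangSupp F.supp := F.bang.target_subset f (x, 0) hx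
    rw [hF] at h1 h2
    exact ⟨h1, h2⟩
  not_A_B _ h := Set.disjoint_left.1 L.disjoint_bang.1 h
  not_A_A' _ h h' := Set.disjoint_left.1 L.disjoint_bang.2.1 h
    ((mem_bangSupp_image L.shallow_left).2 h')
  not_B_A' _ h h' := Set.disjoint_left.1 L.disjoint_bang.2.2.1 h
    ((mem_bangSupp_image L.shallow_left).2 h')
  not_A_B' _ h h' := Set.disjoint_left.1 L.disjoint_bang.2.2.2.1 h
    ((mem_bangSupp_image L.shallow_right).2 h')
  not_B_B' _ h h' := Set.disjoint_left.1 L.disjoint_bang.2.2.2.2.1 h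
    ((mem_bangSupp_image L.shallow_right).2 h')
  not_A'_B' _ h h' := Set.disjoint_left.1 L.disjoint_bang.2.2.2.2.2
    ((mem_bangSupp_image L.shallow_left).2 h) ((mem_bangSupp_image L.shallow_right).2 h')

variable [Monoid Ω]

/-- The promotion graphing of a layout. -/
def Layout.prom : Graphing Ω :=
  Graphing.prom ρ VA VB L.measurable_left L.measurable_right θA θB

def Flat.prom : Flat (L.prom ρ : Graphing Ω) where
  map := (promLoc ρ L G F hG hF).pm
  src := (promLoc ρ L G F hG hF).ps
  real_eq := by rintro ⟨_ | _, _ | _⟩ z <;> rfl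
  mem_source := by
    rintro ⟨_ | _, _ | _⟩ z
    · exact Iff.rfl
    · show z.1 ∈ ((twist ρ).trans θA) '' bangSupp VA ↔ _
      rw [MeasurableEquiv.image_eq_preimage_symm]
      rfl
    · exact Iff.rfl
    · show z.1 ∈ ((twist ρ).trans ((merge ρ).trans θB)) '' bangSupp VB ↔ _
      rw [MeasurableEquiv.image_eq_preimage_symm]
      rfl

theorem mem_prom_supp {x : X} : x ∈ (L.prom ρ : Graphing Ω).supp ↔
    (x ∈ bangSupp VA ∨ x ∈ bangSupp (θA '' VA)) ∨ (x ∈ bangSupp VB ∨ x ∈ bangSupp (θB '' VB)) := by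
  have h1 : x ∈ ((twist ρ).trans θA) '' bangSupp VA ↔ x ∈ bangSupp (θA '' VA) := by
    rw [mem_bangSupp_image L.shallow_left, MeasurableEquiv.image_eq_preimage_symm]
    rfl
  have h2 : x ∈ ((twist ρ).trans ((merge ρ).trans θB)) '' bangSupp VB ↔
      x ∈ bangSupp (θB '' VB) := by
    rw [mem_bangSupp_image L.shallow_right, MeasurableEquiv.image_eq_preimage_symm]
    rfl
  show ((_ ∨ _) ∨ (_ ∨ _)) ↔ _
  rw [h1, h2]

/-- The support of the conclusion of the promotion. -/
theorem symmDiff_prom_supp : symmDiff (L.prom ρ : Graphing Ω).supp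
    (bangSupp (θA '' VA) ∪ bangSupp (VA ∪ VB)) = bangSupp (θB '' VB) := by
  ext x
  have h : x ∈ bangSupp (VA ∪ VB) ↔ x ∈ bangSupp VA ∨ x ∈ bangSupp VB := Iff.rfl
  obtain ⟨-, -, -, h4, h5, h6⟩ := L.disjoint_bang
  have h4' : x ∈ bangSupp VA → x ∉ bangSupp (θB '' VB) := fun h => Set.disjoint_left.1 h4 h
  have h5' : x ∈ bangSupp VB → x ∉ bangSupp (θB '' VB) := fun h => Set.disjoint_left.1 h5 h
  have h6' : x ∈ bangSupp (θA '' VA) → x ∉ bangSupp (θB '' VB) := fun h => Set.disjoint_left.1 h6 h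
  rw [Set.mem_symmDiff, mem_prom_supp, Set.mem_union, h]
  tauto

include L in
theorem Layout.disjoint_tensor : Disjoint (bangSupp (θA '' VA)) (bangSupp (VA ∪ VB)) :=
  disjoint_bangSupp (Disjoint.symm (Set.disjoint_union_left.2 ⟨L.left_left', L.right_left'⟩))

omit [Monoid Ω] in
include L hG hF in
theorem disjoint_tensor_supp : Disjoint (G.mapX θA).bang.supp F.bang.supp := by
  subst hG
  have := L.disjoint_tensor
  rw [← hF] at this
  exact this

/-- The tensor product of the arguments of the promotion graphing. -/
def promArg (ρ : I × I ≃ᵐ I) (θA : X ≃ᵐ X) (G F : Graphing Ω) : Graphing Ω :=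
  (G.mapX θA).bang.exec ρ F.bang

noncomputable def Flat.promArg : Flat (promArg ρ θA G F) :=
  Flat.tensor (disjoint_tensor_supp L G F hG hF) (Flat.mapX_bang G L.shallow_left) (Flat.bang F)

include L hG hF in
theorem promArg_supp : (promArg ρ θA G F).supp = bangSupp (θA '' VA) ∪ bangSupp (VA ∪ VB) := by
  have h := disjoint_tensor_supp L G F hG hF
  show symmDiff (G.mapX θA).bang.supp F.bang.supp = _
  rw [h.symmDiff_eq_sup]
  subst hG
  rw [← hF]
  rfl

theorem prom_cut : (L.prom ρ : Graphing Ω).supp ∩ (promArg ρ θA G F).supp =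
    (promLoc ρ L G F hG hF).cut := by
  ext x
  rw [promArg_supp ρ L G F hG hF, Set.mem_inter_iff, mem_prom_supp, Set.mem_union]
  have h : x ∈ bangSupp (VA ∪ VB) ↔ x ∈ bangSupp VA ∨ x ∈ bangSupp VB := Iff.rfl
  show _ ↔ (x ∈ bangSupp VA ∨ x ∈ bangSupp VB) ∨ θA.symm x ∈ bangSupp VA
  rw [h, ← mem_bangSupp_image L.shallow_left]
  tauto

omit [Monoid Ω] in
include hG hF in
theorem bang_twist_cut : G.bang.supp ∩ (F.bang.mapX (twist ρ)).supp = bangSupp VA := by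
  ext x
  have h1 : x ∈ (F.bang.mapX (twist ρ)).supp ↔ x ∈ bangSupp F.supp := mem_mapX_supp
  rw [Set.mem_inter_iff, h1, hF]
  subst hG
  exact ⟨fun h => h.1, fun h => ⟨h, .inl h⟩⟩

include hG hF in
theorem exec_twist_supp (hd : Disjoint VA VB) :
    (G.bang.exec ρ (F.bang.mapX (twist ρ))).supp = bangSupp VB := by
  ext x
  have h1 : x ∈ (F.bang.mapX (twist ρ)).supp ↔ x ∈ bangSupp F.supp := mem_mapX_supp
  have h2 : x ∈ bangSupp (VA ∪ VB) ↔ x ∈ bangSupp VA ∨ x ∈ bangSupp VB := Iff.rfl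
  have h3 : x ∈ bangSupp VA → x ∉ bangSupp VB :=
    fun h => Set.disjoint_left.1 (disjoint_bangSupp hd) h
  have h4 : x ∈ G.bang.supp ↔ x ∈ bangSupp VA := by subst hG; exact Iff.rfl
  show x ∈ symmDiff _ _ ↔ _
  rw [Set.mem_symmDiff, h1, hF, h2, h4]
  tauto

include L in
-- The inserted edges of the promotion graphing have weight 1, and the letters of the two words
-- otherwise come in the same order.
theorem prom_weight {v : List (G.E ⊕ F.E)}
    {w : List ((L.prom ρ : Graphing Ω).E ⊕ (promArg ρ θA G F).E)}
    (h : Loc.Exp (tensorLetter ρ (disjoint_tensor_supp L G F hG hF)) v w) :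
    pathWeight (L.prom ρ) (promArg ρ θA G F) w =
      pathWeight G.bang (F.bang.mapX (twist ρ)) v := by
  have hC : ∀ (c : (promArg ρ θA G F).E) (a : G.E ⊕ F.E),
      tensorLetter ρ (disjoint_tensor_supp L G F hG hF) c = a →
      (promArg ρ θA G F).weight c = Sum.elim G.weight F.weight a := by
    rintro c _ rfl
    exact tensor_weight _ c
  induction h with
  | last f c hc =>
    show (1 * (1 : Ω)) * (promArg ρ θA G F).weight c = 1 * F.weight f
    rw [hC _ _ hc, one_mul]
    rfl
  | step f g c c' hc hc' v w h ih =>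
    show (((pathWeight (L.prom ρ) (promArg ρ θA G F) w * (1 : Ω)) *
      (promArg ρ θA G F).weight c') * (1 : Ω)) * (promArg ρ θA G F).weight c =
        (pathWeight G.bang (F.bang.mapX (twist ρ)) v * G.weight g) * F.weight f
    rw [hC _ _ hc, hC _ _ hc', ih, mul_one, mul_one]
    rfl

include L hG hF in
/-- What the promotion graphing computes. -/
theorem prom_exec_aeEq (hρ : MeasurePreserving ρ volume volume) {Γ : Subgroup ℝˣ}
    (hθA : Microcosm ρ Γ (θA.prodCongr (MeasurableEquiv.refl I)))
    (hθB : Microcosm ρ Γ (θB.symm.prodCongr (MeasurableEquiv.refl I)))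
    (hGm : G.bang.InMicrocosm ρ Γ) (hFm : F.bang.InMicrocosm ρ Γ) :
    AEEq ((L.prom ρ).exec ρ (promArg ρ θA G F))
      (((G.bang.exec ρ (F.bang.mapX (twist ρ))).mapX (merge ρ)).mapX θB) := by
  let l := promLoc ρ L G F hG hF
  let hd := disjoint_tensor_supp L G F hG hF
  let t : (promArg ρ θA G F).E → G.E ⊕ F.E := tensorLetter ρ hd
  have ht : Function.Injective t := tensorLetter_injective hd
  let fP := Flat.prom ρ L G F hG hF
  let fC := Flat.promArg ρ L G F hG hF
  let fU := Flat.bang G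
  let fW := (Flat.bang F).mapX (twist ρ)
  -- the words of partial maps of both sides
  have hmC : (Sum.elim fP.map fC.map) = l.lm t := by
    funext e
    rcases e with p | c
    · rfl
    · show Sum.elim _ _ (t c) = l.cm (t c)
      rcases t c with g | f <;> rfl
  have hsC : (Sum.elim fP.src fC.src) = l.ls t := by
    funext e
    rcases e with p | c
    · rfl
    · show Sum.elim _ _ (t c) = l.cs (t c)
      rcases t c with g | f <;> rfl
  have hmU : (Sum.elim fU.map fW.map) = l.um := by
    funext e
    rcases e with g | f <;> rfl
  have hsU : (Sum.elim fU.src fW.src) = l.us := by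
    funext e
    rcases e with g | f <;> rfl
  have hcC := prom_cut ρ L G F hG hF
  have hcU := bang_twist_cut ρ G F hG hF
  have hsrcL : ∀ e, (fP.exec fC ρ).src e = outer (l.lm t) (l.ls t) l.cut e.1 := by
    intro e
    show outer (Sum.elim fP.map fC.map) (Sum.elim fP.src fC.src) _ e.1 = _
    rw [hmC, hsC, hcC]
    rfl
  have hnU : ∀ v, muY (pathSource G.bang (F.bang.mapX (twist ρ)) v) = muX (psrc l.um l.us v) := by
    intro v
    rw [Flat.muY_pathSource fU fW, hmU, hsU]
    rfl
  have hnC : ∀ w, muY (pathSource (L.prom ρ) (promArg ρ θA G F) w) =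
      muX (psrc (l.lm t) (l.ls t) w) := by
    intro w
    rw [Flat.muY_pathSource fP fC, hmC, hsC]
    rfl
  let fR := ((fU.exec fW ρ).mapX (merge ρ)).mapX θB
  have hsrcR : ∀ (e : (G.bang.exec ρ (F.bang.mapX (twist ρ))).E) x,
      x ∈ fR.src e ↔ l.Ψ.symm x ∈ outer l.um l.us l.RA e.1 := by
    intro e x
    show (merge ρ).symm (θB.symm x) ∈
      outer (Sum.elim fU.map fW.map) (Sum.elim fU.src fW.src) _ e.1 ↔ _
    rw [hmU, hsU, hcU]
    rfl
  have hnon : ∀ {A : Set X}, muX A ≠ 0 → ∃ x, x ∈ A := fun h =>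
    nonempty_of_measure_ne_zero h
  have hΨ : ∀ {A : Set X}, muX A = 0 → muX (l.Ψ.symm ⁻¹' A) = 0 := fun h =>
    muX_preimage_null (Microcosm.quasiMeasurePreserving hρ (Γ := Γ)
      (Graphing.trans_symm_id Microcosm.merge_symm_id hθB)) (fun _ => rfl) h
  have hR : ∀ (e : ((L.prom ρ).exec ρ (promArg ρ θA G F)).E)
      (e' : (G.bang.exec ρ (F.bang.mapX (twist ρ))).E) w, e.1 = .inl (true, true) :: w →
      Loc.Exp t e'.1 w → (fP.exec fC ρ).src e = fR.src e' := by
    intro e e' w he h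
    ext x
    rw [hsrcL, hsrcR, he]
    exact h.mem_outer l t x
  -- Edges of the two sides are matched by the expansion `Loc.Exp`. It need only be defined on edges
  -- with non-null source.
  refine Flat.aeEq (fP.exec fC ρ) fR ?_
    (fun e (e' : (G.bang.exec ρ (F.bang.mapX (twist ρ))).E) =>
      ∃ w, e.1 = .inl (true, true) :: w ∧ Loc.Exp t e'.1 w) ?_ ?_ ?_ ?_ ?_
  · show symmDiff (L.prom ρ : Graphing Ω).supp (promArg ρ θA G F).supp = _
    rw [promArg_supp ρ L G F hG hF, symmDiff_prom_supp]
    ext x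
    rw [mem_mapX_supp, mem_mapX_supp, exec_twist_supp ρ G F hG hF L.left_right, mem_merge_symm,
      mem_bangSupp_image L.shallow_right]
  · intro e he
    obtain ⟨x, hx⟩ := hnon he
    rw [hsrcL] at hx
    obtain ⟨v, w, hw, hv⟩ := l.exists_exp_of_mem t e.2.1 e.2.2.1 hx
    obtain ⟨⟨f, v', hv'⟩, -, halt, -⟩ := hv.alt
    -- If `v` had null domain, its preimage under the inverse of `Ψ`, which contains the source of
    -- `e`, would be null.
    refine ⟨⟨v, by rw [hv']; exact List.cons_ne_nil _ _, halt, fun h0 => he ?_⟩, w, hw, hv⟩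
    refine measure_mono_null ?_ (hΨ ((hnU v).symm.trans h0))
    intro x hx
    rw [hsrcL, hw, hv.mem_outer l t x] at hx
    exact hx.1
  · intro (e' : (G.bang.exec ρ (F.bang.mapX (twist ρ))).E) he
    obtain ⟨x, hx⟩ := hnon he
    rw [hsrcR] at hx
    -- The tensor product retains only edges of non-null source. A letter with null source would
    -- make the domain of `e'` null, as all the maps involved pull null sets back to null sets.
    have hlet : ∀ a ∈ e'.1, ∃ c, t c = a := by
      intro (a : G.E ⊕ F.E) ha
      by_contra hcon
      refine e'.2.2.2 ?_
      have h0 : muY (stepSource (G.mapX θA).bang F.bang a) = 0 := by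
        by_contra h0
        exact hcon (exists_tensorLetter hd h0)
      have h1 : muX (l.cs a) = 0 := by
        rw [← muY_fst, ← h0]
        refine congrArg muY (Set.ext fun y => ?_)
        refine Iff.trans ?_
          (Flat.mem_stepSource (Flat.mapX_bang G L.shallow_left) (Flat.bang F) a y).symm
        rcases a with g | f <;> exact Iff.rfl
      refine (hnU _).trans (psrc_null ?_ ha ?_)
      · rintro (g | f) A hA
        · exact muX_preimage_null (Microcosm.quasiMeasurePreserving hρ (hGm g)) (fU.real_eq g) hA
        · exact muX_preimage_null (Microcosm.quasiMeasurePreserving hρ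
            (hFm.mapX Microcosm.twist_id Microcosm.twist_symm_id f)) (fW.real_eq f) hA
      · rcases a with g | f
        · have h2 := muX_preimage_null (Microcosm.quasiMeasurePreserving hρ hθA)
            (T := θA) (fun _ => rfl) h1
          have h3 : θA ⁻¹' l.cs (.inl g) = l.us (.inl g) := by
            ext y
            show θA.symm (θA y) ∈ l.sg g ↔ _
            rw [MeasurableEquiv.symm_apply_apply]
            rfl
          exact h3 ▸ h2
        · exact muX_preimage_null (Microcosm.quasiMeasurePreserving hρ (Γ := Γ)
            Microcosm.twist_symm_id) (fun _ => rfl) h1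
    obtain ⟨w, hw⟩ := l.exists_exp_right t e'.2.1 e'.2.2.1 hlet hx
    obtain ⟨-, ⟨c, w', hw'⟩, -, halt⟩ := hw.alt
    refine ⟨⟨.inl (true, true) :: w, List.cons_ne_nil _ _, ?_, fun h0 => he ?_⟩, w, rfl, hw⟩
    · rw [hw'] at halt ⊢
      exact List.isChain_cons_cons.2 ⟨Bool.noConfusion, halt⟩
    · refine measure_mono_null ?_ ((hnC _).symm.trans h0)
      intro x hx
      rw [hsrcR, ← hw.mem_outer l t x] at hx
      exact hx.1
  · rintro e e' e'' ⟨w, hw, h⟩ ⟨w', hw', h'⟩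
    have : w = w' := (List.cons.inj (hw.symm.trans hw')).2
    subst this
    exact Subtype.ext (h.left_unique h')
  · rintro e e' e'' ⟨w, hw, h⟩ ⟨w', hw', h'⟩
    have := h.right_unique ht h'
    subst this
    exact Subtype.ext (hw.trans hw'.symm)
  · rintro e e' ⟨w, hw, h⟩
    refine ⟨?_, hR e e' w hw h, fun x hx => ?_⟩
    · show pathWeight _ _ e.1 = pathWeight _ _ e'.1
      rw [hw, ← prom_weight ρ L G F hG hF h]
      exact mul_one _
    · rw [hsrcL, hw] at hx
      show pmap (Sum.elim fP.map fC.map) e.1 x = θB (merge ρ (pmap (Sum.elim fU.map fW.map) e'.1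
        ((merge ρ).symm (θB.symm x))))
      rw [hmC, hmU, hw]
      exact h.pmap_eq l t hx

end Promotion

end Graphing

/-! ### The measurement of the promotion graphing against its arguments -/

namespace Loc

variable {γ φ : Type*} (l : Loc γ φ)

/-- A map of the promotion graphing followed by a map of the tensor product, from a point of the
region in which they meet. -/
theorem pair_step {p : Bool × Bool} {a : γ ⊕ φ} {x : X} (hx : x ∈ l.cut) (hp : x ∈ l.ps p)
    (ha : l.pm p x ∈ l.cs a) :
    (p = (false, false) ∧ (x ∈ l.RA ∨ x ∈ l.RB) ∧ l.θ.symm (l.cm a (l.pm p x)) ∈ l.RA ∧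
      ∃ g, a = .inl g) ∨
    (p = (false, true) ∧ l.θ.symm x ∈ l.RA ∧ (l.cm a (l.pm p x) ∈ l.RA ∨ l.cm a (l.pm p x) ∈ l.RB) ∧
      ∃ f, a = .inr f) := by
  rcases p with ⟨_ | _, _ | _⟩
  · left
    have h1 : l.θ.symm (l.pm (false, false) x) ∈ l.RA := by
      show l.θ.symm (l.θ (l.T x)) ∈ l.RA
      rw [MeasurableEquiv.symm_apply_apply, l.T_RA]
      exact hp
    rcases a with g | f
    · refine ⟨rfl, .inl hp, ?_, g, rfl⟩
      show l.θ.symm (l.θ (l.bg g (l.θ.symm _))) ∈ l.RA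
      rw [MeasurableEquiv.symm_apply_apply]
      exact (l.sg_sub g _ ha).2
    · exact absurd h1 ((l.sf_sub f _ ha).1.elim (l.not_A_A' _) (l.not_B_A' _))
  · right
    have h1 : l.pm (false, true) x ∈ l.RA := by
      show l.T.symm (l.θ.symm x) ∈ l.RA
      rw [← l.T_RA, MeasurableEquiv.apply_symm_apply]
      exact hp
    rcases a with g | f
    · exact absurd (l.sg_sub g _ ha).1 (l.not_A_A' _ h1)
    · exact ⟨rfl, hp, (l.sf_sub f _ ha).2, f, rfl⟩
  · have h1 : l.Ψ.symm (l.pm (true, false) x) ∈ l.RB := by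
      show l.Ψ.symm (l.Ψ (l.T x)) ∈ l.RB
      rw [MeasurableEquiv.symm_apply_apply, l.T_RB]
      exact hp
    rcases (l.cm_sub a _ ha).1 with (h | h) | h
    · exact absurd h1 (l.not_A_B' _ h)
    · exact absurd h1 (l.not_B_B' _ h)
    · exact absurd h1 (l.not_A'_B' _ h)
  · rcases hx with (h | h) | h
    · exact absurd hp (l.not_A_B' _ h)
    · exact absurd hp (l.not_B_B' _ h)
    · exact absurd hp (l.not_A'_B' _ h)

end Loc

namespace Graphing

variable {Ω : Type*} [Monoid Ω] {ρ : I × I ≃ᵐ I} {VA VB : Set X} {θA θB : X ≃ᵐ X}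

theorem Flat.pairSys_st {F G : Graphing Ω} (f : Flat F) (g : Flat G) (p : F.E × G.E) (y : Y) :
    (pairSys F G).st p y = (g.map p.2 (f.map p.1 y.1), y.2) :=
  Flat.pathReal_eq f g [.inl p.1, .inr p.2] y

theorem Flat.mem_pairSys_src {F G : Graphing Ω} (f : Flat F) (g : Flat G) (p : F.E × G.E) (y : Y) :
    y ∈ (pairSys F G).src p ↔ y.1 ∈ f.src p.1 ∧ f.map p.1 y.1 ∈ g.src p.2 := by
  have h := Flat.mem_pathSource f g [.inl p.1, .inr p.2] y
  have h1 : y ∈ pathSource F G [.inl p.1, .inr p.2] ↔ y ∈ (pairSys F G).src p :=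
    ⟨fun h => ⟨h.1, h.2.1⟩, fun h => ⟨h.1, h.2, trivial⟩⟩
  rw [← h1, h]
  exact ⟨fun h => ⟨h.1, h.2.1⟩, fun h => ⟨h.1, h.2, trivial⟩⟩

variable (ρ) (L : Layout VA VB θA θB) (G F : Graphing Ω) (hG : G.supp = VA)
  (hF : F.supp = VA ∪ VB)

/-- The edge of which an edge of the tensor product consists. -/
noncomputable def argLetter (c : (promArg ρ θA G F).E) : G.E ⊕ F.E :=
  tensorLetter (F := (G.mapX θA).bang) (G := F.bang) ρ (disjoint_tensor_supp L G F hG hF) c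

theorem promArg_map (c : (promArg ρ θA G F).E) (x : X) :
    (Flat.promArg ρ L G F hG hF).map c x =
      (promLoc ρ L G F hG hF).cm (argLetter ρ L G F hG hF c) x := by
  show Sum.elim (Flat.mapX_bang G L.shallow_left).map (Flat.bang F).map
    (argLetter ρ L G F hG hF c) x = _
  rcases argLetter ρ L G F hG hF c with g | f <;> rfl

theorem mem_promArg_src (c : (promArg ρ θA G F).E) (x : X) :
    x ∈ (Flat.promArg ρ L G F hG hF).src c ↔
      x ∈ (promLoc ρ L G F hG hF).cs (argLetter ρ L G F hG hF c) := by
  show x ∈ Sum.elim (Flat.mapX_bang G L.shallow_left).src (Flat.bang F).src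
    (argLetter ρ L G F hG hF c) ↔ _
  rcases argLetter ρ L G F hG hF c with g | f <;> exact Iff.rfl

theorem promArg_weight (c : (promArg ρ θA G F).E) :
    (promArg ρ θA G F).weight c = Sum.elim G.weight F.weight (argLetter ρ L G F hG hF c) :=
  tensor_weight (disjoint_tensor_supp L G F hG hF) c

theorem argLetter_injective : Function.Injective (argLetter ρ L G F hG hF) :=
  tensorLetter_injective (disjoint_tensor_supp L G F hG hF)

/-- An edge of `G` and an edge of `F` which occur in the tensor product. -/
structure ArgPair where
  (g : G.E)
  (f : F.E)
  (c c' : (promArg ρ θA G F).E)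
  hc : argLetter ρ L G F hG hF c = .inl g
  hc' : argLetter ρ L G F hG hF c' = .inr f

variable {ρ L G F hG hF}

theorem ArgPair.ext' {q q' : ArgPair ρ L G F hG hF} (h : q.c = q'.c) (h' : q.c' = q'.c') :
    q = q' := by
  obtain ⟨g, f, c, c', hc, hc'⟩ := q
  obtain ⟨g₁, f₁, c₁, c₁', hc₁, hc₁'⟩ := q'
  dsimp only at h h'
  subst h h'
  obtain rfl := Sum.inl.inj (hc.symm.trans hc₁)
  obtain rfl := Sum.inr.inj (hc'.symm.trans hc₁')
  rfl

theorem ArgPair.edges_injective :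
    Function.Injective fun q : ArgPair ρ L G F hG hF => (q.g, q.f) := by
  intro q q' h
  simp only [Prod.mk.injEq] at h
  have ht := argLetter_injective ρ L G F hG hF
  exact ArgPair.ext' (ht (q.hc.trans (by rw [h.1, q'.hc]))) (ht (q.hc'.trans (by rw [h.2, q'.hc'])))

/-- A path `prom, G, prom, F`. -/
def ArgPair.word (q : ArgPair ρ L G F hG hF) :
    List ((L.prom ρ : Graphing Ω).E × (promArg ρ θA G F).E) :=
  [((false, false), q.c), ((false, true), q.c')]

theorem ArgPair.isBlockCode : Words.IsBlockCode
    (fun a : (L.prom ρ : Graphing Ω).E × (promArg ρ θA G F).E => a.1 = (false, true))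
    (ArgPair.word (ρ := ρ) (L := L) (hG := hG) (hF := hF)) := by
  refine ⟨fun q q' h => ?_, fun q => ⟨[((false, false), q.c)], ((false, true), q.c'), rfl, rfl, ?_⟩⟩
  · obtain ⟨h1, h2⟩ := List.cons.inj h
    exact ArgPair.ext' (Prod.mk.inj h1).2 (Prod.mk.inj (List.cons.inj h2).1).2
  · intro b hb
    rw [List.mem_singleton.1 hb]
    exact fun h => absurd (Prod.mk.inj h).2 Bool.noConfusion

variable (ρ L G F hG hF) in
/-- The pairs of edges of `G` and `F`, as maps of the space times the dialects. -/
def argSys : Sys Ω Y (ArgPair ρ L G F hG hF) where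
  st q := (pairSys G F).st (q.g, q.f)
  src q := (pairSys G F).src (q.g, q.f)
  measurable_src q := (pairSys G F).measurable_src (q.g, q.f)
  wt q := (pairSys G F).wt (q.g, q.f)

/-- Restricting to the pairs that survive in the tensor product does not change the value of a word
of such pairs. -/
theorem argSys_val (m : Ω → ℝ≥0∞) (w : List (ArgPair ρ L G F hG hF)) :
    (argSys ρ L G F hG hF).val m muY w =
      (pairSys G F).val m muY (w.map fun q => (q.g, q.f)) := by
  have h1 : ∀ (w : List (ArgPair ρ L G F hG hF)) y, (argSys ρ L G F hG hF).wreal w y =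
      (pairSys G F).wreal (w.map fun q => (q.g, q.f)) y := by
    intro w
    induction w with
    | nil => exact fun _ => rfl
    | cons q w ih => exact fun y => ih _
  have h2 : ∀ (w : List (ArgPair ρ L G F hG hF)) y, y ∈ (argSys ρ L G F hG hF).wsrc w ↔
      y ∈ (pairSys G F).wsrc (w.map fun q => (q.g, q.f)) := by
    intro w
    induction w with
    | nil => exact fun _ => Iff.rfl
    | cons q w ih => exact fun y => and_congr Iff.rfl (ih _)
  have h3 : (argSys ρ L G F hG hF).wwt w = (pairSys G F).wwt (w.map fun q => (q.g, q.f)) := by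
    induction w with
    | nil => rfl
    | cons q w ih => rw [List.map_cons, Sys.wwt, Sys.wwt, ih]; rfl
  rw [Sys.val, Sys.val, h3]
  congr 2
  ext y
  rw [Sys.mem_prim_map _ ArgPair.edges_injective]
  simp only [Sys.prim, Set.mem_ofPred_eq, h1, h2]

/-- The twist exchanges the places in which the two dialects are stored. -/
theorem unpack_twist (y : Y) : unpack ρ (twist ρ y.1, y.2) = swapD (unpack ρ y) ∧
    unpackRest ρ (twist ρ y.1, y.2) = unpackRest ρ y := by
  simp only [unpack, unpackRest, BB_symm_twist, MeasurableEquiv.symm_apply_apply]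
  exact ⟨rfl, trivial⟩

/-- From `y`, the first edge of `prom` applies the twist, after which the block follows the path `g
f` of `!G` and `twist(!F)` and untwists at the end. `unpack` turns this into a step of `G` and `F`;
the two twists account for `swapD`. -/
theorem argPair_data (q : ArgPair ρ L G F hG hF) (y : Y) :
    (y ∈ (pairSys (L.prom ρ) (promArg ρ θA G F)).wsrc q.word ↔
      swapD (unpack ρ y) ∈ (pairSys G F).src (q.g, q.f)) ∧
    (swapD (unpack ρ ((pairSys (L.prom ρ) (promArg ρ θA G F)).wreal q.word y)) =
      (pairSys G F).st (q.g, q.f) (swapD (unpack ρ y))) ∧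
    unpackRest ρ ((pairSys (L.prom ρ) (promArg ρ θA G F)).wreal q.word y) = unpackRest ρ y := by
  let l := promLoc ρ L G F hG hF
  let fP := Flat.prom ρ L G F hG hF
  let fC := Flat.promArg ρ L G F hG hF
  let fU := Flat.bang G
  let fW := (Flat.bang F).mapX (twist ρ)
  let u : Y := (twist ρ y.1, y.2)
  -- the path on the side of the arguments
  have hU : pathReal G.bang (F.bang.mapX (twist ρ)) [.inl q.g, .inr q.f] u =
      (twist ρ (l.bf q.f ((twist ρ).symm (l.bg q.g (twist ρ y.1)))), y.2) :=
    Flat.pathReal_eq fU fW [.inl q.g, .inr q.f] u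
  have hUs : u ∈ pathSource G.bang (F.bang.mapX (twist ρ)) [.inl q.g, .inr q.f] ↔
      twist ρ y.1 ∈ l.sg q.g ∧ (twist ρ).symm (l.bg q.g (twist ρ y.1)) ∈ l.sf q.f := by
    refine (Flat.mem_pathSource fU fW [.inl q.g, .inr q.f] u).trans ?_
    exact ⟨fun h => ⟨h.1, h.2.1⟩, fun h => ⟨h.1, h.2, trivial⟩⟩
  have hGF : swapD (unpack ρ y) ∈ pathSource G F [.inl q.g, .inr q.f] ↔
      swapD (unpack ρ y) ∈ (pairSys G F).src (q.g, q.f) :=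
    ⟨fun h => ⟨h.1, h.2.1⟩, fun h => ⟨h.1, h.2, trivial⟩⟩
  have hu := unpack_twist (ρ := ρ) y
  have hs := unpack_pathSource ρ G F [.inl q.g, .inr q.f] u
  have hr := unpack_pathReal ρ G F [.inl q.g, .inr q.f] u
  rw [hu.1] at hs hr
  rw [hu.2] at hr
  -- the path on the side of the promotion graphing
  have e1 : ∀ x, fC.map q.c x = θA (l.bg q.g (θA.symm x)) := fun x => by
    rw [promArg_map, q.hc]
    rfl
  have e2 : ∀ x, fC.map q.c' x = l.bf q.f x := fun x => by
    rw [promArg_map, q.hc']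
    rfl
  have e3 : ∀ x, x ∈ fC.src q.c ↔ θA.symm x ∈ l.sg q.g := fun x => by
    rw [mem_promArg_src, q.hc]
    rfl
  have e4 : ∀ x, x ∈ fC.src q.c' ↔ x ∈ l.sf q.f := fun x => by
    rw [mem_promArg_src, q.hc']
    rfl
  have h1 : (pairSys (L.prom ρ) (promArg ρ θA G F)).st ((false, false), q.c) y =
      (θA (l.bg q.g (twist ρ y.1)), y.2) := by
    rw [Flat.pairSys_st fP fC, e1]
    show (θA (l.bg q.g (θA.symm (θA (twist ρ y.1)))), y.2) = _
    rw [MeasurableEquiv.symm_apply_apply]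
  have h2 : ∀ x, (pairSys (L.prom ρ) (promArg ρ θA G F)).st ((false, true), q.c') (θA x, y.2) =
      (l.bf q.f ((twist ρ).symm x), y.2) := by
    intro x
    rw [Flat.pairSys_st fP fC, e2]
    show (l.bf q.f ((twist ρ).symm (θA.symm (θA x))), y.2) = _
    rw [MeasurableEquiv.symm_apply_apply]
  have h3 : (pairSys (L.prom ρ) (promArg ρ θA G F)).wreal q.word y =
      (l.bf q.f ((twist ρ).symm (l.bg q.g (twist ρ y.1))), y.2) := by
    show (pairSys (L.prom ρ) (promArg ρ θA G F)).st ((false, true), q.c')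
      ((pairSys (L.prom ρ) (promArg ρ θA G F)).st ((false, false), q.c) y) = _
    rw [h1, h2]
  have h4 : y ∈ (pairSys (L.prom ρ) (promArg ρ θA G F)).wsrc q.word ↔
      twist ρ y.1 ∈ l.sg q.g ∧ (twist ρ).symm (l.bg q.g (twist ρ y.1)) ∈ l.sf q.f := by
    show y ∈ (pairSys (L.prom ρ) (promArg ρ θA G F)).src ((false, false), q.c) ∧
      (pairSys (L.prom ρ) (promArg ρ θA G F)).st ((false, false), q.c) y ∈
        (pairSys (L.prom ρ) (promArg ρ θA G F)).src ((false, true), q.c') ∧ True ↔ _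
    rw [h1, and_true]
    refine (and_congr (Flat.mem_pairSys_src fP fC _ _) (Flat.mem_pairSys_src fP fC _ _)).trans ?_
    dsimp only
    rw [e3, e4]
    show (y.1 ∈ l.RA ∧ θA.symm (θA (twist ρ y.1)) ∈ l.sg q.g) ∧
      (θA.symm (θA (l.bg q.g (twist ρ y.1))) ∈ l.RA ∧
        (twist ρ).symm (θA.symm (θA (l.bg q.g (twist ρ y.1)))) ∈ l.sf q.f) ↔ _
    rw [MeasurableEquiv.symm_apply_apply, MeasurableEquiv.symm_apply_apply]
    refine ⟨fun h => ⟨h.1.2, h.2.2⟩, fun h => ?_⟩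
    obtain ⟨h5, h6⟩ := l.sg_sub _ _ h.1
    exact ⟨⟨(l.T_RA _).1 h5, h.1⟩, h6, h.2⟩
  have hr1 := (congrArg (unpack ρ) hU).symm.trans hr.1
  have hr2 := (congrArg (unpackRest ρ) hU).symm.trans hr.2
  have h5 := unpack_twist (ρ := ρ)
    (l.bf q.f ((twist ρ).symm (l.bg q.g (twist ρ y.1))), y.2)
  refine ⟨h4.trans (hUs.symm.trans (hs.trans hGF)), ?_, ?_⟩
  · rw [h3, ← h5.1, hr1]
    rfl
  · rw [h3, ← h5.2, hr2]

theorem covers_argPair : Sys.Covers (pairSys (L.prom ρ) (promArg ρ θA G F))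
    (argSys ρ L G F hG hF) ArgPair.word (fun y => swapD (unpack ρ y)) (unpackRest ρ) Set.univ where
  wt q := by
    have h1 := promArg_weight ρ L G F hG hF q.c
    have h2 := promArg_weight ρ L G F hG hF q.c'
    rw [q.hc] at h1
    rw [q.hc'] at h2
    show F.weight q.f * G.weight q.g = (1 * ((promArg ρ θA G F).weight q.c' * (1 : Ω))) *
      ((promArg ρ θA G F).weight q.c * (1 : Ω))
    rw [h1, h2, mul_one, mul_one, one_mul]
    rfl
  inj _ _ h h' := unpack_injective ρ (swapD.injective h) h'
  of_src q y h := (argPair_data q y).1.2 h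
  to_src q y _ h := (argPair_data q y).1.1 h
  real q y _ := (argPair_data q y).2.1
  rest q y _ := (argPair_data q y).2.2
  stay _ _ _ := trivial

variable (ρ L G F hG hF) in
theorem prom_pair_step {a : (L.prom ρ : Graphing Ω).E × (promArg ρ θA G F).E} {y : Y}
    (hy : y.1 ∈ (promLoc ρ L G F hG hF).cut)
    (hs : y ∈ (pairSys (L.prom ρ) (promArg ρ θA G F)).src a) :
    (a.1 = (false, false) ∧ (y.1 ∈ bangSupp VA ∨ y.1 ∈ bangSupp VB) ∧
      θA.symm ((pairSys (L.prom ρ) (promArg ρ θA G F)).st a y).1 ∈ bangSupp VA ∧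
      ∃ g, argLetter ρ L G F hG hF a.2 = .inl g) ∨
    (a.1 = (false, true) ∧ θA.symm y.1 ∈ bangSupp VA ∧
      (((pairSys (L.prom ρ) (promArg ρ θA G F)).st a y).1 ∈ bangSupp VA ∨
        ((pairSys (L.prom ρ) (promArg ρ θA G F)).st a y).1 ∈ bangSupp VB) ∧
      ∃ f, argLetter ρ L G F hG hF a.2 = .inr f) := by
  let l := promLoc ρ L G F hG hF
  let fP := Flat.prom ρ L G F hG hF
  let fC := Flat.promArg ρ L G F hG hF
  rw [Flat.pairSys_st fP fC]
  rw [Flat.mem_pairSys_src fP fC] at hs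
  dsimp only [fC]
  rw [promArg_map]
  rw [mem_promArg_src] at hs
  exact l.pair_step hy hs.1 hs.2

theorem st_mem_cut {a : (L.prom ρ : Graphing Ω).E × (promArg ρ θA G F).E} {y : Y}
    (hs : y ∈ (pairSys (L.prom ρ) (promArg ρ θA G F)).src a) :
    ((pairSys (L.prom ρ) (promArg ρ θA G F)).st a y).1 ∈ (promLoc ρ L G F hG hF).cut := by
  have h1 := (promArg ρ θA G F).target_subset a.2 _ hs.2
  have h2 : ((pairSys (L.prom ρ) (promArg ρ θA G F)).st a y).1 ∈ (promArg ρ θA G F).supp := h1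
  rw [promArg_supp ρ L G F hG hF] at h2
  rcases h2 with h2 | h2
  · exact .inr ((mem_bangSupp_image L.shallow_left).1 h2)
  · exact .inl h2

include L in
omit [Monoid Ω] in
theorem Layout.notMem_left' {x : X} (h : x ∈ bangSupp VA ∨ x ∈ bangSupp VB) :
    θA.symm x ∉ bangSupp VA := fun h' => by
  rcases h with h | h
  · exact Set.disjoint_left.1 L.disjoint_bang.2.1 h ((mem_bangSupp_image L.shallow_left).2 h')
  · exact Set.disjoint_left.1 L.disjoint_bang.2.2.1 h ((mem_bangSupp_image L.shallow_left).2 h')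

theorem wreal_mem_cut {w : List ((L.prom ρ : Graphing Ω).E × (promArg ρ θA G F).E)} {y : Y}
    (hy : y.1 ∈ (promLoc ρ L G F hG hF).cut)
    (hs : y ∈ (pairSys (L.prom ρ) (promArg ρ θA G F)).wsrc w) :
    ((pairSys (L.prom ρ) (promArg ρ θA G F)).wreal w y).1 ∈ (promLoc ρ L G F hG hF).cut := by
  induction w generalizing y with
  | nil => exact hy
  | cons a w ih => exact ih (st_mem_cut hs.1) hs.2

/-- From the region of `V_A ∪ V_B` a pair goes through `G` to the region of `θA(V_A)`, and the next
pair comes back through `F`. So pairs group two by two, each group ending in a letter `(false,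
true)`. -/
theorem exists_argPair_words (n : ℕ)
    (w : List ((L.prom ρ : Graphing Ω).E × (promArg ρ θA G F).E))
    (a : (L.prom ρ : Graphing Ω).E × (promArg ρ θA G F).E) (hn : w.length = n)
    (ha : a.1 = (false, true)) (y : Y) (hy : y.1 ∈ bangSupp VA ∨ y.1 ∈ bangSupp VB)
    (hs : y ∈ (pairSys (L.prom ρ) (promArg ρ θA G F)).wsrc (w ++ [a])) :
    ∃ W : List (ArgPair ρ L G F hG hF), W.flatMap ArgPair.word = w ++ [a] := by
  have hne {x : X} := @L.notMem_left' _ _ _ _ x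
  induction n using Nat.strong_induction_on generalizing w y with
  | _ n ih =>
    rcases w with _ | ⟨b, w⟩
    · rcases prom_pair_step ρ L G F hG hF (.inl hy) hs.1 with ⟨h, -⟩ | ⟨-, h, -⟩
      · rw [ha] at h
        exact absurd (Prod.mk.inj h).2 Bool.noConfusion
      · exact absurd h (hne hy)
    · rcases prom_pair_step ρ L G F hG hF (.inl hy) hs.1 with ⟨hb, -, h1, g, hg⟩ | ⟨-, h, -⟩
      swap
      · exact absurd h (hne hy)
      have key : ∀ c : (L.prom ρ : Graphing Ω).E × (promArg ρ θA G F).E,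
          (pairSys (L.prom ρ) (promArg ρ θA G F)).st b y ∈
            (pairSys (L.prom ρ) (promArg ρ θA G F)).src c →
          ∃ q : ArgPair ρ L G F hG hF, q.word = [b, c] ∧
            (((pairSys (L.prom ρ) (promArg ρ θA G F)).st c
              ((pairSys (L.prom ρ) (promArg ρ θA G F)).st b y)).1 ∈ bangSupp VA ∨
            ((pairSys (L.prom ρ) (promArg ρ θA G F)).st c
              ((pairSys (L.prom ρ) (promArg ρ θA G F)).st b y)).1 ∈ bangSupp VB) := by
        intro c hc
        rcases prom_pair_step ρ L G F hG hF (.inr h1) hc with ⟨-, h, -⟩ | ⟨hc1, -, h2, f, hf⟩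
        · exact absurd h1 (hne h)
        · obtain ⟨b1, b2⟩ := b
          obtain ⟨c1, c2⟩ := c
          dsimp only at hb hc1
          subst hb hc1
          exact ⟨⟨g, f, b2, c2, hg, hf⟩, rfl, h2⟩
      rcases w with _ | ⟨c, w⟩
      · obtain ⟨q, hq, -⟩ := key a hs.2.1
        exact ⟨[q], by rw [List.flatMap_singleton, hq]; rfl⟩
      · obtain ⟨q, hq, h2⟩ := key c hs.2.1
        obtain ⟨W, hW⟩ := ih w.length (by simp only [List.length_cons] at hn; omega) w rfl _ h2
          hs.2.2
        exact ⟨q :: W, by rw [List.flatMap_cons, hW, hq]; rfl⟩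

/-- The interaction of the promotion graphing with its arguments is that of the arguments. -/
theorem meas_prom_eq_zero {m : Ω → ℝ≥0∞} (hm : ∀ u v : Ω, m (u * v) = m (v * u))
    (hρ : MeasurePreserving ρ volume volume) (L : Layout VA VB θA θB) (hG : G.supp = VA)
    (hF : F.supp = VA ∪ VB)
    (hPc : (L.prom ρ : Graphing Ω).Compat m) (hCc : (promArg ρ θA G F).Compat m)
    (hGc : G.Compat m) (hFc : F.Compat m) (h0 : meas m G F = 0) :
    meas m (L.prom ρ) (promArg ρ θA G F) = 0 := by
  have hcomp := compat_pairSys hPc hCc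
  rw [meas_eq_cyc hm hGc hFc, Sys.cyc, ENNReal.tsum_eq_zero] at h0
  have hval : ∀ w, (argSys ρ L G F hG hF).val m muY w = 0 := by
    intro w
    rw [argSys_val]
    have := h0 (w.map fun q => (q.g, q.f))
    rw [Set.indicator_of_mem (Set.mem_univ _), ENNReal.div_eq_zero_iff] at this
    exact this.resolve_right (ENNReal.natCast_ne_top _)
  have hφ : MeasurePreserving (fun y => swapD (unpack ρ y)) muY muY :=
    measurePreserving_swapD.comp (measurePreserving_unpack ρ hρ)
  -- A loop returns to its start through an edge of the tensor product, so it lies in the cut from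
  -- the beginning; from there no edge to the region of the conclusion can be continued.
  have hlast : ∀ {u : List ((L.prom ρ : Graphing Ω).E × (promArg ρ θA G F).E)} {a} {y : Y},
      y ∈ (pairSys (L.prom ρ) (promArg ρ θA G F)).prim (u ++ [a]) →
      y.1 ∈ (promLoc ρ L G F hG hF).cut ∧
      ∃ z, z.1 ∈ (promLoc ρ L G F hG hF).cut ∧
        z ∈ (pairSys (L.prom ρ) (promArg ρ θA G F)).src a ∧
        (pairSys (L.prom ρ) (promArg ρ θA G F)).st a z = y := by
    rintro u a y ⟨-, hs, hr, -⟩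
    rw [Sys.mem_wsrc_append] at hs
    rw [Sys.wreal_append] at hr
    have hr' : (pairSys (L.prom ρ) (promArg ρ θA G F)).st a
      ((pairSys (L.prom ρ) (promArg ρ θA G F)).wreal u y) = y := hr
    have hy : y.1 ∈ (promLoc ρ L G F hG hF).cut := by
      rw [← hr']
      exact st_mem_cut hs.2.1
    exact ⟨hy, _, wreal_mem_cut hy hs.1, hs.2.1, hr⟩
  -- Cycles of the promotion graphing with its arguments are words of blocks, and these have the
  -- values of cycles of `G` and `F`, which vanish.
  have hcov := (covers_argPair (ρ := ρ) (L := L) (hG := hG) (hF := hF)).cyc_eq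
    ArgPair.isBlockCode hm hcomp hφ Set.univ (fun _ => by simp) ?_
  · rw [meas_eq_cyc hm hPc hCc]
    have h1 : (argSys ρ L G F hG hF).cyc m muY
        {W | W.flatMap ArgPair.word ∈ (Set.univ : Set (List ((L.prom ρ : Graphing Ω).E ×
          (promArg ρ θA G F).E)))} = 0 := by
      rw [Sys.cyc, ENNReal.tsum_eq_zero]
      intro w
      simp [hval]
    rw [h1] at hcov
    rw [hcov]
    refine Sys.cyc_congr _ fun w hw => ⟨fun _ => ⟨trivial, ?_⟩, fun _ => trivial⟩
    rw [Sys.val] at hw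
    obtain ⟨y, hy⟩ := nonempty_of_measure_ne_zero (right_ne_zero_of_mul hw)
    rcases List.eq_nil_or_concat w with rfl | ⟨u, a, rfl⟩
    · exact absurd rfl hy.1
    obtain ⟨hcut, -⟩ := hlast (by rwa [List.concat_eq_append] at hy)
    -- One of the first two pairs is a return from the region of `θA(V_A)`. If the first is not, it
    -- leads into that region; a loop cannot stop there, and only a return can follow.
    generalize u.concat a = w at hy
    obtain ⟨h0, hs, hr, -⟩ := hy
    rcases w with _ | ⟨b, w⟩
    · exact absurd rfl h0
    rcases prom_pair_step ρ L G F hG hF hcut hs.1 with ⟨-, h1, h2, -⟩ | ⟨h, -⟩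
    swap
    · exact ⟨b, List.mem_cons_self, h⟩
    rcases w with _ | ⟨c, w⟩
    · have hr' : (pairSys (L.prom ρ) (promArg ρ θA G F)).st b y = y := hr
      rw [hr'] at h2
      exact absurd h2 (L.notMem_left' h1)
    · rcases prom_pair_step ρ L G F hG hF (.inr h2) hs.2.1 with ⟨-, h3, -⟩ | ⟨h, -⟩
      · exact absurd h2 (L.notMem_left' h3)
      · exact ⟨c, by simp, h⟩
  · intro u a ha _ hv
    rw [Sys.val] at hv
    obtain ⟨y, hy⟩ := nonempty_of_measure_ne_zero (right_ne_zero_of_mul hv)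
    obtain ⟨-, z, hcut, hz, rfl⟩ := hlast hy
    rcases prom_pair_step ρ L G F hG hF hcut hz with ⟨h, -⟩ | ⟨-, -, h, -⟩
    · rw [ha] at h
      exact absurd (Prod.mk.inj h).2 Bool.noConfusion
    · exact exists_argPair_words _ u a rfl ha _ h hy.2.1

end Graphing

/-! ## Wagers -/

theorem wmul_add (r : ℝ) (x y : WithTop ℝ) : wmul r (x + y) = wmul r x + wmul r y := by
  induction x using WithTop.recTopCoe with
  | top => rfl
  | coe x =>
    induction y using WithTop.recTopCoe with
    | top => rfl
    | coe y => exact congrArg _ (mul_add r x y)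

theorem add_wmul (r s : ℝ) (x : WithTop ℝ) : wmul (r + s) x = wmul r x + wmul s x := by
  induction x using WithTop.recTopCoe with
  | top => rfl
  | coe x => exact congrArg _ (add_mul r s x)

theorem wmul_wmul (r s : ℝ) (x : WithTop ℝ) : wmul r (wmul s x) = wmul (r * s) x := by
  induction x using WithTop.recTopCoe with
  | top => rfl
  | coe x => exact congrArg _ (mul_assoc r s x).symm

theorem one_wmul (x : WithTop ℝ) : wmul 1 x = x := by
  induction x using WithTop.recTopCoe with
  | top => rfl
  | coe x => exact congrArg _ (one_mul x)

theorem wmul_zero (r : ℝ) : wmul r 0 = 0 := congrArg _ (mul_zero r)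

theorem wmul_coe (r x : ℝ) : wmul r x = ((r * x : ℝ) : WithTop ℝ) := rfl

theorem wmul_sum {ι : Type*} (s : Finset ι) (r : ℝ) (f : ι → WithTop ℝ) :
    wmul r (∑ i ∈ s, f i) = ∑ i ∈ s, wmul r (f i) := by
  classical
  induction s using Finset.induction_on with
  | empty => exact wmul_zero r
  | insert i s hi ih => rw [Finset.sum_insert hi, Finset.sum_insert hi, wmul_add, ih]

/-- The sum must be non-empty because `∞` absorbs even the coefficient `0`. This is where the
non-emptiness of formal sums enters the trefoil property. -/
theorem sum_wmul {ι : Type*} {s : Finset ι} (hs : s.Nonempty) (r : ι → ℝ) (x : WithTop ℝ) :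
    wmul (∑ i ∈ s, r i) x = ∑ i ∈ s, wmul (r i) x := by
  classical
  induction hs using Finset.Nonempty.cons_induction with
  | singleton i => rw [Finset.sum_singleton, Finset.sum_singleton]
  | cons i s hi hs ih => rw [Finset.sum_cons, Finset.sum_cons, add_wmul, ih]

theorem toW_zero : toW 0 = 0 := rfl

theorem toW_add (x y : ℝ≥0∞) : toW (x + y) = toW x + toW y := by
  induction x using ENNReal.recTopCoe with
  | top => rfl
  | coe x =>
    induction y using ENNReal.recTopCoe with
    | top => rfl
    | coe y => exact congrArg _ (NNReal.coe_add x y)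

theorem toW_eq_zero {x : ℝ≥0∞} (h : toW x = 0) : x = 0 := by
  induction x using ENNReal.recTopCoe with
  | top => exact absurd h WithTop.top_ne_zero
  | coe x =>
    have h' : (x : ℝ) = 0 := WithTop.coe_eq_zero.1 h
    rw [NNReal.coe_eq_zero.1 h', ENNReal.coe_zero]

namespace Graphing

variable {Ω : Type*} [Monoid Ω] {m : Ω → ℝ≥0∞}

theorem empty_meas (m : Ω → ℝ≥0∞) (F : Graphing Ω) (V : Set X) (hV : MeasurableSet V) :
    meas m (empty V hV) F = 0 := by
  rw [meas, ENNReal.tsum_eq_zero]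
  rintro ⟨c, hc⟩
  obtain ⟨⟨e, f⟩, -⟩ := List.exists_mem_of_ne_nil _ hc.1
  exact e.elim

theorem meas_eq_zero_of_disjoint (hm : ∀ u v : Ω, m (u * v) = m (v * u)) {F G : Graphing Ω}
    (hF : F.Compat m) (hG : G.Compat m) (hd : Disjoint F.supp G.supp) : meas m F G = 0 := by
  rw [meas_eq_cyc hm hF hG, Sys.cyc, ENNReal.tsum_eq_zero]
  intro w
  rw [Set.indicator_of_mem (Set.mem_univ _), ENNReal.div_eq_zero_iff]
  left
  by_contra h
  rw [Sys.val] at h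
  obtain ⟨y, h0, hs, -⟩ := nonempty_of_measure_ne_zero (right_ne_zero_of_mul h)
  rcases w with _ | ⟨⟨f, g⟩, w⟩
  · exact h0 rfl
  · have h2 := G.source_subset g _ hs.1.2
    exact Set.disjoint_left.1 hd (F.target_subset f _ hs.1.1) h2

end Graphing

/-! ### Projects and their trefoil property -/

namespace Project

variable {Ω : Type*}

/-- All realisers are compatible with `m`. -/
def Compat (m : Ω → ℝ≥0∞) (a : Project Ω) : Prop := ∀ i, (a.slice i).Compat m

variable [Monoid Ω] {m : Ω → ℝ≥0∞} {ρ : I × I ≃ᵐ I}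

theorem Compat.exec (hρ : MeasurePreserving ρ volume volume) {a b : Project Ω} (ha : a.Compat m)
    (hb : b.Compat m) : (a.exec m ρ b).Compat m :=
  fun p => Graphing.compat_exec hρ (ha p.1) (hb p.2)

theorem unit_exec (a b : Project Ω) : (a.exec m ρ b).unit = a.unit * b.unit := by
  show ∑ p : a.ι × b.ι, a.coeff p.1 * b.coeff p.2 = _
  rw [Fintype.sum_prod_type, unit, unit, Finset.sum_mul_sum]

/-- The joint measurement of three projects. -/
noncomputable def tri (m : Ω → ℝ≥0∞) (a b c : Project Ω) : WithTop ℝ :=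
  wmul (b.unit * c.unit) a.wager + wmul (a.unit * c.unit) b.wager +
    wmul (a.unit * b.unit) c.wager +
    ∑ i : a.ι, ∑ j : b.ι, ∑ k : c.ι, wmul (a.coeff i * b.coeff j * c.coeff k)
      (toW (Graphing.triMeas m (a.slice i) (b.slice j) (c.slice k)))

section

variable (hm : ∀ u v : Ω, m (u * v) = m (v * u))

include hm

theorem tri_swap12 {a b c : Project Ω} (ha : a.Compat m) (hb : b.Compat m) (hc : c.Compat m) :
    tri m b a c = tri m a b c := by
  rw [tri, tri, mul_comm b.unit a.unit, add_comm (wmul (a.unit * c.unit) b.wager)]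
  congr 1
  rw [Finset.sum_comm]
  refine Finset.sum_congr rfl fun i _ => Finset.sum_congr rfl fun j _ =>
    Finset.sum_congr rfl fun k _ => ?_
  rw [Graphing.triMeas_swap12 hm (ha i) (hb j) (hc k), mul_comm (b.coeff j)]

theorem tri_swap23 {a b c : Project Ω} (ha : a.Compat m) (hb : b.Compat m) (hc : c.Compat m) :
    tri m a c b = tri m a b c := by
  rw [tri, tri, mul_comm c.unit b.unit,
    add_right_comm (wmul (b.unit * c.unit) a.wager) (wmul (a.unit * b.unit) c.wager)]
  congr 1
  refine Finset.sum_congr rfl fun i _ => ?_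
  rw [Finset.sum_comm]
  refine Finset.sum_congr rfl fun j _ => Finset.sum_congr rfl fun k _ => ?_
  rw [Graphing.triMeas_swap23 hm (ha i) (hb j) (hc k), mul_right_comm]

variable (hρ : MeasurePreserving ρ volume volume)

include hρ

theorem meas_comm {a b : Project Ω} (ha : a.Compat m) (hb : b.Compat m) :
    a.meas m b = b.meas m a := by
  rw [meas, meas, add_comm (wmul _ a.wager), Fintype.sum_prod_type, Fintype.sum_prod_type,
    Finset.sum_comm]
  congr 1
  refine Finset.sum_congr rfl fun j _ => Finset.sum_congr rfl fun i _ => ?_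
  rw [Graphing.meas_comm hm hρ (ha i) (hb j), mul_comm]

/-- The trefoil property for projects. -/
theorem meas_exec {a b c : Project Ω} (ha : a.Compat m) (hb : b.Compat m) (hc : c.Compat m)
    (hd : a.supp ∩ b.supp ∩ c.supp = ∅) : (a.exec m ρ b).meas m c = tri m a b c := by
  have hw : (a.exec m ρ b).wager = a.meas m b := rfl
  have hsum : ∀ x : WithTop ℝ, wmul c.unit x = ∑ k : c.ι, wmul (c.coeff k) x := fun x =>
    sum_wmul Finset.univ_nonempty _ x
  -- The measurement of `a` and `b`, contained in the wager of the execution, is distributed over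
  -- the summands of `c`; each term then receives the summand `⟦F, G⟧` required by the trefoil
  -- property.
  have h1 : wmul c.unit (∑ p : a.ι × b.ι, wmul (a.coeff p.1 * b.coeff p.2)
        (toW ((a.slice p.1).meas m (b.slice p.2)))) +
      ∑ q : (a.ι × b.ι) × c.ι, wmul (a.coeff q.1.1 * b.coeff q.1.2 * c.coeff q.2)
        (toW (((a.slice q.1.1).exec ρ (b.slice q.1.2)).meas m (c.slice q.2))) =
      ∑ i : a.ι, ∑ j : b.ι, ∑ k : c.ι, wmul (a.coeff i * b.coeff j * c.coeff k)
        (toW (Graphing.triMeas m (a.slice i) (b.slice j) (c.slice k))) := by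
    rw [wmul_sum, Fintype.sum_prod_type, Fintype.sum_prod_type, Fintype.sum_prod_type,
      ← Finset.sum_add_distrib]
    refine Finset.sum_congr rfl fun i _ => ?_
    rw [← Finset.sum_add_distrib]
    refine Finset.sum_congr rfl fun j _ => ?_
    rw [hsum, ← Finset.sum_add_distrib]
    refine Finset.sum_congr rfl fun k _ => ?_
    have hd' : (a.slice i).supp ∩ (b.slice j).supp ∩ (c.slice k).supp = ∅ := by
      rw [a.slice_supp, b.slice_supp, c.slice_supp, hd]
    rw [wmul_wmul, mul_comm (c.coeff k), ← wmul_add, ← toW_add, add_comm,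
      Graphing.meas_exec_add hm hρ (ha i) (hb j) (hc k) hd']
  rw [meas, hw, unit_exec, meas, wmul_add, wmul_add, wmul_wmul, wmul_wmul, tri, ← h1,
    mul_comm c.unit b.unit, mul_comm c.unit a.unit]
  show _ + _ + _ + (∑ q : (a.ι × b.ι) × c.ι, _) = _
  rw [add_right_comm (_ + _) (wmul c.unit _), add_assoc (_ + _ + _)]
  rfl

end

/-- The value of an interaction is neither `0` nor `∞`. -/
def Nondeg (x : WithTop ℝ) : Prop := x ≠ 0 ∧ x ≠ ⊤

theorem Orth.symm (hm : ∀ u v : Ω, m (u * v) = m (v * u))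
    (hρ : MeasurePreserving ρ volume volume) {a b : Project Ω} (ha : a.Compat m)
    (hb : b.Compat m) (h : a.Orth m b) : b.Orth m a := by
  rw [Orth, ← meas_comm hm hρ ha hb]
  exact ⟨h.1.symm, h.2⟩

theorem AEEq.meas_eq (hm : ∀ u v : Ω, m (u * v) = m (v * u)) {a b c : Project Ω} (h : a.AEEq b)
    (ha : a.Compat m) (hb : b.Compat m) (hc : c.Compat m) : a.meas m c = b.meas m c := by
  obtain ⟨hw, -, θ, hθ⟩ := h
  have hu : a.unit = b.unit := by
    rw [unit, unit, ← θ.sum_comp]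
    exact Finset.sum_congr rfl fun i _ => (hθ i).1
  rw [meas, meas, hw, hu, Fintype.sum_prod_type, Fintype.sum_prod_type, ← θ.sum_comp]
  congr 1
  refine Finset.sum_congr rfl fun i _ => Finset.sum_congr rfl fun j _ => ?_
  dsimp only
  rw [(hθ i).1, (hθ i).2.meas_eq hm (ha i) (hb _) (hc j)]

omit [Monoid Ω] in
theorem InMicrocosm.compat {Γ : Subgroup ℝˣ} (hρ : MeasurePreserving ρ volume volume)
    (hΓ : ∀ α ∈ Γ, ∀ w : Ω, ENNReal.ofReal |(α : ℝ)| * m w = m w) {a : Project Ω}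
    (ha : a.InMicrocosm ρ Γ) : a.Compat m := fun i => (ha i).compat hρ hΓ

theorem InMicrocosm.exec {Γ : Subgroup ℝˣ} {a b : Project Ω} (ha : a.InMicrocosm ρ Γ)
    (hb : b.InMicrocosm ρ Γ) : (a.exec m ρ b).InMicrocosm ρ Γ :=
  fun p => (ha p.1).exec (hb p.2)

/-! ### Projects consisting of a single graphing -/

omit [Monoid Ω] in
theorem unit_single (F : Graphing Ω) : (single F).unit = 1 := by
  show ∑ _ : Unit, (1 : ℝ) = 1
  simp

theorem meas_single (F G : Graphing Ω) :
    (single F).meas m (single G) = toW (Graphing.meas m F G) := by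
  rw [meas, unit_single, unit_single]
  show wmul 1 0 + wmul 1 0 + ∑ _ : Unit × Unit, wmul (1 * 1) (toW (Graphing.meas m F G)) = _
  rw [wmul_zero, zero_add, zero_add, one_mul, one_wmul]
  simp

theorem exec_single_aeEq {F G H : Graphing Ω} (h0 : (single F).meas m (single G) = 0)
    (h : (F.exec ρ G).AEEq H) : ((single F).exec m ρ (single G)).AEEq (single H) :=
  ⟨h0, h.1, Equiv.prodPUnit Unit, fun _ => ⟨mul_one 1, h⟩⟩

theorem exec_tensor_aeEq {P F G H : Graphing Ω}
    (h0 : (single P).meas m ((single F).exec m ρ (single G)) = 0)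
    (h : (P.exec ρ (F.exec ρ G)).AEEq H) :
    ((single P).exec m ρ ((single F).exec m ρ (single G))).AEEq (single H) :=
  ⟨h0, h.1, (Equiv.punitProd _).trans (Equiv.prodPUnit Unit), fun _ =>
    ⟨by show (1 : ℝ) * (1 * 1) = 1; norm_num, h⟩⟩

theorem meas_tensor {P F G : Graphing Ω} (h0 : Graphing.meas m F G = 0) :
    (single P).meas m ((single F).exec m ρ (single G)) =
      toW (Graphing.meas m P (F.exec ρ G)) := by
  have hw : ((single F).exec m ρ (single G)).wager = 0 := by
    show (single F).meas m (single G) = 0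
    rw [meas_single, h0, toW_zero]
  rw [meas, hw]
  show wmul _ 0 + wmul _ 0 + ∑ _ : Unit × (Unit × Unit),
    wmul (1 * (1 * 1)) (toW (Graphing.meas m P (F.exec ρ G))) = _
  rw [wmul_zero, wmul_zero, zero_add, zero_add, one_mul, one_mul, one_wmul]
  simp

omit [Monoid Ω] in
/-- A project whose delocation is a single graphing is a single graphing. -/
theorem eq_single_of_mapX {T : X ≃ᵐ X} {a : Project Ω} {F : Graphing Ω}
    (h : a.mapX T = single F) : ∃ G, a = single G ∧ G.mapX T = F := by
  obtain ⟨w, V, hV, ι, coeff, slice, hs⟩ := a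
  obtain ⟨rfl, -, rfl, h2, h3, h4⟩ := Project.mk.inj h
  obtain rfl := eq_of_heq h2
  obtain rfl := eq_of_heq h3
  have h5 := congrFun (eq_of_heq h4) ()
  obtain rfl := hs ()
  exact ⟨slice (), rfl, h5⟩

end Project

theorem symmDiff_union_right {U V : Set X} (h : Disjoint U V) : symmDiff (U ∪ V) V = U := by
  ext x
  have h1 : x ∈ U → x ∉ V := fun hx => Set.disjoint_left.1 h hx
  rw [Set.mem_symmDiff, Set.mem_union]
  tauto

theorem symmDiff_union_left {U V : Set X} (h : Disjoint U V) : symmDiff (U ∪ V) U = V := by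
  rw [Set.union_comm]
  exact symmDiff_union_right h.symm

/-! ### Conducts and adjunctions -/

section Conducts

variable {Ω : Type*} [Monoid Ω] {m : Ω → ℝ≥0∞} {Γ : Subgroup ℝˣ} {ρ : I × I ≃ᵐ I}
  (hm : ∀ u v : Ω, m (u * v) = m (v * u))
  (hΓ : ∀ α ∈ Γ, ∀ w : Ω, ENNReal.ofReal |(α : ℝ)| * m w = m w)
  (hρ : MeasurePreserving ρ volume volume)

include hm hΓ hρ

theorem subset_bipolar {V : Set X} {T : Set (Project Ω)}
    (hT : ∀ a ∈ T, a.supp = V ∧ a.InMicrocosm ρ Γ) : T ⊆ bipolar m ρ Γ V T := fun a ha =>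
  ⟨(hT a ha).1, (hT a ha).2, fun _ hb => (hb.2.2 a ha).symm hm hρ (hb.2.1.compat hρ hΓ)
    ((hT a ha).2.compat hρ hΓ)⟩

omit hm hΓ hρ in
/-- The project `(1, r · V)` of the graphing without edges. -/
def probe (r : ℝ) (V : Set X) (hV : MeasurableSet V) : Project Ω where
  wager := 1
  supp := V
  measurable_supp := hV
  ι := Unit
  coeff _ := r
  slice _ := Graphing.empty V hV
  slice_supp _ := rfl

omit [Monoid Ω] hm hΓ hρ in
theorem unit_probe (r : ℝ) (V : Set X) (hV : MeasurableSet V) :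
    (probe r V hV : Project Ω).unit = r := by
  show ∑ _ : Unit, r = r
  simp

omit hm hΓ hρ in
theorem probe_meas (r : ℝ) (V : Set X) (hV : MeasurableSet V) (c : Project Ω) :
    (probe r V hV).meas m c = wmul c.unit 1 + wmul r c.wager := by
  have h : ∑ p : (probe r V hV : Project Ω).ι × c.ι,
      wmul ((probe r V hV : Project Ω).coeff p.1 * c.coeff p.2)
        (toW (((probe r V hV : Project Ω).slice p.1).meas m (c.slice p.2))) = 0 := by
    refine Finset.sum_eq_zero fun p _ => ?_
    have : ((probe r V hV : Project Ω).slice p.1).meas m (c.slice p.2) = 0 :=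
      Graphing.empty_meas m _ V hV
    rw [this, toW_zero, wmul_zero]
  rw [Project.meas, h, add_zero, unit_probe]
  rfl

/-- The projects of the bi-orthogonal closure of a set of balanced projects have wager `0`. -/
theorem wager_eq_zero {V : Set X} (hV : MeasurableSet V) {T : Set (Project Ω)}
    (hT : ∀ a ∈ T, ∃ F : Graphing Ω, a = Project.single F ∧ F.supp = V) {c : Project Ω}
    (hc : c ∈ bipolar m ρ Γ V T) : c.wager = 0 := by
  have hprobe : ∀ r, (probe r V hV : Project Ω).InMicrocosm ρ Γ := fun _ _ => Empty.rec
  -- Against a balanced project the probe gives `1`, whatever `r` is, since it has no edges and the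
  -- wager it multiplies by `r` is `0`.
  have horth : ∀ r, probe r V hV ∈ polar m ρ Γ V T := by
    refine fun r => ⟨rfl, hprobe r, fun a ha => ?_⟩
    obtain ⟨F, rfl, hF⟩ := hT a ha
    refine ⟨hF.symm, ?_⟩
    have : (Project.single F).wager = 0 := rfl
    rw [probe_meas, this, wmul_zero, add_zero, Project.unit_single, one_wmul]
    exact ⟨one_ne_zero, WithTop.one_ne_top⟩
  have hval : ∀ r, wmul c.unit 1 + wmul r c.wager ≠ 0 ∧ wmul c.unit 1 + wmul r c.wager ≠ ⊤ := by
    intro r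
    have h := (hc.2.2 _ (horth r)).symm hm hρ (hc.2.1.compat hρ hΓ) ((hprobe r).compat hρ hΓ)
    have h' := h.2
    rwa [probe_meas] at h'
  generalize c.wager = x at hval
  induction x using WithTop.recTopCoe with
  | top => exact absurd rfl (hval 0).2
  | coe x =>
    by_contra hx
    have hx' : x ≠ 0 := fun h => hx (by rw [h]; rfl)
    -- The pairing of the probe with `c` is `1_c + r x`. A non-zero finite wager `x` would let some
    -- `r` annihilate it; an infinite one makes it infinite.
    refine (hval (-c.unit / x)).1 ?_
    have h1 : wmul c.unit 1 = ((c.unit * 1 : ℝ) : WithTop ℝ) := rfl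
    rw [h1, wmul_coe, ← WithTop.coe_add, div_mul_cancel₀ _ hx', mul_one, add_neg_cancel]
    rfl

/-- Execution is associative inside measurements. -/
theorem meas_exec_exec {a b c : Project Ω} (ha : a.InMicrocosm ρ Γ) (hb : b.InMicrocosm ρ Γ)
    (hc : c.InMicrocosm ρ Γ) (hd : a.supp ∩ b.supp ∩ c.supp = ∅) :
    (a.exec m ρ b).meas m c = (a.exec m ρ c).meas m b := by
  have ha' := ha.compat hρ hΓ
  have hb' := hb.compat hρ hΓ
  have hc' := hc.compat hρ hΓ
  rw [Project.meas_exec hm hρ ha' hb' hc' hd, Project.meas_exec hm hρ ha' hc' hb',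
    Project.tri_swap23 hm ha' hb' hc']
  rw [Set.inter_right_comm, hd]

/-- Adjunction of execution and the tensor product. -/
theorem meas_exec_tensor {a b c : Project Ω} (ha : a.InMicrocosm ρ Γ) (hb : b.InMicrocosm ρ Γ)
    (hc : c.InMicrocosm ρ Γ) (hd : a.supp ∩ b.supp ∩ c.supp = ∅) :
    (a.exec m ρ b).meas m c = a.meas m (b.exec m ρ c) := by
  have ha' := ha.compat hρ hΓ
  have hb' := hb.compat hρ hΓ
  have hc' := hc.compat hρ hΓ
  rw [Project.meas_comm hm hρ ha' (hb'.exec hρ hc'), Project.meas_exec hm hρ ha' hb' hc' hd,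
    Project.meas_exec hm hρ hb' hc' ha', Project.tri_swap23 hm hb' ha' hc',
    Project.tri_swap12 hm ha' hb' hc']
  rw [Set.inter_comm, ← Set.inter_assoc, hd]

/-- The two executions differ in the order of the dialects, but no test sees it. -/
theorem exec_comm_meas {a b c : Project Ω} (ha : a.InMicrocosm ρ Γ) (hb : b.InMicrocosm ρ Γ)
    (hc : c.InMicrocosm ρ Γ) (hd : a.supp ∩ b.supp ∩ c.supp = ∅) :
    (a.exec m ρ b).meas m c = (b.exec m ρ a).meas m c := by
  have ha' := ha.compat hρ hΓ
  have hb' := hb.compat hρ hΓ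
  have hc' := hc.compat hρ hΓ
  rw [Project.meas_exec hm hρ ha' hb' hc' hd, Project.meas_exec hm hρ hb' ha' hc',
    Project.tri_swap12 hm ha' hb' hc']
  rw [Set.inter_comm b.supp, hd]

end Conducts

/-! ### Functorial promotion -/

section Promotion

variable {Ω : Type*} [Monoid Ω] {m : Ω → ℝ≥0∞} {Γ : Subgroup ℝˣ} {ρ : I × I ≃ᵐ I}
  (hm : ∀ u v : Ω, m (u * v) = m (v * u))
  (hΓ : ∀ α ∈ Γ, ∀ w : Ω, ENNReal.ofReal |(α : ℝ)| * m w = m w)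
  (hρ : MeasurePreserving ρ volume volume)
  {VA VB : Set X} {θA θB : X ≃ᵐ X} (L : Graphing.Layout VA VB θA θB)
  (hθA : Microcosm ρ Γ (θA.prodCongr (MeasurableEquiv.refl I)))
  (hθA' : Microcosm ρ Γ (θA.symm.prodCongr (MeasurableEquiv.refl I)))
  (hθB : Microcosm ρ Γ (θB.prodCongr (MeasurableEquiv.refl I)))
  (hθB' : Microcosm ρ Γ (θB.symm.prodCongr (MeasurableEquiv.refl I)))
  (hP : (L.prom ρ : Graphing Ω).InMicrocosm ρ Γ)

theorem prom_supp_eq (ρ : I × I ≃ᵐ I) : (L.prom ρ : Graphing Ω).supp =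
    (bangSupp (θA '' VA) ∪ bangSupp (VA ∪ VB)) ∪ bangSupp (θB '' VB) := by
  ext x
  have h : x ∈ bangSupp (VA ∪ VB) ↔ x ∈ bangSupp VA ∨ x ∈ bangSupp VB := Iff.rfl
  rw [Graphing.mem_prom_supp, Set.mem_union, Set.mem_union, h]
  tauto

include L in
theorem Graphing.Layout.disjoint_conclusion :
    Disjoint (bangSupp (θA '' VA) ∪ bangSupp (VA ∪ VB)) (bangSupp (θB '' VB)) :=
  Set.disjoint_union_left.2 ⟨disjoint_bangSupp L.left'_right',
    disjoint_bangSupp (Set.disjoint_union_left.2 ⟨L.left_right', L.right_right'⟩)⟩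

include hm hΓ hρ L hθA hθA' hθB hθB' hP

/-- The promotion graphing sends the perennisations of the arguments to the perennisation of the
result. -/
theorem nondeg_prom_tensor {A B : Set (Project Ω)} (hA : IsConduct m ρ Γ VA A)
    (hB : IsConduct m ρ Γ VB B) (hB0 : ∀ b ∈ B, b.wager = 0) {A₀ F : Graphing Ω}
    (hA₀ : Project.single A₀ ∈ Project.mapX θA '' A)
    (hF : Project.single F ∈ lolli m ρ Γ VA VB A B) {t : Project Ω}
    (ht : t ∈ polar m ρ Γ (bangSupp (θB '' VB))
      {c | ∃ D : Graphing Ω, Project.single D ∈ Project.mapX θB '' B ∧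
        c = Project.single D.bang}) :
    Project.Nondeg (((Project.single (L.prom ρ)).exec m ρ
      ((Project.single A₀.bang).exec m ρ (Project.single F.bang))).meas m t) := by
  obtain ⟨a, ha, haA⟩ := hA₀
  obtain ⟨G, rfl, rfl⟩ := Project.eq_single_of_mapX haA
  have hGA : Project.single G ∈ bipolar m ρ Γ VA A := by rwa [hA.2]
  have hGs : G.supp = VA := hGA.1
  have hGm : G.InMicrocosm ρ Γ := hGA.2.1 ()
  have hFs : F.supp = VA ∪ VB := hF.1
  have hFm : F.InMicrocosm ρ Γ := hF.2.1 ()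
  have hFG := hF.2.2 _ ha
  have hFGb : (Project.single F).exec m ρ (Project.single G) ∈ bipolar m ρ Γ VB B := by
    rw [hB.2]
    exact hFG
  have hGc := hGm.compat hρ hΓ
  have hFc := hFm.compat hρ hΓ
  -- The measurement is the wager of the execution of the two projects, which belongs to `B`. Here
  -- the assumption on the wagers of `B` is used.
  have h0 : Graphing.meas m F G = 0 := by
    refine toW_eq_zero ?_
    rw [← Project.meas_single]
    exact hB0 _ hFG
  have h0' : Graphing.meas m G F = 0 := by rw [Graphing.meas_comm hm hρ hGc hFc, h0]
  -- the result
  have hsupp : (G.exec ρ F).supp = VB := by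
    show symmDiff G.supp F.supp = VB
    rw [hGs, hFs, symmDiff_comm]
    have h2 : symmDiff F.supp G.supp = VB := hFGb.1
    rwa [hGs, hFs] at h2
  have hDm : (G.exec ρ F).InMicrocosm ρ Γ := hGm.exec hFm
  -- By definition of `⊸`, it is `F ⋈ G` that lies in `B`. As `B` is bi-orthogonally closed and
  -- tests give `G ⋈ F` the same measurements, `G ⋈ F` lies in it too.
  have hDB : Project.single (G.exec ρ F) ∈ B := by
    rw [← hB.2]
    refine ⟨hsupp, fun _ => hDm, fun T hT => ?_⟩
    have h1 := hFGb.2.2 T hT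
    have hTc := hT.2.1.compat hρ hΓ
    refine ⟨hsupp.trans hT.1.symm, ?_⟩
    have h2 : ((Project.single G).exec m ρ (Project.single F)).AEEq
        (Project.single (G.exec ρ F)) :=
      Project.exec_single_aeEq (by rw [Project.meas_single, h0', toW_zero]) (.refl _)
    have h3 : (Project.single G).InMicrocosm ρ Γ := fun _ => hGm
    have h4 : (Project.single F).InMicrocosm ρ Γ := fun _ => hFm
    have hd : (Project.single F).supp ∩ (Project.single G).supp ∩ T.supp = ∅ := by
      show F.supp ∩ G.supp ∩ T.supp = ∅
      rw [hGs, hT.1, Set.inter_assoc, Set.disjoint_iff_inter_eq_empty.1 L.left_right,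
        Set.inter_empty]
    rw [← h2.meas_eq hm ((h3.exec h4).compat hρ hΓ) (fun _ => hDm.compat hρ hΓ) hTc,
      ← exec_comm_meas hm hΓ hρ h4 h3 hT.2.1 hd]
    exact h1.2
  -- what the promotion graphing computes
  have hA₀m : (G.mapX θA).bang.InMicrocosm ρ Γ := (hGm.mapX hθA hθA').bang
  have hCm : (Graphing.promArg ρ θA G F).InMicrocosm ρ Γ := hA₀m.exec hFm.bang
  have hd := Graphing.disjoint_tensor_supp L G F hGs hFs
  have hC0 : Graphing.meas m (G.mapX θA).bang F.bang = 0 :=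
    Graphing.meas_eq_zero_of_disjoint hm (hA₀m.compat hρ hΓ) (hFm.bang.compat hρ hΓ) hd
  have hP0 : Graphing.meas m (L.prom ρ) (Graphing.promArg ρ θA G F) = 0 :=
    Graphing.meas_prom_eq_zero hm hρ L hGs hFs (hP.compat hρ hΓ) (hCm.compat hρ hΓ) hGc hFc h0'
  have hD'm : ((G.exec ρ F).mapX θB).bang.InMicrocosm ρ Γ := (hDm.mapX hθB hθB').bang
  have key : ((Project.single (L.prom ρ)).exec m ρ
      ((Project.single (G.mapX θA).bang).exec m ρ (Project.single F.bang))).AEEq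
      (Project.single ((G.exec ρ F).mapX θB).bang) := by
    refine Project.exec_tensor_aeEq ?_ ?_
    · rw [Project.meas_tensor hC0]
      exact congrArg toW hP0
    · exact ((Graphing.prom_exec_aeEq ρ L G F hGs hFs hρ hθA hθB' hGm.bang hFm.bang).trans_eEq
        ((Graphing.merge_exec_twist_eEq ρ G F hρ).mapX θB)).trans_eEq
        (Graphing.bang_mapX_eEq _ L.shallow_right)
  have hPp : (Project.single (L.prom ρ : Graphing Ω)).InMicrocosm ρ Γ := fun _ => hP
  have hA₀p : (Project.single (G.mapX θA).bang).InMicrocosm ρ Γ := fun _ => hA₀m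
  have hFp : (Project.single F.bang).InMicrocosm ρ Γ := fun _ => hFm.bang
  have htc := ht.2.1.compat hρ hΓ
  have hD'c : (Project.single ((G.exec ρ F).mapX θB).bang).Compat m :=
    fun _ => hD'm.compat hρ hΓ
  rw [key.meas_eq hm ((hPp.exec (hA₀p.exec hFp)).compat hρ hΓ) hD'c htc]
  exact ((ht.2.2 _ ⟨(G.exec ρ F).mapX θB, ⟨_, hDB, rfl⟩, rfl⟩).symm hm hρ htc hD'c).2

/-- The conclusion is a bi-orthogonal, so only measurements against tests `t` matter. By the
adjunctions these are measurements of `prom ⋈ t` against elements of the tensor product, and an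
orthogonality that holds on generators extends to the bi-orthogonal closure. This is used for the
tensor product and for both perennised conducts. -/
theorem prom_mem_lolli {A B : Set (Project Ω)} (hA : IsConduct m ρ Γ VA A)
    (hB : IsConduct m ρ Γ VB B) (hB0 : ∀ b ∈ B, b.wager = 0) :
    Project.single (L.prom ρ) ∈
      lolli m ρ Γ (bangSupp (θA '' VA) ∪ bangSupp (VA ∪ VB)) (bangSupp (θB '' VB))
        (tensor m ρ Γ (bangSupp (θA '' VA)) (bangSupp (VA ∪ VB))
          (ofCourse m ρ Γ (θA '' VA) (Project.mapX θA '' A))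
          (ofCourse m ρ Γ (VA ∪ VB) (lolli m ρ Γ VA VB A B)))
        (ofCourse m ρ Γ (θB '' VB) (Project.mapX θB '' B)) := by
  have hPp : (Project.single (L.prom ρ : Graphing Ω)).InMicrocosm ρ Γ := fun _ => hP
  have hPs : (Project.single (L.prom ρ : Graphing Ω)).supp =
      (bangSupp (θA '' VA) ∪ bangSupp (VA ∪ VB)) ∪ bangSupp (θB '' VB) :=
    prom_supp_eq (Ω := Ω) L ρ
  have hPd := Graphing.symmDiff_prom_supp (Ω := Ω) ρ L
  have hd3 := L.disjoint_conclusion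
  have hd12 := L.disjoint_tensor
  have hinter : ∀ {U V W : Set X}, Disjoint V W → U ∩ V ∩ W = ∅ := fun h => by
    rw [Set.inter_assoc, Set.disjoint_iff_inter_eq_empty.1 h, Set.inter_empty]
  refine ⟨hPs, hPp, fun c hc => ⟨?_, hPp.exec hc.2.1, fun t ht => ⟨?_, ?_⟩⟩⟩
  · show symmDiff _ c.supp = _
    rw [hc.1]
    exact hPd
  · show symmDiff _ c.supp = _
    rw [hc.1, ht.1]
    exact hPd
  have htm := ht.2.1
  -- the test, moved to the side of the promotion graphing
  have hPtm : ((Project.single (L.prom ρ)).exec m ρ t).InMicrocosm ρ Γ := hPp.exec htm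
  have hPts : ((Project.single (L.prom ρ)).exec m ρ t).supp =
      bangSupp (θA '' VA) ∪ bangSupp (VA ∪ VB) := by
    show symmDiff (Project.single (L.prom ρ : Graphing Ω)).supp t.supp = _
    rw [hPs, ht.1]
    exact symmDiff_union_right hd3
  have hPt : (Project.single (L.prom ρ)).exec m ρ t ∈
      polar m ρ Γ (bangSupp (θA '' VA) ∪ bangSupp (VA ∪ VB))
        {c | ∃ a ∈ ofCourse m ρ Γ (θA '' VA) (Project.mapX θA '' A),
          ∃ f ∈ ofCourse m ρ Γ (VA ∪ VB) (lolli m ρ Γ VA VB A B), c = a.exec m ρ f} := by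
    refine ⟨hPts, hPtm, ?_⟩
    rintro _ ⟨a, ha, f, hf, rfl⟩
    have has : a.supp = bangSupp (θA '' VA) := ha.1
    have hfs : f.supp = bangSupp (VA ∪ VB) := hf.1
    have ham : a.InMicrocosm ρ Γ := ha.2.1
    have hfm : f.InMicrocosm ρ Γ := hf.2.1
    refine ⟨?_, ?_⟩
    · rw [hPts]
      show _ = symmDiff a.supp f.supp
      rw [has, hfs, hd12.symmDiff_eq_sup]
      rfl
    -- With `a` moved to the other side, `f` faces a single project of its own support, which only
    -- has to be tested against the generators `!F`.
    rw [← meas_exec_tensor hm hΓ hρ hPtm ham hfm (hinter (by rwa [has, hfs]))]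
    refine ((hf.2.2 (((Project.single (L.prom ρ)).exec m ρ t).exec m ρ a)
      ⟨?_, hPtm.exec ham, ?_⟩).symm hm hρ (hfm.compat hρ hΓ)
      ((hPtm.exec ham).compat hρ hΓ)).2
    · show symmDiff ((Project.single (L.prom ρ)).exec m ρ t).supp a.supp = _
      rw [hPts, has]
      exact symmDiff_union_left hd12
    rintro _ ⟨F, hF, rfl⟩
    have hFs : (Project.single F.bang).supp = bangSupp (VA ∪ VB) := congrArg bangSupp hF.1
    have hFm : (Project.single F.bang).InMicrocosm ρ Γ := fun _ => (hF.2.1 ()).bang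
    refine ⟨?_, ?_⟩
    · show symmDiff ((Project.single (L.prom ρ)).exec m ρ t).supp a.supp = _
      rw [hPts, has, hFs]
      exact symmDiff_union_left hd12
    rw [meas_exec_exec hm hΓ hρ hPtm ham hFm (hinter (by rwa [has, hFs]))]
    have hs2 : (((Project.single (L.prom ρ)).exec m ρ t).exec m ρ (Project.single F.bang)).supp =
        bangSupp (θA '' VA) := by
      show symmDiff ((Project.single (L.prom ρ)).exec m ρ t).supp _ = _
      rw [hPts, hFs]
      exact symmDiff_union_right hd12
    -- The same for `a`, now that `f` has been replaced by a perennisation.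
    refine ((ha.2.2 (((Project.single (L.prom ρ)).exec m ρ t).exec m ρ (Project.single F.bang))
      ⟨hs2, hPtm.exec hFm, ?_⟩).symm hm hρ (ham.compat hρ hΓ) ((hPtm.exec hFm).compat hρ hΓ)).2
    rintro _ ⟨A₀, hA₀, rfl⟩
    obtain ⟨a₀, ha₀, ha₀A⟩ := hA₀
    have ha₀b : a₀ ∈ bipolar m ρ Γ VA A := by rwa [hA.2]
    have hAs : (Project.single A₀.bang).supp = bangSupp (θA '' VA) := by
      have h1 := congrArg Project.supp ha₀A
      have h2 : θA '' a₀.supp = A₀.supp := h1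
      rw [ha₀b.1] at h2
      exact congrArg bangSupp h2.symm
    have hAm : (Project.single A₀.bang).InMicrocosm ρ Γ := by
      obtain ⟨G, rfl, rfl⟩ := Project.eq_single_of_mapX ha₀A
      exact fun _ => ((ha₀b.2.1 ()).mapX hθA hθA').bang
    refine ⟨hs2.trans hAs.symm, ?_⟩
    -- Both arguments are now perennisations. They are regrouped into a tensor product, and the test
    -- is moved back out of the execution.
    rw [meas_exec_exec hm hΓ hρ hPtm hFm hAm (hinter (by rw [hAs, hFs]; exact hd12.symm)),
      meas_exec_tensor hm hΓ hρ hPtm hAm hFm (hinter (by rwa [hAs, hFs])),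
      meas_exec_exec hm hΓ hρ hPp htm (hAm.exec hFm) (hinter ?_)]
    · exact nondeg_prom_tensor hm hΓ hρ L hθA hθA' hθB hθB' hP hA hB hB0 ⟨a₀, ha₀, ha₀A⟩ hF ht
    · show Disjoint t.supp (symmDiff (Project.single A₀.bang).supp (Project.single F.bang).supp)
      rw [hAs, hFs, hd12.symmDiff_eq_sup, ht.1]
      exact hd3.symm
  rw [meas_exec_exec hm hΓ hρ hPp hc.2.1 htm (hinter (by rw [hc.1, ht.1]; exact hd3))]
  exact ((hc.2.2 _ hPt).symm hm hρ (hc.2.1.compat hρ hΓ) (hPtm.compat hρ hΓ)).2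

/-- What the promotion graphing computes on perennisations. -/
theorem prom_exec_tensor_aeEq {A B : Set (Project Ω)} (hA : IsConduct m ρ Γ VA A)
    (hB : IsConduct m ρ Γ VB B) (hB0 : ∀ b ∈ B, b.wager = 0) {G F : Graphing Ω}
    (hG : Project.single (G.mapX θA).bang ∈
      ofCourse m ρ Γ (θA '' VA) (Project.mapX θA '' A))
    (hF : Project.single F.bang ∈ ofCourse m ρ Γ (VA ∪ VB) (lolli m ρ Γ VA VB A B)) :
    Project.AEEq
      ((Project.single (L.prom ρ)).exec m ρ
        ((Project.single (G.mapX θA).bang).exec m ρ (Project.single F.bang)))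
      (Project.single (((G.bang.exec ρ (F.bang.mapX (twist ρ))).mapX (merge ρ)).mapX θB)) := by
  have hGs : G.supp = VA := θA.injective.image_injective (bangSupp_injective hG.1)
  have hFs : F.supp = VA ∪ VB := bangSupp_injective hF.1
  have hGm : G.bang.InMicrocosm ρ Γ :=
    Graphing.InMicrocosm.of_bang_mapX L.shallow_left (hG.2.1 ()) hθA hθA'
  refine Project.exec_tensor_aeEq ?_
    (Graphing.prom_exec_aeEq ρ L G F hGs hFs hρ hθA hθB' hGm (hF.2.1 ()))
  -- For perennisations that merely lie in the closures, nothing says that `⟦G, F⟧` vanishes. That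
  -- the result has wager `0` follows from its membership in `!θB(B)`.
  have hmem := prom_mem_lolli hm hΓ hρ L hθA hθA' hθB hθB' hP hA hB hB0
  have hC := subset_bipolar hm hΓ hρ (V := bangSupp (θA '' VA) ∪ bangSupp (VA ∪ VB))
    (T := {c | ∃ a ∈ ofCourse m ρ Γ (θA '' VA) (Project.mapX θA '' A),
      ∃ f ∈ ofCourse m ρ Γ (VA ∪ VB) (lolli m ρ Γ VA VB A B), c = a.exec m ρ f}) ?_
    ⟨_, hG, _, hF, rfl⟩
  · refine wager_eq_zero hm hΓ hρ
      (measurableSet_bangSupp (θB.measurableSet_image.2 L.measurable_right)) ?_ (hmem.2.2 _ hC)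
    rintro _ ⟨D, ⟨b, hb, hbD⟩, rfl⟩
    refine ⟨_, rfl, congrArg bangSupp ?_⟩
    rw [← hB.2] at hb
    have h2 : θB '' b.supp = D.supp := congrArg Project.supp hbD
    rw [← h2, hb.1]
  · rintro _ ⟨a, ha, f, hf, rfl⟩
    refine ⟨?_, ha.2.1.exec hf.2.1⟩
    show symmDiff a.supp f.supp = _
    rw [ha.1, hf.1, L.disjoint_tensor.symmDiff_eq_sup]
    rfl

end Promotion
end IG
theorem mainTheorem2 {Ω : Type*} [Monoid Ω] (m : Ω → ℝ≥0∞)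
    (hm : ∀ u v : Ω, m (u * v) = m (v * u))
    (Γ : Subgroup ℝˣ) (hΓ : ∀ α ∈ Γ, ∀ w : Ω, ENNReal.ofReal |(α : ℝ)| * m w = m w)
    (ρ : I × I ≃ᵐ I) (hρ : MeasurePreserving ρ volume volume)
    (VA VB : Set X) (hVA : MeasurableSet VA) (hVB : MeasurableSet VB)
    (αA αB : ℝˣ) (hαA : αA ∈ Γ) (hαB : αB ∈ Γ) (lA lB : ℝ)
    (θA θB : X ≃ᵐ X) (hθA : θA = affineX αA lA) (hθB : θB = affineX αB lB)
    (hAB : Disjoint VA VB) (hAA : Disjoint VA (θA '' VA)) (hBA : Disjoint VB (θA '' VA))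
    (hAB' : Disjoint VA (θB '' VB)) (hBB' : Disjoint VB (θB '' VB))
    (hA'B' : Disjoint (θA '' VA) (θB '' VB))
    (A B : Set (Project Ω)) (hA : IsConduct m ρ Γ VA A) (hB : IsConduct m ρ Γ VB B)
    (hB0 : ∀ b ∈ B, b.wager = 0) :
    -- functorial promotion: `prom` belongs to `(!A' ⊗ !(A ⊸ B)) ⊸ !B'`
    Project.single (Graphing.prom ρ VA VB hVA hVB θA θB) ∈
      lolli m ρ Γ (bangSupp (θA '' VA) ∪ bangSupp (VA ∪ VB)) (bangSupp (θB '' VB))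
        (tensor m ρ Γ (bangSupp (θA '' VA)) (bangSupp (VA ∪ VB))
          (ofCourse m ρ Γ (θA '' VA) (Project.mapX θA '' A))
          (ofCourse m ρ Γ (VA ∪ VB) (lolli m ρ Γ VA VB A B)))
        (ofCourse m ρ Γ (θB '' VB) (Project.mapX θB '' B)) ∧
    -- what `prom` computes
    ∀ G F : Graphing Ω,
      Project.single (G.mapX θA).bang ∈ ofCourse m ρ Γ (θA '' VA) (Project.mapX θA '' A) →
      Project.single F.bang ∈ ofCourse m ρ Γ (VA ∪ VB) (lolli m ρ Γ VA VB A B) →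
      Project.AEEq
        ((Project.single (Graphing.prom ρ VA VB hVA hVB θA θB)).exec m ρ
          ((Project.single (G.mapX θA).bang).exec m ρ (Project.single F.bang)))
        (Project.single
          (((G.bang.exec ρ (F.bang.mapX (twist ρ))).mapX (merge ρ)).mapX θB)) ∧
      ∃ D : Graphing Ω, D.IsVariant (F.exec ρ G) ∧
        Graphing.AEEq ((G.bang.exec ρ (F.bang.mapX (twist ρ))).mapX (merge ρ)) D.bang := by
  subst hθA hθB
  let L : Graphing.Layout VA VB (affineX αA lA) (affineX αB lB) :=
    ⟨hVA, hVB, shallow_affineX _ _, shallow_affineX _ _, hAB, hAA, hBA, hAB', hBB', hA'B'⟩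
  have h1 := Microcosm.affineX_id (ρ := ρ) hαA lA
  have h2 := Microcosm.affineX_symm_id (ρ := ρ) hαA lA
  have h3 := Microcosm.affineX_id (ρ := ρ) hαB lB
  have h4 := Microcosm.affineX_symm_id (ρ := ρ) hαB lB
  have hP : (L.prom ρ : Graphing Ω).InMicrocosm ρ Γ :=
    Graphing.prom_inMicrocosm hVA hVB hαA hαB lA lB
  refine ⟨prom_mem_lolli hm hΓ hρ L h1 h2 h3 h4 hP hA hB hB0, fun G F hG hF =>
    ⟨prom_exec_tensor_aeEq hm hΓ hρ L h1 h2 h3 h4 hP hA hB hB0 hG hF, G.exec ρ F,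
      Graphing.exec_isVariant ρ G F hρ, (Graphing.merge_exec_twist_eEq ρ G F hρ).aeEq⟩⟩
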